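/- **Setting.** Let $n_v,n_h,N,L$ be natural numbers and $n=n_v+n_h$. Let $H=\sum_{l=1}^L\alpha_lU_l$ be Hermitian on $n_v$ qubits, with $\alpha_l\ge 0$ and $U_l$ unitary, and let $\rho=e^{-H}/\mathrm{Tr}(e^{-H})$. Let $H_1,\dots,H_N$ be Hermitian and unitary on $n_v+n_h$ qubits, and for $\theta\in\mathbb R^N$ put $$\sigma_v(\theta)=\mathrm{Tr}_h\Big[\prod_{j=1}^N e^{-iH_j\theta_j}\,|0\rangle\langle 0|\,\prod_{j=N}^1 e^{iH_j\theta_j}\Big],\qquad \widetilde D_2(\sigma_v\|\rho)=\log\mathrm{Tr}(\sigma_v^2\rho^{-1}).$$ The Hamiltonian and the network are accessible only through unit-cost queries, each also in inverse form and in singly controlled form, to * Select (which is the same as $\mathcal O_U$): $|l\rangle|\psi\rangle\mapsto|l\rangle U_l|\psi\rangle$; * $\mathcal O_{\exp}(t)$, $t\in\mathbb R$: $|j\rangle|\psi\rangle\mapsto|j\rangle e^{-iH_jt}|\psi\rangle$; * Prepare at a truncation order $K\in\mathbb N$ of the algorithm's choice: a unitary with $|0\rangle\mapsto\frac1{\sqrt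 s}\sum_{k\le K}\sum_{l_1,\dots,l_k}\sqrt{\frac{\alpha_{l_1}\cdots\alpha_{l_k}}{2^kk!}}\,|k,l_1,\dots,l_k\rangle$, where $s=\sum_{k\le K}\frac{\|\alpha\|_1^k}{2^kk!}\le e^{\|\alpha\|_1/2}$. An algorithm is a quantum circuit of single-qubit gates, Toffoli gates and queries, acting on qubits initialized to $|0\rangle$, followed by a measurement of all qubits in the computational basis and a real-valued function of the outcome. The gate count is the number of single-qubit and Toffoli gates; queries are counted separately. **Theorem (coherent algorithm for thermal state learning).** There are universal constants $C,c$ such that the following holds. Let $n_v,n_h,N,L$, $\theta\in\mathbb R^N$, $k\in\{1,\dots,N\}$, $\epsilon>0$, $A\in\mathbb R$, $Z>0$ and $p>0$ be given. Then there is one algorithm, depending only on these data, that makes at most $$C\,\Lambda^c\;\frac{N+\sqrt{e^{A}2^{n_v}/Z}}{\epsilon\,p}\ \text{ queries}\qquad\text{and uses at most}\qquad C\,\Lambda^c\;\frac{(L+n)\sqrt{e^{A}2^{n_v}/Z}}{\epsilon\,p}\ \text{ gates},$$ where $\Lambda=\log\!\big(2+N+L+n+e^{A}2^{n_v}/(\epsilon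 p)\big)$, and that does the following for every choice of $\alpha$, $U_l$, $H_j$ and Prepare unitaries as above with $\|\alpha\|_1\le A$, $\mathrm{Tr}(e^H)\ge Z$, $\mathrm{Tr}(\sigma_v^2e^H/\mathrm{Tr}(e^H))\ge p$ and $\epsilon\le\frac{13}{2\mathrm{Tr}(\sigma_v^2\rho^{-1})}$: the partial derivative $\partial_{\theta_k}\widetilde D_2(\sigma_v\|\rho)$ exists, and with probability greater than $2/3$ the algorithm outputs an $\mathcal E$ with $|\mathcal E-\partial_{\theta_k}\widetilde D_2(\sigma_v\|\rho)|\le\epsilon$. In particular (with $A=\|\alpha\|_1$, $Z=\mathrm{Tr}(e^H)$, $p=\mathrm{Tr}(\sigma_v^2e^H/\mathrm{Tr}(e^H))$), the query count is $\widetilde O\Big(\frac{N+\sqrt{e^{\|\alpha\|_1}2^{n_v}/\mathrm{Tr}(e^H)}}{\epsilon\,\mathrm{Tr}(\sigma_v^2e^H/\mathrm{Tr}(e^H))}\Big)$ and the gate count is $\widetilde O\Big(\frac{(L+n)\sqrt{e^{\|\alpha\|_1}2^{n_v}/\mathrm{Tr}(e^H)}}{\epsilon\,\mathrm{Tr}(\sigma_v^2e^H/\mathrm{Tr}(e^H))}\Big)$.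 -/

import Mathlib

open scoped Matrix Nat

noncomputable section

/-- Operators on a register whose qubits are labelled by `ι`; the computational basis states
are the assignments `ι → Bool`. -/
abbrev QOp (ι : Type) : Type := Matrix (ι → Bool) (ι → Bool) ℂ

/-! ### Unitary quantum neural networks and the thermal target -/

/-- `e^{-iGt}`. -/
def evolve {ι : Type} [Fintype ι] [DecidableEq ι] (G : QOp ι) (t : ℝ) : QOp ι :=
  NormedSpace.exp ((-(Complex.I * (t : ℂ))) • G)

/-- The network unitary `e^{-iG₁θ₁} e^{-iG₂θ₂} ⋯ e^{-iG_Nθ_N}` (leftmost factor first). -/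
def qnnUnitary {ι : Type} [Fintype ι] [DecidableEq ι] {N : ℕ} (G : Fin N → QOp ι)
    (θ : Fin N → ℝ) : QOp ι :=
  (List.ofFn fun j => evolve (G j) (θ j)).prod

/-- The projector `|0⟩⟨0|` on the all-zero basis state. -/
def zeroProj (ι : Type) [Fintype ι] [DecidableEq ι] : QOp ι :=
  Matrix.single (fun _ => false) (fun _ => false) 1

/-- The partial trace over the second register. -/
def traceOut {ι κ : Type} [Fintype κ] [DecidableEq κ] (M : QOp (ι ⊕ κ)) : QOp ι :=
  fun x y => ∑ h : κ → Bool, M (Sum.elim x h) (Sum.elim y h)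

/-- The visible output state of the network: visible qubits `ι`, hidden qubits `κ`. -/
def visibleState {ι κ : Type} [Fintype ι] [DecidableEq ι] [Fintype κ] [DecidableEq κ] {N : ℕ}
    (G : Fin N → QOp (ι ⊕ κ)) (θ : Fin N → ℝ) : QOp ι :=
  traceOut (qnnUnitary G θ * zeroProj (ι ⊕ κ) * (qnnUnitary G θ)ᴴ)

/-- The thermal state `e^{-H} / Tr e^{-H}`. -/
def thermalState {ι : Type} [Fintype ι] [DecidableEq ι] (H : QOp ι) : QOp ι :=
  (NormedSpace.exp (-H)).trace⁻¹ • NormedSpace.exp (-H)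

/-- `Tr (σ² ρ⁻¹)`. -/
def overlap {ι : Type} [Fintype ι] [DecidableEq ι] (σ ρ : QOp ι) : ℝ :=
  ((σ ^ 2 * ρ⁻¹).trace).re

/-- The maximal Rényi divergence of order two, `log Tr (σ² ρ⁻¹)`. -/
def renyiTwo {ι : Type} [Fintype ι] [DecidableEq ι] (σ ρ : QOp ι) : ℝ :=
  Real.log (overlap σ ρ)

/-! ### The oracles -/

/-- Value of a bit string, least significant bit first. -/
def bitsVal {a : ℕ} (b : Fin a → Bool) : ℕ := ∑ i, if b i then 2 ^ (i : ℕ) else 0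

open Classical in
/-- `|j⟩|ψ⟩ ↦ |j⟩ V_j |ψ⟩`, with the index `j < L` in binary on `⌈log₂ L⌉` qubits; unused
index values act trivially. -/
def multiplexed {ι : Type} {L : ℕ} (V : Fin L → QOp ι) : QOp (Fin (Nat.clog 2 L) ⊕ ι) :=
  fun x y =>
    if x ∘ Sum.inl = y ∘ Sum.inl then
      if h : bitsVal (x ∘ Sum.inl) < L then V ⟨_, h⟩ (x ∘ Sum.inr) (y ∘ Sum.inr)
      else if x ∘ Sum.inr = y ∘ Sum.inr then 1 else 0
    else 0

/-- The register of the Prepare operation truncated at order `K`: a counter in unary and `K`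
index registers. -/
abbrev PrepReg (L K : ℕ) : Type := Fin K ⊕ (Fin K × Fin (Nat.clog 2 L))

/-- The basis state `|k, l₁, …, l_k⟩`; index registers beyond the `k`-th are zero. -/
def prepKet {L : ℕ} (K k : ℕ) (l : Fin k → Fin L) : PrepReg L K → Bool
  | Sum.inl i => decide ((i : ℕ) < k)
  | Sum.inr (i, b) => if h : (i : ℕ) < k then Nat.testBit (l ⟨i, h⟩ : ℕ) (b : ℕ) else false

/-- The normalization `s = ∑_{k ≤ K} (‖α‖₁ / 2)^k / k!`. -/
def prepNorm {L : ℕ} (α : Fin L → ℝ) (K : ℕ) : ℝ :=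
  ∑ k ∈ Finset.range (K + 1), (∑ l, |α l|) ^ k / (2 ^ k * (k ! : ℝ))

/-- `s^{-1/2} ∑_{k ≤ K} ∑_{l₁,…,l_k} √(α_{l₁} ⋯ α_{l_k} / (2^k k!)) |k, l₁, …, l_k⟩`. -/
def prepState {L : ℕ} (α : Fin L → ℝ) (K : ℕ) : (PrepReg L K → Bool) → ℂ :=
  ((1 / √(prepNorm α K) : ℝ) : ℂ) •
    ∑ k ∈ Finset.range (K + 1), ∑ l : Fin k → Fin L,
      ((√((∏ i, α (l i)) / (2 ^ k * (k ! : ℝ))) : ℝ) : ℂ) • Pi.single (prepKet K k l) (1 : ℂ)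

/-- The data hidden behind the oracles: a Hamiltonian `∑ α_l U_l` on `nv` visible qubits given
as a linear combination of unitaries, the `N` generators of the network (Hermitian and unitary)
on `nv + nh` qubits, and unitaries implementing Prepare, of which only the action on the zero
state is prescribed. -/
structure ThermalInstance (nv nh N L : ℕ) where
  /-- coefficients of the Hamiltonian -/
  α : Fin L → ℝ
  /-- unitaries of the Hamiltonian -/
  U : Fin L → QOp (Fin nv)
  /-- generators of the network -/
  G : Fin N → QOp (Fin nv ⊕ Fin nh)
  /-- Prepare, for every truncation order -/
  prep : ∀ K : ℕ, QOp (PrepReg L K)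
  α_nonneg : ∀ l, 0 ≤ α l
  U_unitary : ∀ l, U l ∈ Matrix.unitaryGroup (Fin nv → Bool) ℂ
  ham_hermitian : (∑ l, (α l : ℂ) • U l).IsHermitian
  G_unitary : ∀ j, G j ∈ Matrix.unitaryGroup (Fin nv ⊕ Fin nh → Bool) ℂ
  G_hermitian : ∀ j, (G j).IsHermitian
  prep_unitary : ∀ K, prep K ∈ Matrix.unitaryGroup (PrepReg L K → Bool) ℂ
  prep_zero : ∀ K, prep K *ᵥ Pi.single (fun _ => false) 1 = prepState α K

namespace ThermalInstance

variable {nv nh N L : ℕ} (I : ThermalInstance nv nh N L)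

/-- `H = ∑ α_l U_l`. -/
def ham : QOp (Fin nv) := ∑ l, (I.α l : ℂ) • I.U l

/-- `‖α‖₁`. -/
def alphaNorm : ℝ := ∑ l, |I.α l|

/-- The target state `ρ = e^{-H} / Tr e^{-H}`. -/
def target : QOp (Fin nv) := thermalState I.ham

/-- The output `σ_v` of the network on the visible qubits. -/
def sigma (θ : Fin N → ℝ) : QOp (Fin nv) := visibleState I.G θ

/-- `Tr e^H`. -/
def partition : ℝ := ((NormedSpace.exp I.ham).trace).re

/-- `Tr (σ_v² e^H / Tr e^H)`. -/
def normOverlap (θ : Fin N → ℝ) : ℝ :=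
  ((I.sigma θ ^ 2 * ((NormedSpace.exp I.ham).trace⁻¹ • NormedSpace.exp I.ham)).trace).re

end ThermalInstance

/-- The oracles: Select, the evolution oracle at time `t`, and Prepare at order `K`. -/
inductive Oracle : Type
  | select : Oracle
  | evolution (t : ℝ) : Oracle
  | prepare (K : ℕ) : Oracle

/-- The qubits that an oracle acts on. -/
abbrev Oracle.Reg (nv nh N L : ℕ) : Oracle → Type
  | .select => Fin (Nat.clog 2 L) ⊕ Fin nv
  | .evolution _ => Fin (Nat.clog 2 N) ⊕ (Fin nv ⊕ Fin nh)
  | .prepare K => PrepReg L K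

/-- The operator that an oracle applies. -/
def Oracle.op {nv nh N L : ℕ} (I : ThermalInstance nv nh N L) :
    (o : Oracle) → QOp (o.Reg nv nh N L)
  | .select => multiplexed I.U
  | .evolution t => multiplexed fun j => evolve (I.G j) t
  | .prepare K => I.prep K

/-! ### Circuits -/

open Classical in
/-- The operator `M`, applied to the wires `e` of a larger register. -/
def applyOn {ι κ : Type} (e : ι ↪ κ) (M : QOp ι) : QOp κ :=
  fun x y => if ∀ w, w ∉ Set.range e → x w = y w then M (x ∘ e) (y ∘ e) else 0

open Classical in
/-- The singly controlled version of `M`; the control qubit is `none`. -/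
def controlled {ι : Type} (M : QOp ι) : QOp (Option ι) :=
  fun x y =>
    if x none = y none then
      if x none = true then M (x ∘ some) (y ∘ some)
      else if x ∘ some = y ∘ some then 1 else 0
    else 0

/-- A single-qubit matrix as an operator on a one-qubit register. -/
def singleOp (u : Matrix Bool Bool ℂ) : QOp Unit := fun x y => u (x ()) (y ())

/-- The Toffoli gate: qubit `2` is flipped if qubits `0` and `1` are both set. -/
def toffoliOp : QOp (Fin 3) :=
  fun x y => if x = Function.update y 2 (xor (y 2) (y 0 && y 1)) then 1 else 0

/-- The operations of a circuit on `W` wires: single-qubit gates, Toffoli gates, and queries to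
the oracles or (if `inv` holds) to their inverses, without or with a control. -/
inductive Instr (nv nh N L W : ℕ) : Type
  | single (u : Matrix.unitaryGroup Bool ℂ) (w : Fin W) : Instr nv nh N L W
  | toffoli (e : Fin 3 ↪ Fin W) : Instr nv nh N L W
  | query (o : Oracle) (inv : Bool) (e : o.Reg nv nh N L ↪ Fin W) : Instr nv nh N L W
  | ctrlQuery (o : Oracle) (inv : Bool) (e : Option (o.Reg nv nh N L) ↪ Fin W) :
      Instr nv nh N L W

namespace Instr

variable {nv nh N L W : ℕ}

/-- The operator of an instruction. -/
def op (I : ThermalInstance nv nh N L) : Instr nv nh N L W → QOp (Fin W)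
  | single u w => applyOn ⟨fun _ : Unit => w, fun _ _ _ => rfl⟩ (singleOp u)
  | toffoli e => applyOn e toffoliOp
  | query o inv e => applyOn e (if inv then (o.op I)ᴴ else o.op I)
  | ctrlQuery o inv e => applyOn e (controlled (if inv then (o.op I)ᴴ else o.op I))

/-- Number of elementary gates in an instruction. -/
def gateCost : Instr nv nh N L W → ℕ
  | single _ _ => 1
  | toffoli _ => 1
  | query _ _ _ => 0
  | ctrlQuery _ _ _ => 0

/-- Number of oracle queries in an instruction. -/
def queryCost : Instr nv nh N L W → ℕ
  | single _ _ => 0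
  | toffoli _ => 0
  | query _ _ _ => 1
  | ctrlQuery _ _ _ => 1

end Instr

/-- A quantum algorithm: a circuit on `wires` qubits that start in the zero state and are
all measured at the end, and the estimate read off from the measured bit string. -/
structure QAlgorithm (nv nh N L : ℕ) : Type where
  /-- number of qubits -/
  wires : ℕ
  /-- instructions, in order of time -/
  circuit : List (Instr nv nh N L wires)
  /-- the estimate -/
  output : (Fin wires → Bool) → ℝ

namespace QAlgorithm

variable {nv nh N L : ℕ} (Q : QAlgorithm nv nh N L)

/-- Total number of elementary gates. -/
def gateCount : ℕ := (Q.circuit.map Instr.gateCost).sum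

/-- Total number of oracle queries. -/
def queryCount : ℕ := (Q.circuit.map Instr.queryCost).sum

/-- The state before the measurement. -/
def finalState (I : ThermalInstance nv nh N L) : (Fin Q.wires → Bool) → ℂ :=
  Q.circuit.foldl (fun ψ g => g.op I *ᵥ ψ) (Pi.single (fun _ => false) 1)

open Classical in
/-- The probability that the estimate lies in `S`. -/
def prob (I : ThermalInstance nv nh N L) (S : Set ℝ) : ℝ :=
  ∑ x : Fin Q.wires → Bool, if Q.output x ∈ S then ‖Q.finalState I x‖ ^ 2 else 0

end QAlgorithm

end

noncomputable section

/-! ### Angles determined by their odd multiples -/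

/-! Write $E=e^{H/2}$ and use Frobenius norms. Then
$\mathrm{Tr}(\sigma_v^2\rho^{-1})=\|e^{-H/2}\|^2\|\sigma_vE\|^2$, and the first factor does not
depend on $\theta$, so the derivative sought is the logarithmic derivative of
$f=\|\sigma_vE\|^2/\|E\|^2$. Since $H_k^2=1$, a shift of $\theta_k$ by $t$ makes $f$ a quartic form
in $(\cos t,\sin t)$ with coefficients $\beta_0,\dots,\beta_4$ and values in $[0,1]$; the answer is
$\beta_1/\beta_0$, and five shifts suffice to read it off (`quartic_coeff_one`). Nonnegativity
forces $\beta_1^2\le 49\beta_0$ (`quartic_coeff_one_sq_le`). Therefore values of $\sqrt f$ with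
error $\delta$ give $\beta_1/\beta_0$ with error $O(\delta/p)$ and not only $O(\delta/p^{3/2})$
(`quartic_logDeriv_close`), so that $\delta\sim\epsilon p$ is enough.

The amplitude $\sqrt f$ is produced as follows. Prepare, controlled Selects and inverse Prepare form
a block encoding of $T/s$, where $T$ is the truncated series of $E$ (`sum_selectBlock`). On half of
a maximally entangled state, the flagged amplitudes are the entries of $T$, and the flagged part has
norm $2^{-n_v/2}\|T\|/s\ge 1/(2D)$ with $D=\sqrt{e^A2^{n_v}/Z}$. About $D$ rounds of inner
amplification raise this to a constant. Running the network on fresh qubits, then its inverse on the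
old visible qubits with the same hidden qubits, and projecting onto zero multiplies $T$ by
$\sigma_v$ (`network_encoding_apply`). The flag then has probability
$\kappa\|\sigma_vT\|^2/\|T\|^2$. The factor $\kappa$ is unknown but independent of $\theta$, so it
drops out of the logarithmic derivative (`logDeriv_close_of_scaled`). The right inner depth is
unknown too: all depths with angle multiplier $3^j$, $j\le M$, are tried, and one of them has
$\kappa\ge\frac14$.

Outer amplification by $O(1/\delta)$ rounds resolves $\sqrt{\kappa f}$. The network sits outside the
inner amplification, so each outer round costs about $D+N$ queries and not $DN$. Instead of phase
estimation, each of polylogarithmically many circuits is sampled polylogarithmically often, so that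
its flag probability is known to constant accuracy; by `angle_close` these numbers already determine
the angle up to $2^{-J}$. The output is the derivative of any admissible instance compatible with
the observed frequencies. By `abs_deriv_sub_le_of_signal_close` all such instances agree up to
$\epsilon$, and Chebyshev with a union bound (`sum_prod_frequency_far_le`) controls the failure
probability. -/

/-- The offsets `0, 1, 2, 4, 8, …`. -/
def powOffset : ℕ → ℕ
  | 0 => 0
  | i + 1 => 2 ^ i

lemma abs_sin_nat_mul_pi_sub (n : ℕ) (x : ℝ) : |Real.sin (n * Real.pi - x)| = |Real.sin x| := by
  rw [Real.sin_nat_mul_pi_sub]; simp [abs_mul]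

lemma abs_cos_nat_mul_pi_sub (n : ℕ) (x : ℝ) : |Real.cos (n * Real.pi - x)| = |Real.cos x| := by
  rw [Real.cos_nat_mul_pi_sub]; simp [abs_mul]

/-- Jordan's inequality $\sin x\ge 2x/\pi$, used at $x$ or at $\pi-x$. -/
lemma quarter_le_sin {x : ℝ} (h1 : Real.pi / 8 ≤ x) (h2 : x ≤ 7 * Real.pi / 8) :
    1 / 4 ≤ Real.sin x := by
  have hp := Real.pi_pos
  rcases le_total x (Real.pi / 2) with h | h
  · have := Real.mul_le_sin (by linarith) h
    refine le_trans ?_ this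
    rw [div_mul_eq_mul_div, le_div_iff₀ hp]; linarith
  · have := Real.mul_le_sin (x := Real.pi - x) (by linarith) (by linarith)
    rw [Real.sin_pi_sub] at this
    refine le_trans ?_ this
    rw [div_mul_eq_mul_div, le_div_iff₀ hp]; linarith

/-- The window $(\pi/8,\pi/4]$ spans exactly one octave, so repeated doubling of a small angle hits
it. -/
lemma exists_two_pow_mul_window {x : ℝ} (hx : 0 < x) (hx' : x < Real.pi / 8) :
    ∃ n : ℕ, 1 ≤ n ∧ 2 ^ n * x ≤ Real.pi / 4 ∧ Real.pi / 8 < 2 ^ n * x := by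
  obtain ⟨n, h1, h2⟩ := exists_nat_pow_near (x := Real.pi / 4 / x) (y := 2)
    (by rw [le_div_iff₀ hx]; linarith [Real.pi_pos]) (by norm_num)
  rw [le_div_iff₀ hx] at h1
  rw [div_lt_iff₀ hx, pow_succ] at h2
  refine ⟨n, ?_, h1, by linarith⟩
  by_contra hn
  obtain rfl : n = 0 := by omega
  simp at h2; linarith

lemma abs_sin_sub_le (a b : ℝ) : |Real.sin (a - b)| ≤ |Real.sin a| + |Real.sin b| := by
  rw [Real.sin_sub]
  refine (abs_sub _ _).trans ?_
  rw [abs_mul, abs_mul]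
  have h1 := Real.abs_cos_le_one a
  have h2 := Real.abs_cos_le_one b
  have h3 := abs_nonneg (Real.sin a)
  have h4 := abs_nonneg (Real.sin b)
  nlinarith

/-- Repeated doubling brings the larger angle into the window no later than the smaller one. -/
lemma two_pow_lt_of_window {x y : ℝ} {i j : ℕ} (hx : 0 < x) (hi : 2 ^ i * x ≤ Real.pi / 4)
    (hj : Real.pi / 8 < 2 ^ j * y) (hyx : y ≤ x) : i ≤ j := by
  by_contra hlt
  have h1 : (2 : ℝ) ^ (j + 1) ≤ 2 ^ i := pow_le_pow_right₀ (by norm_num) (by omega)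
  have h2 : (0 : ℝ) < 2 ^ j := by positivity
  rw [pow_succ] at h1
  nlinarith

-- With $s=\chi+\psi$ and $d=\chi-\psi$ one has $\sin^2m\chi-\sin^2m\psi=\sin ms\,\sin md$. If
-- $d>2^{-J}$, choose $j$ with $2^jd$ in the window. For the multipliers $m=2^j+1$ and $m=2^j+1+2^i$
-- the factor $\sin md$ is at least $\frac14$, so $\sin ms$ is small. Subtracting the two angles,
-- $\sin 2^is$ is small for all $1\le i\le j$. That is impossible, because some $2^is$ is itself far
-- from the multiples of $\pi$, unless $s$ is close to $\pi/2$, where the odd multiplier $2^j+1$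
-- decides.
set_option maxHeartbeats 400000 in
lemma angle_close_of_le {J : ℕ} {χ ψ : ℝ} (hψ0 : 0 ≤ ψ) (hle : ψ ≤ χ) (hχ : χ ≤ Real.pi / 2)
    (h : ∀ i ≤ J, ∀ j ≤ J,
      |Real.sin ((2 * (powOffset i + powOffset j) + 1 : ℕ) * χ) ^ 2
        - Real.sin ((2 * (powOffset i + powOffset j) + 1 : ℕ) * ψ) ^ 2| ≤ 1 / 64) :
    χ - ψ ≤ 1 / 2 ^ J := by
  have hp := Real.pi_pos
  have hp4 : Real.pi < 4 := by linarith [Real.pi_lt_d2]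
  obtain ⟨s, hs⟩ : ∃ s, s = χ + ψ := ⟨_, rfl⟩
  obtain ⟨d, hd⟩ : ∃ d, d = χ - ψ := ⟨_, rfl⟩
  have hmul : ∀ i ≤ J, ∀ j ≤ J,
      |Real.sin ((2 * (powOffset i + powOffset j) + 1 : ℕ) * s)|
        * |Real.sin ((2 * (powOffset i + powOffset j) + 1 : ℕ) * d)| ≤ 1 / 64 := by
    intro i hi j hj
    refine le_of_eq_of_le ?_ (h i hi j hj)
    -- The multiplier plays no role in the product formula for $\sin^2m\chi-\sin^2m\psi$.
    generalize (2 * (powOffset i + powOffset j) + 1 : ℕ) = m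
    rw [← abs_mul, hs, hd, mul_add, mul_sub, Real.sin_add, Real.sin_sub]
    congr 1
    linear_combination (-(Real.sin (m * ψ)) ^ 2) * Real.sin_sq_add_cos_sq (m * χ)
      + (Real.sin (m * χ)) ^ 2 * Real.sin_sq_add_cos_sq (m * ψ)
  clear h
  by_contra hlt
  rw [← hd, not_le] at hlt
  have hd0 : 0 < d := lt_trans (by positivity) hlt
  have hds : d ≤ s := by linarith
  have hsd : s ≤ Real.pi - d := by linarith
  -- For large $d$ the multiplier $1$ suffices: $d\le s\le\pi-d$, so both sines are at least
  -- $\frac14$.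
  rcases le_or_gt (Real.pi / 8) d with hd8 | hd8
  · have h0 := hmul 0 (by omega) 0 (by omega)
    simp only [powOffset, add_zero, mul_zero, zero_add, Nat.cast_one, one_mul] at h0
    have h1 := quarter_le_sin (x := s) (by linarith) (by linarith)
    have h2 := quarter_le_sin (x := d) (by linarith) (by linarith)
    rw [abs_of_pos (by linarith), abs_of_pos (by linarith)] at h0
    nlinarith
  obtain ⟨j, hj1, hj4, hj8⟩ := exists_two_pow_mul_window hd0 hd8
  -- $2^jd\le\pi/4<1$ together with $d>2^{-J}$ leaves no room for $j>J$.
  have hjJ : j ≤ J := by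
    by_contra hc
    have h1 : (2 : ℝ) ^ (J + 1) ≤ 2 ^ j := pow_le_pow_right₀ (by norm_num) (by omega)
    have h2 : (0 : ℝ) < 2 ^ J := by positivity
    rw [div_lt_iff₀ h2] at hlt
    rw [pow_succ] at h1
    nlinarith
  have hoff : ∀ i, 1 ≤ i → ((2 * powOffset i : ℕ) : ℝ) = 2 ^ i := by
    intro i hi
    obtain ⟨i, rfl⟩ : ∃ k, i = k + 1 := ⟨i - 1, by omega⟩
    simp [powOffset, pow_succ, mul_comm]
  have hm1 : |Real.sin ((2 ^ j + 1) * s)| ≤ 1 / 16 := by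
    have h0 := hmul 0 (by omega) j hjJ
    have e : ((2 * (powOffset 0 + powOffset j) + 1 : ℕ) : ℝ) = 2 ^ j + 1 := by
      rw [← hoff j hj1]; simp [powOffset]
    rw [e] at h0
    have h2 := quarter_le_sin (x := (2 ^ j + 1) * d) (by linarith) (by linarith)
    rw [abs_of_pos (a := Real.sin ((2 ^ j + 1) * d)) (by linarith)] at h0
    nlinarith [abs_nonneg (Real.sin ((2 ^ j + 1) * s))]
  have hm2 : ∀ i, 1 ≤ i → i ≤ j → |Real.sin (2 ^ i * s)| ≤ 1 / 8 := by
    intro i hi hij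
    have h0 := hmul i (by omega) j hjJ
    have e : ((2 * (powOffset i + powOffset j) + 1 : ℕ) : ℝ) = 2 ^ j + 1 + 2 ^ i := by
      rw [← hoff j hj1, ← hoff i hi]; push_cast; ring
    rw [e] at h0
    have hpw : (2 : ℝ) ^ i ≤ 2 ^ j := pow_le_pow_right₀ (by norm_num) hij
    have hpw0 : (0 : ℝ) < 2 ^ i := by positivity
    have h2 := quarter_le_sin (x := (2 ^ j + 1 + 2 ^ i) * d) (by nlinarith) (by nlinarith)
    rw [abs_of_pos (a := Real.sin ((2 ^ j + 1 + 2 ^ i) * d)) (by linarith)] at h0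
    have h3 : |Real.sin ((2 ^ j + 1 + 2 ^ i) * s)| ≤ 1 / 16 := by
      nlinarith [abs_nonneg (Real.sin ((2 ^ j + 1 + 2 ^ i) * s))]
    have h4 := abs_sin_sub_le ((2 ^ j + 1 + 2 ^ i) * s) ((2 ^ j + 1) * s)
    rw [show (2 ^ j + 1 + 2 ^ i) * s - (2 ^ j + 1) * s = 2 ^ i * s by ring] at h4
    linarith
  -- Reflecting $s\mapsto\pi-s$ preserves $|\sin ms|$ for integers $m$, and $s\le\pi-d$ keeps the
  -- reflected angle above $d$.
  obtain ⟨w, hdw, hw2, hw1, hwi⟩ : ∃ w, d ≤ w ∧ w ≤ Real.pi / 2 ∧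
      |Real.sin ((2 ^ j + 1) * w)| ≤ 1 / 16 ∧
      ∀ i, 1 ≤ i → i ≤ j → |Real.sin (2 ^ i * w)| ≤ 1 / 8 := by
    rcases le_total s (Real.pi / 2) with hs2 | hs2
    · exact ⟨s, hds, hs2, hm1, hm2⟩
    · refine ⟨Real.pi - s, by linarith, by linarith, ?_, fun i hi hij => ?_⟩
      · have := abs_sin_nat_mul_pi_sub (2 ^ j + 1) ((2 ^ j + 1) * s)
        push_cast at this
        rwa [mul_sub, this]
      · have := abs_sin_nat_mul_pi_sub (2 ^ i) (2 ^ i * s)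
        push_cast at this
        rw [mul_sub, this]; exact hm2 i hi hij
  have hcontra : ∀ x : ℝ, Real.pi / 8 ≤ x → x ≤ 7 * Real.pi / 8 → |Real.sin x| ≤ 1 / 8 → False := by
    intro x h1 h2 h3
    have := quarter_le_sin h1 h2
    have := le_abs_self (Real.sin x)
    linarith
  rcases lt_or_ge w (Real.pi / 8) with hw8 | hw8
  · obtain ⟨i, hi1, hi4, hi8⟩ := exists_two_pow_mul_window (by linarith) hw8
    exact hcontra _ hi8.le (by linarith)
      (hwi i hi1 (two_pow_lt_of_window (by linarith) hi4 hj8 hdw))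
  · by_cases hw7 : 2 * w ≤ 7 * Real.pi / 8
    · exact hcontra (2 ^ 1 * w) (by linarith) (by linarith) (hwi 1 le_rfl hj1)
    -- Near $\pi/2$ even multipliers see only the distance $y$ to $\pi/2$, since $2^i\cdot\pi/2$ is
    -- a multiple of $\pi$ for $i\ge1$; the odd multiplier turns the sine into a cosine of a
    -- multiple of $y$.
    obtain ⟨y, hy⟩ : ∃ y, y = Real.pi / 2 - w := ⟨_, rfl⟩
    have hy0 : 0 ≤ y := by linarith
    have hy8 : y < Real.pi / 8 := by linarith
    obtain ⟨q, hq⟩ : ∃ q : ℕ, 2 ^ j = 2 * q := ⟨2 ^ (j - 1), by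
      rw [← pow_succ']; congr 1; omega⟩
    have hqR : (2 : ℝ) ^ j = 2 * q := by exact_mod_cast hq
    have hcos : |Real.cos ((2 ^ j + 1) * y)| ≤ 1 / 16 := by
      refine le_of_eq_of_le ?_ hw1
      have : (2 ^ j + 1) * w = Real.pi / 2 - ((2 ^ j + 1) * y - q * Real.pi) := by
        rw [hy, hqR]; ring
      rw [this, Real.sin_pi_div_two_sub, ← Real.cos_neg (_ - _), neg_sub,
        abs_cos_nat_mul_pi_sub]
    have hyi : ∀ i, 1 ≤ i → i ≤ j → |Real.sin (2 ^ i * y)| ≤ 1 / 8 := by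
      intro i hi hij
      have := abs_sin_nat_mul_pi_sub (2 ^ (i - 1)) (2 ^ i * w)
      have h2 : (2 : ℝ) ^ i = 2 * 2 ^ (i - 1) := by rw [← pow_succ']; congr 1; omega
      push_cast at this
      rw [show (2 : ℝ) ^ (i - 1) * Real.pi - 2 ^ i * w = 2 ^ i * y by rw [hy, h2]; ring] at this
      rw [this]; exact hwi i hi hij
    -- Either $(2^j+1)y\le1$ and its cosine is at least $\frac12$, or some $2^iy$ with $i\le j$ lies
    -- in the window.
    rcases le_or_gt (2 ^ j * y) (Real.pi / 8) with hyj | hyj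
    · have h1 := Real.one_sub_sq_div_two_le_cos (x := (2 ^ j + 1) * y)
      have h2 := le_abs_self (Real.cos ((2 ^ j + 1) * y))
      have h3 : (2 ^ j + 1) * y ≤ 1 := by linarith
      have h4 : 0 ≤ (2 ^ j + 1) * y := by positivity
      have h5 : ((2 ^ j + 1) * y) ^ 2 ≤ 1 := pow_le_one₀ h4 h3
      linarith
    · have hy0' : 0 < y := by
        rcases hy0.eq_or_lt with h | h
        · rw [← h] at hyj; linarith
        · exact h
      obtain ⟨i, hi1, hi4, hi8⟩ := exists_two_pow_mul_window hy0' hy8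
      exact hcontra _ hi8.le (by linarith)
        (hyi i hi1 (two_pow_lt_of_window hy0' hi4 hyj le_rfl))

lemma angle_close {J : ℕ} {χ ψ : ℝ} (hχ0 : 0 ≤ χ) (hχ : χ ≤ Real.pi / 2)
    (hψ0 : 0 ≤ ψ) (hψ : ψ ≤ Real.pi / 2)
    (h : ∀ i ≤ J, ∀ j ≤ J,
      |Real.sin ((2 * (powOffset i + powOffset j) + 1 : ℕ) * χ) ^ 2
        - Real.sin ((2 * (powOffset i + powOffset j) + 1 : ℕ) * ψ) ^ 2| ≤ 1 / 64) :
    |χ - ψ| ≤ 1 / 2 ^ J := by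
  rcases le_total ψ χ with hle | hle
  · rw [abs_of_nonneg (by linarith)]
    exact angle_close_of_le hψ0 hle hχ h
  · rw [abs_sub_comm, abs_of_nonneg (by linarith)]
    refine angle_close_of_le hχ0 hle hψ fun i hi j hj => ?_
    rw [abs_sub_comm]; exact h i hi j hj

lemma powOffset_le {J i : ℕ} (h : i ≤ J) : 2 * powOffset i ≤ 2 ^ J := by
  rcases i with _ | i
  · simp [powOffset]
  · simp only [powOffset]
    rw [← pow_succ']
    exact Nat.pow_le_pow_right (by norm_num) h

/-! ### Quartic forms on the circle -/

/-- A binary quartic form. -/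
def quartic (β : Fin 5 → ℝ) (c s : ℝ) : ℝ :=
  β 0 * c ^ 4 + β 1 * c ^ 3 * s + β 2 * c ^ 2 * s ^ 2 + β 3 * c * s ^ 3 + β 4 * s ^ 4

lemma hasDerivAt_quartic (β : Fin 5 → ℝ) :
    HasDerivAt (fun t => quartic β (Real.cos t) (Real.sin t)) (β 1) 0 := by
  have hc := Real.hasDerivAt_cos 0
  have hs := Real.hasDerivAt_sin 0
  have := (((((hc.pow 4).const_mul (β 0)).add (((hc.pow 3).const_mul (β 1)).mul hs)).add
    (((hc.pow 2).const_mul (β 2)).mul (hs.pow 2))).add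
    ((hc.const_mul (β 3)).mul (hs.pow 3))).add ((hs.pow 4).const_mul (β 4))
  refine HasDerivAt.congr_deriv this ?_
  simp

/-- The five shifts used to read off the derivative of a quartic form. -/
def shiftAngle : Fin 5 → ℝ := ![0, Real.pi / 4, -(Real.pi / 4), Real.arctan 2, -Real.arctan 2]

/-- Differences at opposite shifts keep only the odd coefficients: they are $(\beta_1+\beta_3)/2$ at
$\pm\pi/4$ and $(4\beta_1+16\beta_3)/25$ at $\pm\arctan2$. The weights eliminate $\beta_3$. -/
lemma quartic_coeff_one (β : Fin 5 → ℝ) (f : ℝ → ℝ)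
    (hf : ∀ t, f t = quartic β (Real.cos t) (Real.sin t)) :
    β 1 = (16 * (f (shiftAngle 1) - f (shiftAngle 2))
      - 25 / 2 * (f (shiftAngle 3) - f (shiftAngle 4))) / 6 := by
  simp only [hf]
  simp only [shiftAngle, Matrix.cons_val, quartic, Real.cos_neg, Real.sin_neg,
    Real.cos_pi_div_four, Real.sin_pi_div_four, Real.cos_arctan, Real.sin_arctan]
  have h5 : √(1 + 2 ^ 2 : ℝ) ^ 2 = 5 := by rw [Real.sq_sqrt (by norm_num)]; norm_num
  have h2 : √(2 : ℝ) ^ 2 = 2 := Real.sq_sqrt (by norm_num)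
  have h4 : √(2 : ℝ) ^ 4 = 4 := by rw [show √(2 : ℝ) ^ 4 = (√2 ^ 2) ^ 2 by ring, h2]; norm_num
  have h50 : √(1 + 2 ^ 2 : ℝ) ≠ 0 := by positivity
  generalize √(1 + 2 ^ 2 : ℝ) = r at *
  have hi : (1 / r) ^ 2 = 1 / 5 := by rw [div_pow, h5]; norm_num
  rw [show 2 / r = 2 * (1 / r) by ring]
  generalize 1 / r = u at *
  have hi4 : u ^ 4 = 1 / 25 := by rw [show u ^ 4 = (u ^ 2) ^ 2 by ring, hi]; norm_num
  linear_combination (- (4 / 6) * (β 1 + β 3) / 2) * (h4) + (25 / 6) * (2 * β 1 + 8 * β 3) * hi4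

/-- A discriminant argument: $\beta_0+\beta_1u+\dots+\beta_4u^4\ge0$ for all $u$, and for $|u|\le1$
the terms of degree at least two amount to at most $12u^2$, because the coefficients are bounded by
$4$, $7$ and $1$. The lemma is what saves a factor $p^{-1/2}$ in the accuracy. -/
lemma quartic_coeff_one_sq_le (β : Fin 5 → ℝ)
    (h0 : ∀ t, 0 ≤ quartic β (Real.cos t) (Real.sin t))
    (h1 : ∀ t, quartic β (Real.cos t) (Real.sin t) ≤ 1) :
    β 1 ^ 2 ≤ 49 * β 0 := by
  have b1 := quartic_coeff_one β _ fun t => rfl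
  have e0 := h0 0
  have e0' := h1 0
  have e4 := h0 (Real.pi / 2)
  have e4' := h1 (Real.pi / 2)
  have q1 := h0 (shiftAngle 1)
  have q1' := h1 (shiftAngle 1)
  have q2 := h0 (shiftAngle 2)
  have q2' := h1 (shiftAngle 2)
  have q3 := h0 (shiftAngle 3)
  have q3' := h1 (shiftAngle 3)
  have q4 := h0 (shiftAngle 4)
  have q4' := h1 (shiftAngle 4)
  have hh : (√2 / 2) ^ 4 = (1 / 4 : ℝ) := by
    rw [show (√2 / 2 : ℝ) ^ 4 = (√2 ^ 2) ^ 2 / 16 by ring, Real.sq_sqrt (by norm_num)]; norm_num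
  have f1 : quartic β (Real.cos (shiftAngle 1)) (Real.sin (shiftAngle 1))
      = (β 0 + β 1 + β 2 + β 3 + β 4) / 4 := by
    simp only [shiftAngle, Matrix.cons_val, quartic, Real.cos_pi_div_four, Real.sin_pi_div_four]
    linear_combination (β 0 + β 1 + β 2 + β 3 + β 4) * hh
  have f2 : quartic β (Real.cos (shiftAngle 2)) (Real.sin (shiftAngle 2))
      = (β 0 - β 1 + β 2 - β 3 + β 4) / 4 := by
    simp only [shiftAngle, Matrix.cons_val, quartic, Real.cos_neg, Real.sin_neg,
      Real.cos_pi_div_four, Real.sin_pi_div_four]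
    linear_combination (β 0 - β 1 + β 2 - β 3 + β 4) * hh
  simp [quartic] at e0 e0' e4 e4'
  have hb1 : |β 1| ≤ 5 := by rw [abs_le]; constructor <;> linarith
  rw [f1] at q1 q1'
  rw [f2] at q2 q2'
  have hb3 : |β 3| ≤ 7 := by rw [abs_le] at *; constructor <;> linarith
  have hb2 : |β 2| ≤ 4 := by rw [abs_le] at *; constructor <;> linarith
  have hb4 : |β 4| ≤ 1 := by rw [abs_le]; constructor <;> linarith
  -- The minimizer of $\beta_0+\beta_1u+12u^2$.
  obtain ⟨u, hu⟩ : ∃ u, u = -β 1 / 24 := ⟨_, rfl⟩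
  have hpoly : 0 ≤ β 0 + β 1 * u + β 2 * u ^ 2 + β 3 * u ^ 3 + β 4 * u ^ 4 := by
    have ht := h0 (Real.arctan u)
    rw [Real.cos_arctan, Real.sin_arctan] at ht
    have hr : 0 < √(1 + u ^ 2) := by positivity
    generalize √(1 + u ^ 2) = r at *
    have : quartic β (1 / r) (u / r)
        = (β 0 + β 1 * u + β 2 * u ^ 2 + β 3 * u ^ 3 + β 4 * u ^ 4) / r ^ 4 := by
      unfold quartic; field_simp
    rw [this] at ht
    by_contra hc
    exact absurd ht (not_le.2 (div_neg_of_neg_of_pos (not_le.1 hc) (by positivity)))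
  have hu1 : |u| ≤ 1 := by
    rw [hu, abs_div, abs_neg, abs_of_pos (show (0 : ℝ) < 24 by norm_num), div_le_one (by norm_num)]
    linarith
  have hrest : β 2 * u ^ 2 + β 3 * u ^ 3 + β 4 * u ^ 4 ≤ 12 * u ^ 2 := by
    have g1 : β 3 * u ≤ 7 := by
      refine (le_abs_self _).trans ?_
      rw [abs_mul]
      nlinarith [abs_nonneg (β 3), abs_nonneg u]
    have g2 : u ^ 2 ≤ 1 := by rw [← sq_abs]; nlinarith [abs_nonneg u]
    have g3 : β 4 * u ^ 2 ≤ 1 := by nlinarith [le_abs_self (β 4), sq_nonneg u]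
    have g4 := le_abs_self (β 2)
    nlinarith [sq_nonneg u]
  rw [hu] at hpoly hrest
  nlinarith

lemma abs_sub_le_of_sqrt {a b δ : ℝ} (ha : 0 ≤ a) (hb : 0 ≤ b) (h : |√a - √b| ≤ δ) :
    |a - b| ≤ δ * (√a + √b) := by
  have : a - b = (√a - √b) * (√a + √b) := by
    have h1 := Real.sq_sqrt ha
    have h2 := Real.sq_sqrt hb
    linear_combination h2 - h1
  rw [this, abs_mul, abs_of_nonneg (a := √a + √b) (by positivity)]
  exact mul_le_mul_of_nonneg_right h (by positivity)

/-- Stability of the logarithmic derivative of a bounded nonnegative quartic form. -/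
lemma quartic_logDeriv_close {β γ : Fin 5 → ℝ} {p δ : ℝ} (hp : 0 < p)
    (hβ0 : ∀ t, 0 ≤ quartic β (Real.cos t) (Real.sin t))
    (hβ1 : ∀ t, quartic β (Real.cos t) (Real.sin t) ≤ 1)
    (hγ0 : ∀ t, 0 ≤ quartic γ (Real.cos t) (Real.sin t))
    (hγ1 : ∀ t, quartic γ (Real.cos t) (Real.sin t) ≤ 1)
    (hpβ : p ≤ β 0) (hδ : δ ≤ √p / 2)
    (hclose : ∀ i, |√(quartic β (Real.cos (shiftAngle i)) (Real.sin (shiftAngle i)))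
      - √(quartic γ (Real.cos (shiftAngle i)) (Real.sin (shiftAngle i)))| ≤ δ) :
    |β 1 / β 0 - γ 1 / γ 0| ≤ 118 * δ / p := by
  have hδ0 : 0 ≤ δ := (abs_nonneg _).trans (hclose 0)
  have hdiff : ∀ i, |quartic β (Real.cos (shiftAngle i)) (Real.sin (shiftAngle i))
      - quartic γ (Real.cos (shiftAngle i)) (Real.sin (shiftAngle i))| ≤ 2 * δ := by
    intro i
    refine (abs_sub_le_of_sqrt (hβ0 _) (hγ0 _) (hclose i)).trans ?_
    have := Real.sqrt_le_one.2 (hβ1 (shiftAngle i))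
    have := Real.sqrt_le_one.2 (hγ1 (shiftAngle i))
    nlinarith
  -- $19=2\,(2\cdot16+2\cdot\frac{25}2)/6$, from the weights in `quartic_coeff_one`.
  have hd1 : |β 1 - γ 1| ≤ 19 * δ := by
    rw [quartic_coeff_one β _ fun t => rfl, quartic_coeff_one γ _ fun t => rfl]
    have h1 := abs_le.1 (hdiff 1)
    have h2 := abs_le.1 (hdiff 2)
    have h3 := abs_le.1 (hdiff 3)
    have h4 := abs_le.1 (hdiff 4)
    rw [abs_le]
    constructor <;> linarith [h1.1, h1.2, h2.1, h2.2, h3.1, h3.2, h4.1, h4.2]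
  have hc0 := hclose 0
  have e0 : ∀ β : Fin 5 → ℝ, quartic β (Real.cos (shiftAngle 0)) (Real.sin (shiftAngle 0)) = β 0 := by
    intro β; simp [shiftAngle, quartic]
  rw [e0, e0] at hc0
  have hβ00 : 0 < β 0 := by linarith
  have hγ00 : 0 ≤ γ 0 := by have := hγ0 (shiftAngle 0); rwa [e0] at this
  have hb := quartic_coeff_one_sq_le β hβ0 hβ1
  have hu2 := Real.sq_sqrt hβ00.le
  have hv2 := Real.sq_sqrt hγ00
  have hpu : √p ≤ √(β 0) := Real.sqrt_le_sqrt hpβ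
  have hp2 := Real.sq_sqrt hp.le
  have hp0 : 0 < √p := Real.sqrt_pos.2 hp
  -- The factor $\sqrt{\beta_0}$ gained here pays for one of the square roots in the denominator
  -- when $\beta_0$ is replaced by $\gamma_0$.
  have hb1 : |β 1| ≤ 7 * √(β 0) := by
    apply abs_le_of_sq_le_sq _ (by positivity)
    nlinarith
  obtain ⟨u, hu⟩ : ∃ u, u = √(β 0) := ⟨_, rfl⟩
  obtain ⟨v, hv⟩ : ∃ v, v = √(γ 0) := ⟨_, rfl⟩
  rw [← hu] at hu2 hpu hb1 hc0
  rw [← hv] at hv2 hc0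
  have hvu : u / 2 ≤ v := by linarith [(abs_le.1 hc0).2]
  have hu0 : 0 < u := by linarith
  have hv0 : 0 < v := by linarith
  -- The first term carries the error of the numerator, the second the error of the denominator;
  -- with $u\le2v$ they give $19\cdot4+7\cdot(2+4)=118$.
  have key : β 1 / β 0 - γ 1 / γ 0 = (β 1 - γ 1) / v ^ 2 + β 1 * ((v - u) * (v + u)) / (u ^ 2 * v ^ 2) := by
    rw [← hu2, ← hv2]; field_simp; ring
  have hpu2 : p ≤ u ^ 2 := by rw [← hp2]; gcongr
  have hiv : 1 / v ^ 2 ≤ 4 / p := by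
    rw [div_le_div_iff₀ (by positivity) hp]; nlinarith
  have hiuv : 1 / (u * v) ≤ 2 / p := by
    rw [div_le_div_iff₀ (by positivity) hp]; nlinarith
  rw [key]
  refine (abs_add_le _ _).trans ?_
  have t1 : |(β 1 - γ 1) / v ^ 2| ≤ 19 * δ * (4 / p) := by
    rw [abs_div, abs_of_pos (a := v ^ 2) (by positivity), div_eq_mul_one_div]
    gcongr
  have t2 : |β 1 * ((v - u) * (v + u)) / (u ^ 2 * v ^ 2)| ≤ 7 * δ * (2 / p + 4 / p) := by
    rw [abs_div, abs_mul, abs_mul, abs_of_pos (a := u ^ 2 * v ^ 2) (by positivity),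
      abs_of_pos (a := v + u) (by positivity), abs_sub_comm v u]
    calc |β 1| * (|u - v| * (v + u)) / (u ^ 2 * v ^ 2)
        ≤ 7 * u * (δ * (v + u)) / (u ^ 2 * v ^ 2) := by gcongr
      _ = 7 * δ * (1 / (u * v) + 1 / v ^ 2) := by field_simp
      _ ≤ _ := by gcongr
  refine (add_le_add t1 t2).trans (le_of_eq ?_)
  ring

/-! ### Frobenius norms and the matrix exponential -/

section Frobenius

open scoped Matrix.Norms.Frobenius

variable {n m : Type} [Fintype n] [Fintype m]

lemma frobenius_norm_sq (X : Matrix m n ℂ) : ‖X‖ ^ 2 = ∑ x, ∑ y, ‖X x y‖ ^ 2 := by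
  rw [Matrix.frobenius_norm_def, ← Real.sqrt_eq_rpow, Real.sq_sqrt (by positivity)]
  simp

lemma trace_conjTranspose_mul_self (X : Matrix m n ℂ) : (Xᴴ * X).trace = ((‖X‖ ^ 2 : ℝ) : ℂ) := by
  rw [frobenius_norm_sq, Finset.sum_comm]
  simp only [Matrix.trace, Matrix.diag, Matrix.mul_apply, Matrix.conjTranspose_apply]
  push_cast
  refine Finset.sum_congr rfl fun i _ => Finset.sum_congr rfl fun j _ => ?_
  rw [Complex.star_def, Complex.conj_mul']

variable [DecidableEq n]

lemma frobenius_norm_unitary_mul {U : Matrix n n ℂ} (hU : U ∈ Matrix.unitaryGroup n ℂ)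
    (X : Matrix n n ℂ) : ‖U * X‖ = ‖X‖ := by
  have h : ((‖U * X‖ ^ 2 : ℝ) : ℂ) = ((‖X‖ ^ 2 : ℝ) : ℂ) := by
    rw [← trace_conjTranspose_mul_self, ← trace_conjTranspose_mul_self, Matrix.conjTranspose_mul,
      Matrix.mul_assoc, ← Matrix.mul_assoc Uᴴ, ← Matrix.star_eq_conjTranspose U,
      Matrix.mem_unitaryGroup_iff'.1 hU, Matrix.one_mul]
  have h' : ‖U * X‖ ^ 2 = ‖X‖ ^ 2 := by exact_mod_cast h
  exact (pow_left_inj₀ (norm_nonneg _) (norm_nonneg _) (by norm_num)).1 h'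

/-- Cauchy–Schwarz for the Hilbert–Schmidt inner product. -/
lemma abs_trace_conjTranspose_mul_le (X Y : Matrix n n ℂ) : ‖(Xᴴ * Y).trace‖ ≤ ‖X‖ * ‖Y‖ := by
  have h1 : ‖(Xᴴ * Y).trace‖ ≤ ∑ p : n × n, ‖X p.1 p.2‖ * ‖Y p.1 p.2‖ := by
    rw [Fintype.sum_prod_type, Finset.sum_comm]
    simp only [Matrix.trace, Matrix.diag, Matrix.mul_apply, Matrix.conjTranspose_apply]
    refine (norm_sum_le _ _).trans (Finset.sum_le_sum fun i _ => (norm_sum_le _ _).trans ?_)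
    exact Finset.sum_le_sum fun j _ => by rw [norm_mul, norm_star]
  refine h1.trans ?_
  have h2 := Finset.sum_mul_sq_le_sq_mul_sq Finset.univ (fun p : n × n => ‖X p.1 p.2‖)
    (fun p => ‖Y p.1 p.2‖)
  have e : ∀ X : Matrix n n ℂ, ∑ p : n × n, ‖X p.1 p.2‖ ^ 2 = ‖X‖ ^ 2 := fun X => by
    rw [frobenius_norm_sq, ← Fintype.sum_prod_type']
  rw [e, e, ← mul_pow] at h2
  exact le_of_sq_le_sq h2 (by positivity)

lemma frobenius_norm_one_sq : ‖(1 : Matrix n n ℂ)‖ ^ 2 = Fintype.card n := by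
  have := trace_conjTranspose_mul_self (1 : Matrix n n ℂ)
  simp only [Matrix.conjTranspose_one, Matrix.mul_one, Matrix.trace_one] at this
  exact_mod_cast this.symm

lemma hasSum_matrix_exp (X : Matrix n n ℂ) :
    HasSum (fun k : ℕ => ((k ! : ℂ)⁻¹) • X ^ k) (NormedSpace.exp X) :=
  NormedSpace.exp_series_hasSum_exp' (𝕂 := ℂ) X

/-- The exponential series, cut off after the term of degree `K`. -/
def expTrunc (K : ℕ) (X : Matrix n n ℂ) : Matrix n n ℂ :=
  ∑ k ∈ Finset.range (K + 1), ((k ! : ℂ)⁻¹) • X ^ k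

lemma norm_exp_le {X : Matrix n n ℂ} {c b : ℝ} (h : ∀ k, ‖X ^ k‖ ≤ c * b ^ k) :
    ‖NormedSpace.exp X‖ ≤ c * Real.exp b := by
  have hg : HasSum (fun k : ℕ => c * (b ^ k / k !)) (c * Real.exp b) := by
    rw [Real.exp_eq_exp_ℝ]
    exact (NormedSpace.expSeries_div_hasSum_exp b).mul_left c
  refine (hasSum_matrix_exp X).norm_le_of_bounded hg fun k => ?_
  rw [norm_smul, norm_inv, Complex.norm_natCast]
  calc ((k ! : ℝ))⁻¹ * ‖X ^ k‖ ≤ (k ! : ℝ)⁻¹ * (c * b ^ k) := by gcongr; exact h k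
    _ = _ := by ring

/-- Every omitted term has $k>K$, so inserting the factor $2^{k-K}\ge1$ bounds the tail by $2^{-K}$
times the full series at $2b$. -/
lemma norm_expTrunc_sub_exp_le (K : ℕ) {X : Matrix n n ℂ} {c b : ℝ} (hc : 0 ≤ c) (hb : 0 ≤ b)
    (h : ∀ k, ‖X ^ k‖ ≤ c * b ^ k) :
    ‖expTrunc K X - NormedSpace.exp X‖ ≤ c / 2 ^ K * Real.exp (2 * b) := by
  have hg : HasSum (fun k : ℕ => c / 2 ^ K * ((2 * b) ^ k / k !)) (c / 2 ^ K * Real.exp (2 * b)) := by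
    rw [Real.exp_eq_exp_ℝ]
    exact (NormedSpace.expSeries_div_hasSum_exp (2 * b)).mul_left _
  have hs : HasSum (fun k : ℕ => if k ∈ Finset.range (K + 1) then ((k ! : ℂ)⁻¹) • X ^ k else 0)
      (expTrunc K X) := by
    have := hasSum_sum_of_ne_finset_zero (L := SummationFilter.unconditional ℕ)
      (f := fun k : ℕ => if k ∈ Finset.range (K + 1) then ((k ! : ℂ)⁻¹) • X ^ k else 0)
      (s := Finset.range (K + 1)) (fun k hk => by simp only [hk, if_false])
    rwa [Finset.sum_congr rfl (g := fun k => ((k ! : ℂ)⁻¹) • X ^ k)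
      (fun k hk => by simp only [hk, if_true])] at this
  refine (hs.sub (hasSum_matrix_exp X)).norm_le_of_bounded hg fun k => ?_
  by_cases hk : k ∈ Finset.range (K + 1)
  · simp only [hk, if_true, sub_self, norm_zero]; positivity
  · simp only [hk, if_false, zero_sub, norm_neg]
    rw [norm_smul, norm_inv, Complex.norm_natCast]
    have hkK : K ≤ k := by simp at hk; omega
    have h2 : (1 : ℝ) ≤ 2 ^ k / 2 ^ K := by
      rw [one_le_div (by positivity)]; exact pow_le_pow_right₀ (by norm_num) hkK
    calc ((k ! : ℝ))⁻¹ * ‖X ^ k‖ ≤ (k ! : ℝ)⁻¹ * (c * b ^ k * 1) := by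
          rw [mul_one]; gcongr; exact h k
      _ ≤ (k ! : ℝ)⁻¹ * (c * b ^ k * (2 ^ k / 2 ^ K)) := by gcongr
      _ = _ := by rw [mul_pow]; ring

lemma norm_linearCombination_mul_le {ι : Type} [Fintype ι] {α : ι → ℂ} {U : ι → Matrix n n ℂ}
    (hU : ∀ l, U l ∈ Matrix.unitaryGroup n ℂ) (X : Matrix n n ℂ) :
    ‖(∑ l, α l • U l) * X‖ ≤ (∑ l, ‖α l‖) * ‖X‖ := by
  rw [Finset.sum_mul, Finset.sum_mul]
  refine (norm_sum_le _ _).trans (Finset.sum_le_sum fun l _ => ?_)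
  rw [Matrix.smul_mul, norm_smul, frobenius_norm_unitary_mul (hU l)]

/-- Starting from $\|1\|=\sqrt{\dim}$ and multiplying on the left, the dimension enters once and not
once per factor. -/
lemma norm_pow_le_of_norm_mul_le {X : Matrix n n ℂ} {b : ℝ} (hb : 0 ≤ b)
    (h : ∀ Y : Matrix n n ℂ, ‖X * Y‖ ≤ b * ‖Y‖) (k : ℕ) :
    ‖X ^ k‖ ≤ √(Fintype.card n) * b ^ k := by
  induction k with
  | zero =>
    rw [pow_zero, pow_zero, mul_one, ← frobenius_norm_one_sq, Real.sqrt_sq (norm_nonneg _)]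
  | succ k ih =>
    rw [pow_succ', pow_succ]
    refine (h _).trans ?_
    calc b * ‖X ^ k‖ ≤ b * (√(Fintype.card n) * b ^ k) := by gcongr
      _ = _ := by ring

end Frobenius

/-! ### The thermal state and the overlap through $e^{\pm H/2}$ -/

section Thermal

open scoped Matrix.Norms.Frobenius

variable {ι : Type} [Fintype ι] [DecidableEq ι]

/-- `e^{H/2}`. -/
def halfExp (H : QOp ι) : QOp ι := NormedSpace.exp ((1 / 2 : ℂ) • H)

lemma halfExp_isHermitian {H : QOp ι} (hH : H.IsHermitian) : (halfExp H).IsHermitian := by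
  apply Matrix.IsHermitian.exp
  rw [Matrix.IsHermitian, Matrix.conjTranspose_smul, hH.eq]
  congr 1
  norm_num

lemma halfExp_mul_self (H : QOp ι) : halfExp H * halfExp H = NormedSpace.exp H := by
  rw [halfExp, ← Matrix.exp_add_of_commute _ _ (Commute.refl _), ← add_smul]
  norm_num

lemma halfExp_mul_halfExp_neg (H : QOp ι) : halfExp H * halfExp (-H) = 1 := by
  rw [halfExp, halfExp, ← Matrix.exp_add_of_commute, smul_neg, add_neg_cancel,
    NormedSpace.exp_zero]
  rw [smul_neg]
  exact (Commute.refl _).neg_right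

lemma trace_exp_eq {H : QOp ι} (hH : H.IsHermitian) :
    (NormedSpace.exp H).trace = ((‖halfExp H‖ ^ 2 : ℝ) : ℂ) := by
  rw [← trace_conjTranspose_mul_self, (halfExp_isHermitian hH).eq, halfExp_mul_self]

lemma trace_sq_mul_exp_eq {H σ : QOp ι} (hH : H.IsHermitian) (hσ : σ.IsHermitian) :
    (σ ^ 2 * NormedSpace.exp H).trace = ((‖σ * halfExp H‖ ^ 2 : ℝ) : ℂ) := by
  rw [← trace_conjTranspose_mul_self, Matrix.conjTranspose_mul, (halfExp_isHermitian hH).eq,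
    hσ.eq, ← halfExp_mul_self, sq, ← Matrix.mul_assoc, Matrix.trace_mul_comm]
  simp only [Matrix.mul_assoc]

lemma trace_exp_pos (H : QOp ι) : 0 < ‖halfExp H‖ := by
  rw [norm_pos_iff]
  intro h0
  have := halfExp_mul_halfExp_neg H
  rw [h0, Matrix.zero_mul] at this
  exact zero_ne_one this

lemma thermalState_inv {H : QOp ι} (hH : H.IsHermitian) :
    (thermalState H)⁻¹ = ((‖halfExp (-H)‖ ^ 2 : ℝ) : ℂ) • NormedSpace.exp H := by
  have h1 := trace_exp_eq hH.neg
  have h0 : ((‖halfExp (-H)‖ ^ 2 : ℝ) : ℂ) ≠ 0 := by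
    have := trace_exp_pos (-H)
    exact_mod_cast (by positivity)
  rw [thermalState, h1]
  apply Matrix.inv_eq_left_inv
  rw [Matrix.smul_mul, Matrix.mul_smul, smul_smul, mul_inv_cancel₀ h0, one_smul,
    ← Matrix.exp_add_of_commute, add_neg_cancel, NormedSpace.exp_zero]
  exact (Commute.refl H).neg_right

lemma overlap_thermalState {H σ : QOp ι} (hH : H.IsHermitian) (hσ : σ.IsHermitian) :
    overlap σ (thermalState H) = ‖halfExp (-H)‖ ^ 2 * ‖σ * halfExp H‖ ^ 2 := by
  rw [overlap, thermalState_inv hH, Matrix.mul_smul, Matrix.trace_smul, trace_sq_mul_exp_eq hH hσ,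
    smul_eq_mul, ← Complex.ofReal_mul, Complex.ofReal_re]

/-- Cauchy–Schwarz applied to $1=\mathrm{Tr}\,\sigma=\mathrm{Tr}(e^{-H/2}\cdot e^{H/2}\sigma)$. It
turns the accuracy hypothesis of the theorem into $\epsilon\le 13/2$. -/
lemma one_le_overlap {H σ : QOp ι} (hH : H.IsHermitian) (hσ : σ.IsHermitian)
    (htr : σ.trace = 1) : 1 ≤ overlap σ (thermalState H) := by
  rw [overlap_thermalState hH hσ, ← mul_pow]
  apply one_le_pow₀
  have h := abs_trace_conjTranspose_mul_le (halfExp (-H)) (halfExp H * σ)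
  have h1 : halfExp (-H) * halfExp H = 1 := by
    have := halfExp_mul_halfExp_neg (-H)
    rwa [neg_neg] at this
  rw [(halfExp_isHermitian hH.neg).eq, ← Matrix.mul_assoc, h1, Matrix.one_mul, htr, norm_one] at h
  have h2 : ‖halfExp H * σ‖ = ‖σ * halfExp H‖ := by
    rw [← Matrix.frobenius_norm_conjTranspose (halfExp H * σ), Matrix.conjTranspose_mul,
      (halfExp_isHermitian hH).eq, hσ.eq]
  rwa [h2] at h

end Thermal

/-! ### Bounds on $e^{H/2}$ and on its truncation in terms of $\|\alpha\|_1$ -/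

namespace ThermalInstance

open scoped Matrix.Norms.Frobenius

variable {nv nh N L : ℕ} (I : ThermalInstance nv nh N L)

lemma ham_isHermitian : I.ham.IsHermitian := I.ham_hermitian

lemma alphaNorm_nonneg : 0 ≤ I.alphaNorm := Finset.sum_nonneg fun _ _ => abs_nonneg _

lemma norm_half_ham_mul_le (c : ℂ) (hc : ‖c‖ = 1 / 2) (Y : QOp (Fin nv)) :
    ‖(c • I.ham) * Y‖ ≤ I.alphaNorm / 2 * ‖Y‖ := by
  rw [Matrix.smul_mul, norm_smul, hc]
  have := norm_linearCombination_mul_le (α := fun l => (I.α l : ℂ)) I.U_unitary Y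
  simp only [Complex.norm_real, Real.norm_eq_abs] at this
  unfold ham alphaNorm
  linarith

lemma card_visible : (Fintype.card (Fin nv → Bool) : ℝ) = 2 ^ nv := by simp

lemma norm_half_ham_pow_le (c : ℂ) (hc : ‖c‖ = 1 / 2) (k : ℕ) :
    ‖(c • I.ham) ^ k‖ ≤ √(2 ^ nv) * (I.alphaNorm / 2) ^ k := by
  rw [← card_visible]
  exact norm_pow_le_of_norm_mul_le (by have := I.alphaNorm_nonneg; positivity)
    (I.norm_half_ham_mul_le c hc) k

lemma norm_halfExp_le : ‖halfExp I.ham‖ ≤ √(2 ^ nv) * Real.exp (I.alphaNorm / 2) :=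
  norm_exp_le (I.norm_half_ham_pow_le _ (by norm_num))

lemma norm_halfExp_neg_le : ‖halfExp (-I.ham)‖ ≤ √(2 ^ nv) * Real.exp (I.alphaNorm / 2) := by
  rw [halfExp, smul_neg, ← neg_smul]
  exact norm_exp_le (I.norm_half_ham_pow_le _ (by norm_num))

/-- Cauchy–Schwarz applied to $2^{n_v}=\mathrm{Tr}(e^{H/2}e^{-H/2})$. -/
lemma le_norm_halfExp : √(2 ^ nv) * Real.exp (-(I.alphaNorm / 2)) ≤ ‖halfExp I.ham‖ := by
  have h := abs_trace_conjTranspose_mul_le (halfExp I.ham) (halfExp (-I.ham))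
  rw [(halfExp_isHermitian I.ham_isHermitian).eq, halfExp_mul_halfExp_neg, Matrix.trace_one,
    Complex.norm_natCast, card_visible] at h
  have h2 := I.norm_halfExp_neg_le
  have hs : √((2 : ℝ) ^ nv) * √(2 ^ nv) = 2 ^ nv := Real.mul_self_sqrt (by positivity)
  have hs0 : 0 < √((2 : ℝ) ^ nv) := by positivity
  have h3 : √((2 : ℝ) ^ nv) * √(2 ^ nv) ≤
      √(2 ^ nv) * (‖halfExp I.ham‖ * Real.exp (I.alphaNorm / 2)) := by
    rw [hs]
    refine h.trans ?_
    calc _ ≤ ‖halfExp I.ham‖ * (√(2 ^ nv) * Real.exp (I.alphaNorm / 2)) := by gcongr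
      _ = _ := by ring
  have h4 := le_of_mul_le_mul_left h3 hs0
  rw [Real.exp_neg, ← div_eq_mul_inv, div_le_iff₀ (Real.exp_pos _)]
  exact h4

/-- The truncated series of `e^{H/2}` that is produced by a Prepare of order `K`. -/
def halfTrunc (K : ℕ) : QOp (Fin nv) := expTrunc K ((1 / 2 : ℂ) • I.ham)

lemma norm_halfTrunc_sub_le (K : ℕ) :
    ‖I.halfTrunc K - halfExp I.ham‖ ≤ √(2 ^ nv) / 2 ^ K * Real.exp I.alphaNorm := by
  have := norm_expTrunc_sub_exp_le K (X := (1 / 2 : ℂ) • I.ham) (by positivity)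
    (by have := I.alphaNorm_nonneg; positivity) (I.norm_half_ham_pow_le _ (by norm_num))
  rwa [mul_div_cancel₀ _ (by norm_num : (2 : ℝ) ≠ 0)] at this

/-- Only relative errors matter, because the overlaps are normalized by $\|e^{H/2}\|$. The lower
bound on that norm costs another $e^{\|\alpha\|_1/2}$, and $\frac32\|\alpha\|_1$ is rounded up to
$2\|\alpha\|_1$. -/
lemma norm_halfTrunc_sub_le_mul (K : ℕ) :
    ‖I.halfTrunc K - halfExp I.ham‖ ≤ Real.exp (2 * I.alphaNorm) / 2 ^ K * ‖halfExp I.ham‖ := by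
  refine (I.norm_halfTrunc_sub_le K).trans ?_
  have h := I.le_norm_halfExp
  have ha := I.alphaNorm_nonneg
  calc √(2 ^ nv) / 2 ^ K * Real.exp I.alphaNorm
      ≤ √(2 ^ nv) / 2 ^ K * Real.exp (2 * I.alphaNorm + -(I.alphaNorm / 2)) := by
        gcongr; linarith
    _ = Real.exp (2 * I.alphaNorm) / 2 ^ K * (√(2 ^ nv) * Real.exp (-(I.alphaNorm / 2))) := by
        rw [Real.exp_add]; ring
    _ ≤ _ := by gcongr

lemma partition_eq : I.partition = ‖halfExp I.ham‖ ^ 2 := by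
  rw [partition, trace_exp_eq I.ham_isHermitian, Complex.ofReal_re]

lemma partition_le : I.partition ≤ Real.exp I.alphaNorm * 2 ^ nv := by
  rw [partition_eq]
  calc ‖halfExp I.ham‖ ^ 2 ≤ (√(2 ^ nv) * Real.exp (I.alphaNorm / 2)) ^ 2 := by
        gcongr; exact I.norm_halfExp_le
    _ = _ := by
        rw [mul_pow, Real.sq_sqrt (by positivity), ← Real.exp_nat_mul]
        push_cast
        rw [mul_div_cancel₀ _ (by norm_num : (2 : ℝ) ≠ 0), mul_comm]

lemma le_partition : Real.exp (-I.alphaNorm) * 2 ^ nv ≤ I.partition := by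
  rw [partition_eq]
  calc _ = (√(2 ^ nv) * Real.exp (-(I.alphaNorm / 2))) ^ 2 := by
        rw [mul_pow, Real.sq_sqrt (by positivity), ← Real.exp_nat_mul]
        push_cast
        rw [mul_neg, mul_div_cancel₀ _ (by norm_num : (2 : ℝ) ≠ 0), mul_comm]
    _ ≤ _ := by gcongr; exact I.le_norm_halfExp

lemma normOverlap_eq {θ : Fin N → ℝ} (hσ : (I.sigma θ).IsHermitian) :
    I.normOverlap θ = ‖I.sigma θ * halfExp I.ham‖ ^ 2 / ‖halfExp I.ham‖ ^ 2 := by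
  rw [normOverlap, Matrix.mul_smul, Matrix.trace_smul, trace_sq_mul_exp_eq I.ham_isHermitian hσ,
    trace_exp_eq I.ham_isHermitian, smul_eq_mul, ← Complex.ofReal_inv, ← Complex.ofReal_mul,
    Complex.ofReal_re]
  ring

end ThermalInstance

/-- Changing the denominator is harmless because the quotient $\|a\|/\|u\|$ is at most one. -/
lemma abs_norm_div_sub_norm_div_le {V W : Type} [SeminormedAddCommGroup V]
    [SeminormedAddCommGroup W] {a b : V} {u v : W} (hau : ‖a‖ ≤ ‖u‖) (hv : 0 < ‖v‖) :
    |‖a‖ / ‖u‖ - ‖b‖ / ‖v‖| ≤ (‖a - b‖ + ‖u - v‖) / ‖v‖ := by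
  have h1 : ‖a‖ / ‖u‖ - ‖b‖ / ‖v‖ = ((‖a‖ - ‖b‖) + (‖a‖ / ‖u‖) * (‖v‖ - ‖u‖)) / ‖v‖ := by
    rcases (norm_nonneg u).eq_or_lt with hu | hu
    · have : ‖a‖ = 0 := le_antisymm (by linarith) (norm_nonneg a)
      -- With $\|u\|=0$ also $\|a\|=0$, and the quotient $0/0$ is $0$.
      rw [this]; field_simp; ring
    · field_simp; ring
  rw [h1, abs_div, abs_of_pos hv]
  gcongr
  refine (abs_add_le _ _).trans (add_le_add (abs_norm_sub_norm_le a b) ?_)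
  rw [abs_mul, abs_of_nonneg (by positivity)]
  calc _ ≤ 1 * |‖v‖ - ‖u‖| := by
        gcongr
        exact div_le_one_of_le₀ hau (norm_nonneg _)
    _ ≤ _ := by rw [one_mul, abs_sub_comm]; exact abs_norm_sub_norm_le u v

/-! ### Operators on some of the wires, possibly selected by the others -/

section MuxOn

variable {ι κ μ : Type}

open Classical in
/-- The operator that acts on the wires `e` by `V x`, where `x` is the current basis state. It is
well behaved if `V x` does not depend on the wires `e` of `x`. -/
def muxOn (e : ι ↪ κ) (V : (κ → Bool) → QOp ι) : QOp κ :=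
  fun x y => if ∀ w, w ∉ Set.range e → x w = y w then V x (x ∘ e) (y ∘ e) else 0

/-- `V` depends only on the wires off `e`. -/
def OffIndep {α : Type} (e : ι ↪ κ) (V : (κ → Bool) → α) : Prop :=
  ∀ x y, (∀ w, w ∉ Set.range e → x w = y w) → V x = V y

lemma applyOn_eq_muxOn (e : ι ↪ κ) (M : QOp ι) : applyOn e M = muxOn e fun _ => M := rfl

lemma offIndep_const {α : Type} (e : ι ↪ κ) (M : α) : OffIndep e fun _ => M := fun _ _ _ => rfl

lemma extend_comp_self (e : ι ↪ κ) (z : ι → Bool) (x : κ → Bool) :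
    Function.extend e z x ∘ e = z := by
  funext i; simp [e.injective.extend_apply]

lemma extend_off (e : ι ↪ κ) (z : ι → Bool) (x : κ → Bool) {w : κ} (hw : w ∉ Set.range e) :
    Function.extend e z x w = x w :=
  Function.extend_apply' _ _ _ fun ⟨i, hi⟩ => hw ⟨i, hi⟩

lemma extend_comp_of_disjoint (e : ι ↪ κ) (f : μ → κ) (h : ∀ i j, e i ≠ f j) (z : ι → Bool)
    (x : κ → Bool) : Function.extend e z x ∘ f = x ∘ f := by
  funext j
  exact extend_off e z x fun ⟨i, hi⟩ => h i j hi

lemma eq_extend_iff (e : ι ↪ κ) (z : ι → Bool) (x y : κ → Bool) :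
    y = Function.extend e z x ↔ (∀ w, w ∉ Set.range e → x w = y w) ∧ y ∘ e = z := by
  constructor
  · rintro rfl
    exact ⟨fun w hw => (extend_off e z x hw).symm, extend_comp_self e z x⟩
  · rintro ⟨h1, rfl⟩
    funext w
    by_cases hw : w ∈ Set.range e
    · obtain ⟨i, rfl⟩ := hw
      simp [e.injective.extend_apply]
    · rw [extend_off e _ _ hw, h1 w hw]

lemma extend_extend (e : ι ↪ κ) (z z' : ι → Bool) (x : κ → Bool) :
    Function.extend e z (Function.extend e z' x) = Function.extend e z x := by
  rw [eq_extend_iff]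
  exact ⟨fun w hw => by rw [extend_off e _ _ hw, extend_off e _ _ hw], extend_comp_self _ _ _⟩

lemma extend_self_comp (e : ι ↪ κ) (x : κ → Bool) : Function.extend e (x ∘ e) x = x :=
  ((eq_extend_iff e (x ∘ e) x x).2 ⟨fun _ _ => rfl, rfl⟩).symm

lemma OffIndep.extend {α : Type} {e : ι ↪ κ} {V : (κ → Bool) → α} (hV : OffIndep e V)
    (z : ι → Bool) (x : κ → Bool) : V (Function.extend e z x) = V x :=
  hV _ _ fun _ hw => extend_off e z x hw

lemma offIndep_inl {α : Type} (F : (ι → Bool) → α) :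
    OffIndep (Function.Embedding.inr : κ ↪ ι ⊕ κ) fun x => F (x ∘ Sum.inl) := by
  intro x y h
  have : x ∘ Sum.inl = y ∘ Sum.inl := funext fun i => h (Sum.inl i) (by simp)
  simp only [this]

lemma offIndep_none {α : Type} (F : Bool → α) :
    OffIndep (Function.Embedding.some : ι ↪ Option ι) fun x => F (x none) := by
  intro x y h
  simp only [h none (by simp)]

variable [Fintype ι] [DecidableEq ι] [Fintype κ] [DecidableEq κ]

/-- A row of `muxOn` is supported on the states that agree with $x$ off `e`, and these are
parametrized by their restriction $z$ to `e`. Circuit computations thereby reduce to sums over the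
small register. -/
lemma muxOn_mulVec (e : ι ↪ κ) (V : (κ → Bool) → QOp ι) (ψ : (κ → Bool) → ℂ) (x : κ → Bool) :
    (muxOn e V *ᵥ ψ) x = ∑ z, V x (x ∘ e) z * ψ (Function.extend e z x) := by
  classical
  rw [Matrix.mulVec, dotProduct]
  symm
  refine Finset.sum_of_injOn (fun z => Function.extend e z x) ?_ (by simp) ?_ ?_
  · intro z _ z' _ h
    have := congrArg (· ∘ e) h
    simpa only [extend_comp_self] using this
  · intro y _ hy
    rw [muxOn, if_neg, zero_mul]
    intro hxy
    refine hy ⟨y ∘ e, by simp, ?_⟩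
    exact ((eq_extend_iff e (y ∘ e) x y).2 ⟨hxy, rfl⟩).symm
  · intro z _
    rw [muxOn, if_pos fun w hw => (extend_off e z x hw).symm, extend_comp_self]

lemma applyOn_mulVec (e : ι ↪ κ) (M : QOp ι) (ψ : (κ → Bool) → ℂ) (x : κ → Bool) :
    (applyOn e M *ᵥ ψ) x = ∑ z, M (x ∘ e) z * ψ (Function.extend e z x) :=
  muxOn_mulVec e _ ψ x

lemma qop_ext {M N : QOp κ} (h : ∀ ψ, M *ᵥ ψ = N *ᵥ ψ) : M = N := by
  ext x y
  have := congrFun (h (Pi.single y 1)) x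
  simpa using this

/-- The left factor changes the basis state only on `e`, so the right factor still sees the same
selector. -/
lemma muxOn_mul (e : ι ↪ κ) (V : (κ → Bool) → QOp ι) {W : (κ → Bool) → QOp ι}
    (hW : OffIndep e W) : muxOn e V * muxOn e W = muxOn e fun x => V x * W x := by
  apply qop_ext
  intro ψ
  rw [← Matrix.mulVec_mulVec]
  funext x
  simp only [muxOn_mulVec, extend_extend, extend_comp_self, hW.extend, Matrix.mul_apply,
    Finset.mul_sum, Finset.sum_mul]
  rw [Finset.sum_comm]
  simp only [mul_assoc]

lemma muxOn_one (e : ι ↪ κ) : muxOn e (fun _ => 1) = 1 := by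
  apply qop_ext
  intro ψ
  funext x
  rw [muxOn_mulVec, Matrix.one_mulVec, Finset.sum_eq_single (x ∘ e)]
  · rw [extend_self_comp, Matrix.one_apply_eq, one_mul]
  · intro z _ hz; rw [Matrix.one_apply_ne hz.symm, zero_mul]
  · simp

omit [Fintype ι] [DecidableEq ι] [Fintype κ] [DecidableEq κ] in
lemma muxOn_conjTranspose (e : ι ↪ κ) {V : (κ → Bool) → QOp ι} (hV : OffIndep e V) :
    (muxOn e V)ᴴ = muxOn e fun x => (V x)ᴴ := by
  ext x y
  rw [Matrix.conjTranspose_apply, muxOn, muxOn]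
  by_cases h : ∀ w, w ∉ Set.range e → x w = y w
  · rw [if_pos h, if_pos fun w hw => (h w hw).symm, hV x y h, Matrix.conjTranspose_apply]
  · rw [if_neg h, if_neg, star_zero]
    exact fun h' => h fun w hw => (h' w hw).symm

lemma muxOn_unitary (e : ι ↪ κ) {V : (κ → Bool) → QOp ι} (hV : OffIndep e V)
    (hu : ∀ x, V x ∈ Matrix.unitaryGroup (ι → Bool) ℂ) :
    muxOn e V ∈ Matrix.unitaryGroup (κ → Bool) ℂ := by
  rw [Matrix.mem_unitaryGroup_iff, Matrix.star_eq_conjTranspose, muxOn_conjTranspose e hV,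
    muxOn_mul e V (fun x y h => by rw [hV x y h]), ← muxOn_one e]
  congr 1
  funext x
  exact Matrix.mem_unitaryGroup_iff.1 (hu x)

lemma applyOn_unitary (e : ι ↪ κ) {M : QOp ι} (hu : M ∈ Matrix.unitaryGroup (ι → Bool) ℂ) :
    applyOn e M ∈ Matrix.unitaryGroup (κ → Bool) ℂ :=
  muxOn_unitary e (offIndep_const e M) fun _ => hu

lemma applyOn_mul (e : ι ↪ κ) (M M' : QOp ι) :
    applyOn e (M * M') = applyOn e M * applyOn e M' :=
  (muxOn_mul e _ (offIndep_const e M')).symm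

lemma applyOn_one (e : ι ↪ κ) : applyOn e (1 : QOp ι) = 1 := muxOn_one e

omit [Fintype ι] [DecidableEq ι] [Fintype κ] [DecidableEq κ] in
lemma applyOn_conjTranspose (e : ι ↪ κ) (M : QOp ι) : applyOn e Mᴴ = (applyOn e M)ᴴ :=
  (muxOn_conjTranspose e (offIndep_const e M)).symm

omit [Fintype ι] [DecidableEq ι] [Fintype κ] [DecidableEq κ] in
lemma muxOn_muxOn (e : ι ↪ κ) (f : κ ↪ μ) (V : (μ → Bool) → (κ → Bool) → QOp ι) :
    muxOn f (fun x => muxOn e (V x)) = muxOn (e.trans f) fun x => V x (x ∘ f) := by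
  ext x y
  rw [muxOn, muxOn, muxOn]
  have hiff : (∀ w, w ∉ Set.range (e.trans f) → x w = y w) ↔
      (∀ w, w ∉ Set.range f → x w = y w) ∧ ∀ w, w ∉ Set.range e → (x ∘ f) w = (y ∘ f) w := by
    constructor
    · refine fun h => ⟨fun w hw => h w ?_, fun w hw => h _ ?_⟩
      · rintro ⟨i, rfl⟩; exact hw ⟨e i, rfl⟩
      · rintro ⟨i, hi⟩; exact hw ⟨i, f.injective hi⟩
    · rintro ⟨h1, h2⟩ w hw
      by_cases hf : w ∈ Set.range f
      · obtain ⟨v, rfl⟩ := hf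
        exact h2 v fun ⟨i, hi⟩ => hw ⟨i, by simp [← hi]⟩
      · exact h1 w hf
  by_cases h1 : ∀ w, w ∉ Set.range f → x w = y w
  · by_cases h2 : ∀ w, w ∉ Set.range e → (x ∘ f) w = (y ∘ f) w
    · rw [if_pos h1, if_pos h2, if_pos (hiff.2 ⟨h1, h2⟩)]; rfl
    · rw [if_pos h1, if_neg h2, if_neg fun h => h2 (hiff.1 h).2]
  · rw [if_neg h1, if_neg fun h => h1 (hiff.1 h).1]

omit [Fintype ι] [DecidableEq ι] [Fintype κ] [DecidableEq κ] in
lemma applyOn_muxOn (e : ι ↪ κ) (f : κ ↪ μ) (V : (κ → Bool) → QOp ι) :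
    applyOn f (muxOn e V) = muxOn (e.trans f) fun x => V (x ∘ f) := muxOn_muxOn e f fun _ => V

omit [Fintype ι] [DecidableEq ι] [Fintype κ] [DecidableEq κ] in
lemma applyOn_applyOn (e : ι ↪ κ) (f : κ ↪ μ) (M : QOp ι) :
    applyOn f (applyOn e M) = applyOn (e.trans f) M := applyOn_muxOn e f _

open Classical in
/-- The unitary that a multiplexer applies to its target when its index register is `z`. -/
def muxBlock {L : ℕ} (V : Fin L → QOp ι) (z : Fin (Nat.clog 2 L) → Bool) : QOp ι :=
  if h : bitsVal z < L then V ⟨_, h⟩ else 1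

-- This and `controlled_eq_muxOn` bring the oracles of the statement into the calculus of `muxOn`.
omit [DecidableEq ι] in
lemma multiplexed_eq_muxOn {L : ℕ} (V : Fin L → QOp ι) :
    multiplexed V = muxOn Function.Embedding.inr fun x => muxBlock V (x ∘ Sum.inl) := by
  ext x y
  have hiff : (∀ w, w ∉ Set.range (Function.Embedding.inr : ι ↪ Fin (Nat.clog 2 L) ⊕ ι) →
      x w = y w) ↔ x ∘ Sum.inl = y ∘ Sum.inl := by
    constructor
    · intro h; funext i; exact h _ (by simp)
    · rintro h (i | i) hw
      · exact congrFun h i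
      · simp at hw
  rw [multiplexed, muxOn]
  by_cases h : x ∘ Sum.inl = y ∘ Sum.inl
  · rw [if_pos h, if_pos (hiff.2 h), muxBlock]
    split_ifs with h1 h2
    · rfl
    · exact (Matrix.one_apply_eq (x ∘ _)).symm.trans (congrArg _ h2)
    · exact (Matrix.one_apply_ne h2).symm
  · rw [if_neg h, if_neg fun h' => h (hiff.1 h')]

omit [DecidableEq ι] in
lemma controlled_eq_muxOn (M : QOp ι) :
    controlled M = muxOn Function.Embedding.some fun x => if x none = true then M else 1 := by
  ext x y
  have hiff : (∀ w, w ∉ Set.range (Function.Embedding.some : ι ↪ Option ι) →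
      x w = y w) ↔ x none = y none := by
    constructor
    · intro h; exact h _ (by simp)
    · rintro h (_ | i) hw
      · exact h
      · simp at hw
  rw [controlled, muxOn]
  by_cases h : x none = y none
  · rw [if_pos h, if_pos (hiff.2 h)]
    split_ifs with h1 h2
    · rfl
    · exact (Matrix.one_apply_eq (x ∘ _)).symm.trans (congrArg _ h2)
    · exact (Matrix.one_apply_ne h2).symm
  · rw [if_neg h, if_neg fun h' => h (hiff.1 h')]

lemma muxBlock_unitary {L : ℕ} {V : Fin L → QOp ι}
    (hV : ∀ l, V l ∈ Matrix.unitaryGroup (ι → Bool) ℂ) (z : Fin (Nat.clog 2 L) → Bool) :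
    muxBlock V z ∈ Matrix.unitaryGroup (ι → Bool) ℂ := by
  unfold muxBlock
  split_ifs with h
  · exact hV _
  · exact one_mem _

lemma multiplexed_unitary {L : ℕ} {V : Fin L → QOp ι}
    (hV : ∀ l, V l ∈ Matrix.unitaryGroup (ι → Bool) ℂ) :
    multiplexed V ∈ Matrix.unitaryGroup (Fin (Nat.clog 2 L) ⊕ ι → Bool) ℂ := by
  rw [multiplexed_eq_muxOn]
  exact muxOn_unitary _ (offIndep_inl _) fun x => muxBlock_unitary hV _

lemma controlled_unitary {M : QOp ι} (hM : M ∈ Matrix.unitaryGroup (ι → Bool) ℂ) :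
    controlled M ∈ Matrix.unitaryGroup (Option ι → Bool) ℂ := by
  rw [controlled_eq_muxOn]
  refine muxOn_unitary _ (offIndep_none fun b => if b = true then M else 1) fun x => ?_
  split_ifs
  · exact hM
  · exact one_mem _

omit [DecidableEq ι] in
lemma controlled_conjTranspose (M : QOp ι) : controlled Mᴴ = (controlled M)ᴴ := by
  rw [controlled_eq_muxOn, controlled_eq_muxOn,
    muxOn_conjTranspose _ (offIndep_none fun b => if b = true then M else 1)]
  congr 1
  funext x
  split_ifs
  · rfl
  · rw [Matrix.conjTranspose_one]

end MuxOn

/-! ### Evolutions -/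

section Evolve

variable {ι : Type} [Fintype ι] [DecidableEq ι]

lemma evolve_add (G : QOp ι) (s t : ℝ) : evolve G (s + t) = evolve G s * evolve G t := by
  unfold evolve
  rw [← Matrix.exp_add_of_commute _ _ ((Commute.refl G).smul_left _ |>.smul_right _), ← add_smul]
  congr 2
  push_cast
  ring

lemma evolve_zero (G : QOp ι) : evolve G 0 = 1 := by
  simp [evolve]

lemma evolve_conjTranspose {G : QOp ι} (hG : G.IsHermitian) (t : ℝ) :
    (evolve G t)ᴴ = evolve G (-t) := by
  unfold evolve
  rw [← Matrix.exp_conjTranspose, Matrix.conjTranspose_smul, hG.eq]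
  congr 2
  simp

lemma evolve_unitary {G : QOp ι} (hG : G.IsHermitian) (t : ℝ) :
    evolve G t ∈ Matrix.unitaryGroup (ι → Bool) ℂ := by
  rw [Matrix.mem_unitaryGroup_iff, Matrix.star_eq_conjTranspose, evolve_conjTranspose hG,
    ← evolve_add, add_neg_cancel, evolve_zero]

end Evolve

/-- `Oracle.Reg` reduces only on a constructor, so the instances for a variable oracle need a case
distinction. -/
instance oracleRegFintype (nv nh N L : ℕ) : (o : Oracle) → Fintype (o.Reg nv nh N L)
  | .select => inferInstanceAs (Fintype (Fin (Nat.clog 2 L) ⊕ Fin nv))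
  | .evolution _ => inferInstanceAs (Fintype (Fin (Nat.clog 2 N) ⊕ (Fin nv ⊕ Fin nh)))
  | .prepare K => inferInstanceAs (Fintype (PrepReg L K))

instance oracleRegDecidableEq (nv nh N L : ℕ) : (o : Oracle) → DecidableEq (o.Reg nv nh N L)
  | .select => inferInstanceAs (DecidableEq (Fin (Nat.clog 2 L) ⊕ Fin nv))
  | .evolution _ => inferInstanceAs (DecidableEq (Fin (Nat.clog 2 N) ⊕ (Fin nv ⊕ Fin nh)))
  | .prepare K => inferInstanceAs (DecidableEq (PrepReg L K))

lemma ThermalInstance.oracle_unitary {nv nh N L : ℕ} (I : ThermalInstance nv nh N L) (o : Oracle) :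
    o.op I ∈ Matrix.unitaryGroup (o.Reg nv nh N L → Bool) ℂ := by
  cases o with
  | select => exact multiplexed_unitary I.U_unitary
  | evolution t => exact multiplexed_unitary fun j => evolve_unitary (I.G_hermitian j) t
  | prepare K => exact I.prep_unitary K

/-! ### Circuits over named wires -/

/-- Instructions over an arbitrary set of wires. -/
inductive Gate (nv nh N L : ℕ) (ι : Type) : Type
  | single (u : Matrix.unitaryGroup Bool ℂ) (w : ι) : Gate nv nh N L ι
  | toffoli (e : Fin 3 ↪ ι) : Gate nv nh N L ι
  | query (o : Oracle) (inv : Bool) (e : o.Reg nv nh N L ↪ ι) : Gate nv nh N L ι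
  | ctrlQuery (o : Oracle) (inv : Bool) (e : Option (o.Reg nv nh N L) ↪ ι) : Gate nv nh N L ι

/-- A wire, as an embedding of a one-qubit register. -/
def wire {ι : Type} (w : ι) : Unit ↪ ι := ⟨fun _ => w, fun _ _ _ => rfl⟩

@[simp] lemma wire_apply {ι : Type} (w : ι) (u : Unit) : wire w u = w := rfl

lemma singleOp_mul (u v : Matrix Bool Bool ℂ) : singleOp (u * v) = singleOp u * singleOp v := by
  ext x y
  rw [singleOp, Matrix.mul_apply, Matrix.mul_apply]
  refine Fintype.sum_equiv (Equiv.funUnique Unit Bool).symm _ _ fun b => rfl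

lemma singleOp_conjTranspose (u : Matrix Bool Bool ℂ) : singleOp uᴴ = (singleOp u)ᴴ := rfl

lemma singleOp_one : singleOp 1 = 1 := by
  ext x y
  rw [singleOp, Matrix.one_apply, Matrix.one_apply]
  congr 1
  rw [eq_iff_iff]
  exact ⟨fun h => funext fun _ => h, fun h => congrFun h _⟩

lemma singleOp_unitary {u : Matrix Bool Bool ℂ} (hu : u ∈ Matrix.unitaryGroup Bool ℂ) :
    singleOp u ∈ Matrix.unitaryGroup (Unit → Bool) ℂ := by
  rw [Matrix.mem_unitaryGroup_iff, Matrix.star_eq_conjTranspose, ← singleOp_conjTranspose,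
    ← singleOp_mul, ← Matrix.star_eq_conjTranspose, Matrix.mem_unitaryGroup_iff.1 hu, singleOp_one]

/-- The action of the Toffoli gate on basis states. -/
def toffoliMap (y : Fin 3 → Bool) : Fin 3 → Bool :=
  Function.update y 2 (xor (y 2) (y 0 && y 1))

lemma toffoliMap_toffoliMap (y : Fin 3 → Bool) : toffoliMap (toffoliMap y) = y := by
  revert y; decide

lemma toffoliOp_conjTranspose : toffoliOpᴴ = toffoliOp := by
  ext x y
  have : (y = toffoliMap x) ↔ (x = toffoliMap y) :=
    ⟨fun h => by rw [h, toffoliMap_toffoliMap], fun h => by rw [h, toffoliMap_toffoliMap]⟩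
  rw [Matrix.conjTranspose_apply]
  change star (if y = toffoliMap x then (1 : ℂ) else 0) = if x = toffoliMap y then 1 else 0
  simp only [this]
  split_ifs <;> simp

lemma toffoliOp_unitary : toffoliOp ∈ Matrix.unitaryGroup (Fin 3 → Bool) ℂ := by
  rw [Matrix.mem_unitaryGroup_iff, Matrix.star_eq_conjTranspose, toffoliOp_conjTranspose]
  ext x y
  rw [Matrix.mul_apply, Finset.sum_eq_single (toffoliMap x)]
  · change (if x = toffoliMap (toffoliMap x) then (1 : ℂ) else 0)
      * (if toffoliMap x = toffoliMap y then 1 else 0) = _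
    rw [toffoliMap_toffoliMap, if_pos rfl, one_mul, Matrix.one_apply]
    congr 1
    rw [eq_iff_iff]
    exact ⟨fun h => by rw [← toffoliMap_toffoliMap x, h, toffoliMap_toffoliMap], fun h => by rw [h]⟩
  · intro z _ hz
    change (if x = toffoliMap z then (1 : ℂ) else 0) * _ = _
    rw [if_neg, zero_mul]
    rintro rfl
    exact hz (toffoliMap_toffoliMap z).symm
  · simp

namespace Gate

variable {nv nh N L : ℕ} {ι : Type}

/-- The operator of a gate. -/
def op (I : ThermalInstance nv nh N L) : Gate nv nh N L ι → QOp ι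
  | single u w => applyOn (wire w) (singleOp u)
  | toffoli e => applyOn e toffoliOp
  | query o inv e => applyOn e (if inv then (o.op I)ᴴ else o.op I)
  | ctrlQuery o inv e => applyOn e (controlled (if inv then (o.op I)ᴴ else o.op I))

/-- Number of elementary gates. -/
def gateCost : Gate nv nh N L ι → ℕ
  | single _ _ => 1
  | toffoli _ => 1
  | query _ _ _ => 0
  | ctrlQuery _ _ _ => 0

/-- Number of queries. -/
def queryCost : Gate nv nh N L ι → ℕ
  | single _ _ => 0
  | toffoli _ => 0
  | query _ _ _ => 1
  | ctrlQuery _ _ _ => 1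

/-- The inverse gate. -/
def inv : Gate nv nh N L ι → Gate nv nh N L ι
  | single u w => single u⁻¹ w
  | toffoli e => toffoli e
  | query o b e => query o (!b) e
  | ctrlQuery o b e => ctrlQuery o (!b) e

/-- Placement of a gate on the wires of a larger register. -/
def toInstr {W : ℕ} (f : ι ↪ Fin W) : Gate nv nh N L ι → Instr nv nh N L W
  | single u w => .single u (f w)
  | toffoli e => .toffoli (e.trans f)
  | query o b e => .query o b (e.trans f)
  | ctrlQuery o b e => .ctrlQuery o b (e.trans f)

lemma toInstr_gateCost {W : ℕ} (f : ι ↪ Fin W) (g : Gate nv nh N L ι) :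
    (g.toInstr f).gateCost = g.gateCost := by cases g <;> rfl

lemma toInstr_queryCost {W : ℕ} (f : ι ↪ Fin W) (g : Gate nv nh N L ι) :
    (g.toInstr f).queryCost = g.queryCost := by cases g <;> rfl

lemma toInstr_op {W : ℕ} (f : ι ↪ Fin W) (I : ThermalInstance nv nh N L) (g : Gate nv nh N L ι) :
    (g.toInstr f).op I = applyOn f (g.op I) := by
  cases g with
  | single u w => exact (applyOn_applyOn (wire w) f (singleOp u)).symm
  | toffoli e => exact (applyOn_applyOn e f _).symm
  | query o b e => exact (applyOn_applyOn e f _).symm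
  | ctrlQuery o b e => exact (applyOn_applyOn e f _).symm

lemma inv_gateCost (g : Gate nv nh N L ι) : g.inv.gateCost = g.gateCost := by cases g <;> rfl

lemma inv_queryCost (g : Gate nv nh N L ι) : g.inv.queryCost = g.queryCost := by cases g <;> rfl

lemma ite_not_conjTranspose {κ : Type} (M : QOp κ) (b : Bool) :
    (if (!b) = true then Mᴴ else M) = (if b = true then Mᴴ else M)ᴴ := by
  cases b <;> simp

lemma inv_op (I : ThermalInstance nv nh N L) (g : Gate nv nh N L ι) : g.inv.op I = (g.op I)ᴴ := by
  cases g with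
  | single u w =>
    change applyOn _ (singleOp (star (u : Matrix Bool Bool ℂ))) = _
    rw [Matrix.star_eq_conjTranspose, singleOp_conjTranspose, applyOn_conjTranspose]
    rfl
  | toffoli e =>
    change applyOn e toffoliOp = (applyOn e toffoliOp)ᴴ
    rw [← applyOn_conjTranspose, toffoliOp_conjTranspose]
  | query o b e =>
    change applyOn e (if (!b) = true then _ else _) = (applyOn e _)ᴴ
    rw [← applyOn_conjTranspose, ite_not_conjTranspose]
  | ctrlQuery o b e =>
    change applyOn e (controlled (if (!b) = true then _ else _)) = (applyOn e (controlled _))ᴴ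
    rw [← applyOn_conjTranspose, ite_not_conjTranspose, controlled_conjTranspose]

variable [Fintype ι] [DecidableEq ι]

lemma op_unitary (I : ThermalInstance nv nh N L) (g : Gate nv nh N L ι) :
    g.op I ∈ Matrix.unitaryGroup (ι → Bool) ℂ := by
  have hq : ∀ (o : Oracle) (b : Bool), (if b = true then (o.op I)ᴴ else o.op I) ∈
      Matrix.unitaryGroup (o.Reg nv nh N L → Bool) ℂ := by
    intro o b
    split_ifs
    · exact Unitary.star_mem (I.oracle_unitary o)
    · exact I.oracle_unitary o
  cases g with
  | single u w => exact applyOn_unitary _ (singleOp_unitary u.2)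
  | toffoli e => exact applyOn_unitary _ toffoliOp_unitary
  | query o b e => exact applyOn_unitary _ (hq o b)
  | ctrlQuery o b e => exact applyOn_unitary _ (controlled_unitary (hq o b))

end Gate

section Circuit

variable {nv nh N L : ℕ} {ι : Type}

/-- Total number of elementary gates of a circuit. -/
def circGates (c : List (Gate nv nh N L ι)) : ℕ := (c.map Gate.gateCost).sum

/-- Total number of queries of a circuit. -/
def circQueries (c : List (Gate nv nh N L ι)) : ℕ := (c.map Gate.queryCost).sum

/-- The inverse circuit. -/
def circInv (c : List (Gate nv nh N L ι)) : List (Gate nv nh N L ι) := (c.map Gate.inv).reverse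

lemma circGates_append (c d : List (Gate nv nh N L ι)) :
    circGates (c ++ d) = circGates c + circGates d := by simp [circGates]

lemma circQueries_append (c d : List (Gate nv nh N L ι)) :
    circQueries (c ++ d) = circQueries c + circQueries d := by simp [circQueries]

lemma circGates_inv (c : List (Gate nv nh N L ι)) : circGates (circInv c) = circGates c := by
  simp [circGates, circInv, Function.comp_def, Gate.inv_gateCost]

lemma circQueries_inv (c : List (Gate nv nh N L ι)) : circQueries (circInv c) = circQueries c := by
  simp [circQueries, circInv, Function.comp_def, Gate.inv_queryCost]

variable [Fintype ι] [DecidableEq ι]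

/-- The operator of a circuit; the head of the list acts first. -/
def circOp (I : ThermalInstance nv nh N L) : List (Gate nv nh N L ι) → QOp ι
  | [] => 1
  | g :: c => circOp I c * g.op I

lemma circOp_append (I : ThermalInstance nv nh N L) (c d : List (Gate nv nh N L ι)) :
    circOp I (c ++ d) = circOp I d * circOp I c := by
  induction c with
  | nil => simp [circOp]
  | cons g c ih => rw [List.cons_append, circOp, ih, circOp, Matrix.mul_assoc]

lemma circOp_singleton (I : ThermalInstance nv nh N L) (g : Gate nv nh N L ι) :
    circOp I [g] = g.op I := Matrix.one_mul _

lemma circOp_inv (I : ThermalInstance nv nh N L) (c : List (Gate nv nh N L ι)) :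
    circOp I (circInv c) = (circOp I c)ᴴ := by
  induction c with
  | nil => simp [circOp, circInv]
  | cons g c ih =>
    have : circInv (g :: c) = circInv c ++ [g.inv] := by simp [circInv]
    rw [this, circOp_append, ih, circOp_singleton, Gate.inv_op, circOp, Matrix.conjTranspose_mul]

lemma circOp_unitary (I : ThermalInstance nv nh N L) (c : List (Gate nv nh N L ι)) :
    circOp I c ∈ Matrix.unitaryGroup (ι → Bool) ℂ := by
  induction c with
  | nil => exact one_mem _
  | cons g c ih => exact mul_mem ih (g.op_unitary I)

lemma foldl_toInstr {W : ℕ} (f : ι ↪ Fin W) (I : ThermalInstance nv nh N L)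
    (c : List (Gate nv nh N L ι)) (ψ : (Fin W → Bool) → ℂ) :
    (c.map (Gate.toInstr f)).foldl (fun ψ g => g.op I *ᵥ ψ) ψ = applyOn f (circOp I c) *ᵥ ψ := by
  induction c generalizing ψ with
  | nil => simp [circOp, applyOn_one]
  | cons g c ih =>
    rw [List.map_cons, List.foldl_cons, ih, circOp, applyOn_mul, ← Matrix.mulVec_mulVec,
      Gate.toInstr_op]

end Circuit

/-! ### Operators realized with the help of auxiliary wires -/

section Realizable

/-- Auxiliary wires: `P` of them are kept in state zero, `P` of them in state one. -/
abbrev Anc (P : ℕ) : Type := Fin P × Bool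

/-- The state `ψ` on the work wires, next to the auxiliary wires in their fixed state. -/
def withAnc {ω : Type} {P : ℕ} (ψ : (ω → Bool) → ℂ) : (ω ⊕ Anc P → Bool) → ℂ :=
  fun x => if x ∘ Sum.inr = Prod.snd then ψ (x ∘ Sum.inl) else 0

variable {nv nh N L : ℕ} {ω : Type} [Fintype ω] [DecidableEq ω]

/-- Some circuit with at most `g` gates and `q` queries acts on the work wires as `M`. -/
def Realizable (P : ℕ) (M : ThermalInstance nv nh N L → QOp ω) (g q : ℕ) : Prop :=
  ∃ c : List (Gate nv nh N L (ω ⊕ Anc P)), circGates c ≤ g ∧ circQueries c ≤ q ∧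
    ∀ I ψ, circOp I c *ᵥ withAnc ψ = withAnc (M I *ᵥ ψ)

variable {P : ℕ} {M M' : ThermalInstance nv nh N L → QOp ω} {g g' q q' : ℕ}

lemma Realizable.mono (h : Realizable P M g q) (hg : g ≤ g') (hq : q ≤ q') :
    Realizable P M g' q' := by
  obtain ⟨c, h1, h2, h3⟩ := h
  exact ⟨c, h1.trans hg, h2.trans hq, h3⟩

lemma Realizable.one : Realizable P (fun _ : ThermalInstance nv nh N L => (1 : QOp ω)) 0 0 :=
  ⟨[], le_rfl, le_rfl, fun I ψ => by simp [circOp]⟩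

lemma Realizable.mul (h : Realizable P M g q) (h' : Realizable P M' g' q') :
    Realizable P (fun I => M I * M' I) (g + g') (q + q') := by
  obtain ⟨c, h1, h2, h3⟩ := h
  obtain ⟨c', h1', h2', h3'⟩ := h'
  refine ⟨c' ++ c, ?_, ?_, fun I ψ => ?_⟩
  · rw [circGates_append]; omega
  · rw [circQueries_append]; omega
  · rw [circOp_append, ← Matrix.mulVec_mulVec, h3', h3, Matrix.mulVec_mulVec]

lemma Realizable.pow (h : Realizable P M g q) (r : ℕ) :
    Realizable P (fun I => M I ^ r) (r * g) (r * q) := by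
  induction r with
  | zero => simpa using Realizable.one
  | succ r ih =>
    simp only [pow_succ, Nat.succ_mul]
    exact ih.mul h

/-- The inverse circuit undoes the circuit on the vectors `withAnc (M I *ᵥ φ)`. As `M I` is unitary,
every `withAnc ψ` has this form, so the auxiliary wires return to their fixed state here as well. -/
lemma Realizable.adjoint (h : Realizable P M g q)
    (hM : ∀ I, M I ∈ Matrix.unitaryGroup (ω → Bool) ℂ) : Realizable P (fun I => (M I)ᴴ) g q := by
  obtain ⟨c, h1, h2, h3⟩ := h
  refine ⟨circInv c, by rwa [circGates_inv], by rwa [circQueries_inv], fun I ψ => ?_⟩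
  have e : ψ = M I *ᵥ ((M I)ᴴ *ᵥ ψ) := by
    rw [Matrix.mulVec_mulVec, ← Matrix.star_eq_conjTranspose, Matrix.mem_unitaryGroup_iff.1 (hM I),
      Matrix.one_mulVec]
  conv_lhs => rw [e]
  rw [← h3, circOp_inv, Matrix.mulVec_mulVec, ← Matrix.star_eq_conjTranspose (circOp I c),
    Matrix.mem_unitaryGroup_iff'.1 (circOp_unitary I c), Matrix.one_mulVec]

lemma Realizable.listProd {l : List (ThermalInstance nv nh N L → QOp ω)}
    (h : ∀ M ∈ l, Realizable P M g q) :
    Realizable P (fun I => (l.map fun M => M I).prod) (l.length * g) (l.length * q) := by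
  induction l with
  | nil => simpa using Realizable.one
  | cons M l ih =>
    simp only [List.map_cons, List.prod_cons, List.length_cons, Nat.succ_mul, Nat.add_comm _ g,
      Nat.add_comm _ q]
    exact (h M (by simp)).mul (ih fun M' hM' => h M' (by simp [hM']))

/-- A multiplexer whose targets are work wires, selected by work or auxiliary wires. -/
lemma muxOn_withAnc {ι : Type} [Fintype ι] [DecidableEq ι] (e : ι ↪ ω)
    (V : (ω ⊕ Anc P → Bool) → QOp ι) (ψ : (ω → Bool) → ℂ) :
    muxOn (e.trans Function.Embedding.inl) V *ᵥ withAnc ψ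
      = withAnc (muxOn e (fun x => V (Sum.elim x Prod.snd)) *ᵥ ψ) := by
  funext x
  have h1 : ∀ z, Function.extend (e.trans (Function.Embedding.inl : ω ↪ ω ⊕ Anc P)) z x ∘ Sum.inr
      = x ∘ Sum.inr := fun z => extend_comp_of_disjoint _ _ (by simp) z x
  have h2 : ∀ z, Function.extend (e.trans (Function.Embedding.inl : ω ↪ ω ⊕ Anc P)) z x ∘ Sum.inl
      = Function.extend e z (x ∘ Sum.inl) := by
    intro z
    rw [eq_extend_iff]
    refine ⟨fun w hw => ?_, ?_⟩
    · exact (extend_off _ z x (by rintro ⟨i, hi⟩; exact hw ⟨i, Sum.inl_injective hi⟩)).symm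
    · exact extend_comp_self (e.trans Function.Embedding.inl) z x
  rw [muxOn_mulVec]
  simp only [withAnc, h1, h2]
  split_ifs with h
  · rw [muxOn_mulVec]
    refine Finset.sum_congr rfl fun z _ => ?_
    have : Sum.elim (x ∘ Sum.inl) Prod.snd = x := by rw [← h]; exact Sum.elim_comp_inl_inr x
    rw [this]; rfl
  · simp

lemma Realizable.single (u : Matrix.unitaryGroup Bool ℂ) (w : ω) :
    Realizable P (fun _ : ThermalInstance nv nh N L => applyOn (wire w) (singleOp u)) 1 0 := by
  refine ⟨[Gate.single u (Sum.inl w)], by simp [circGates, Gate.gateCost],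
    by simp [circQueries, Gate.queryCost], fun I ψ => ?_⟩
  rw [circOp_singleton]
  exact muxOn_withAnc (wire w) (fun _ => singleOp u) ψ

lemma Realizable.prepare (K : ℕ) (e : PrepReg L K ↪ ω) :
    Realizable P (fun I : ThermalInstance nv nh N L => applyOn e (I.prep K)) 0 1 := by
  refine ⟨[Gate.query (.prepare K) false (e.trans Function.Embedding.inl)],
    by simp [circGates, Gate.gateCost], by simp [circQueries, Gate.queryCost], fun I ψ => ?_⟩
  rw [circOp_singleton]
  exact muxOn_withAnc e (fun _ => I.prep K) ψ

/-- The bits of `j` on auxiliary wires. -/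
def ancBits {P b : ℕ} (hb : b ≤ P) (j : ℕ) : Fin b ↪ Anc P :=
  ⟨fun i => (Fin.castLE hb i, Nat.testBit j i), fun i i' h => by
    have := congrArg (fun p : Anc P => (p.1 : ℕ)) h
    exact Fin.ext this⟩

lemma bitsVal_testBit {b j : ℕ} (hj : j < 2 ^ b) : bitsVal (fun i : Fin b => Nat.testBit j i) = j := by
  induction b generalizing j with
  | zero => simp [bitsVal] at *; omega
  | succ b ih =>
    have h := ih (j := j / 2) (by rw [Nat.div_lt_iff_lt_mul (by norm_num), ← pow_succ]; exact hj)
    rw [bitsVal, Fin.sum_univ_succ]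
    simp only [Fin.val_zero, Fin.val_succ, Nat.testBit_succ, pow_succ, Nat.testBit_zero]
    rw [bitsVal] at h
    have h2 : ∑ i : Fin b, (if (j / 2).testBit i = true then 2 ^ (i : ℕ) * 2 else 0) = j / 2 * 2 := by
      rw [← h, Finset.sum_mul, h]
      exact Finset.sum_congr rfl fun i _ => by split_ifs <;> simp
    rw [h2]
    by_cases hodd : j % 2 = 1
    · simp [hodd]; omega
    · simp [hodd]; omega

/-- The index register of the oracle is wired to auxiliary constants that spell $j$ in binary; the
multiplexer then always selects its $j$-th block, without any gates. -/
lemma Realizable.evolution (hP : Nat.clog 2 N ≤ P) (e : Fin nv ⊕ Fin nh ↪ ω) (j : Fin N) (t : ℝ) :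
    Realizable P (fun I : ThermalInstance nv nh N L => applyOn e (evolve (I.G j) t)) 0 1 := by
  have hinj : Function.Injective (Sum.elim (Sum.inr ∘ ancBits hP j : _ → ω ⊕ Anc P)
      (Sum.inl ∘ e)) := by
    rintro (i | i) (i' | i') h
    · simp only [Sum.elim_inl, Function.comp, Sum.inr.injEq] at h
      rw [(ancBits hP (j : ℕ)).injective h]
    · simp at h
    · simp at h
    · simp only [Sum.elim_inr, Function.comp, Sum.inl.injEq] at h
      rw [e.injective h]
  refine ⟨[Gate.query (.evolution t) false ⟨_, hinj⟩],
    by simp [circGates, Gate.gateCost], by simp [circQueries, Gate.queryCost], fun I ψ => ?_⟩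
  rw [circOp_singleton]
  change applyOn ⟨_, hinj⟩ (multiplexed fun j => evolve (I.G j) t) *ᵥ _ = _
  rw [multiplexed_eq_muxOn, applyOn_muxOn]
  have he : Function.Embedding.inr.trans (⟨_, hinj⟩ : _ ↪ ω ⊕ Anc P)
      = e.trans Function.Embedding.inl := by ext i; rfl
  rw [he, muxOn_withAnc]
  congr 2
  beta_reduce
  rw [applyOn_eq_muxOn]
  congr 1
  funext x
  have hz : (Sum.elim x Prod.snd ∘ (⟨_, hinj⟩ : _ ↪ ω ⊕ Anc P)) ∘ Sum.inl
      = fun i : Fin (Nat.clog 2 N) => Nat.testBit j i := by funext i; rfl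
  have hv := bitsVal_testBit (j.2.trans_le (Nat.le_pow_clog (b := 2) (by norm_num) N))
  rw [hz, muxBlock, dif_pos (by rw [hv]; exact j.2)]
  congr 2
  exact Fin.ext hv

/-- Select, controlled by the wire `c`, with index register `d` and target `e`. -/
lemma Realizable.ctrlSelect (c : ω) (d : Fin (Nat.clog 2 L) ↪ ω) (e : Fin nv ↪ ω)
    (hcd : ∀ i, c ≠ d i) (hce : ∀ i, c ≠ e i) (hde : ∀ i j, d i ≠ e j) :
    Realizable P (fun I : ThermalInstance nv nh N L =>
      muxOn e fun x => if x c = true then muxBlock I.U (x ∘ d) else 1) 0 1 := by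
  have hinj : Function.Injective (fun o : Option (Fin (Nat.clog 2 L) ⊕ Fin nv) =>
      (Sum.inl (o.elim c (Sum.elim d e)) : ω ⊕ Anc P)) := by
    rintro (_ | i | i) (_ | i' | i') h <;> simp_all
    · exact absurd h.symm (hcd _)
    · exact absurd h.symm (hce _)
    · exact absurd h.symm (hde _ _)
  refine ⟨[Gate.ctrlQuery .select false ⟨_, hinj⟩],
    by simp [circGates, Gate.gateCost], by simp [circQueries, Gate.queryCost], fun I ψ => ?_⟩
  rw [circOp_singleton]
  change applyOn ⟨_, hinj⟩ (controlled (multiplexed I.U)) *ᵥ _ = _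
  rw [controlled_eq_muxOn]
  -- The control moves inside the multiplexer, so that controlled Select becomes a single `muxOn` on
  -- the target wires.
  have hfun : (fun x : Option (Fin (Nat.clog 2 L) ⊕ Fin nv) → Bool =>
      if x none = true then multiplexed I.U else 1)
      = fun x => muxOn Function.Embedding.inr fun y =>
          if x none = true then muxBlock I.U (y ∘ Sum.inl) else 1 := by
    funext x
    split_ifs
    · exact multiplexed_eq_muxOn _
    · exact (muxOn_one _).symm
  have hmux : muxOn Function.Embedding.some (fun x : Option (Fin (Nat.clog 2 L) ⊕ Fin nv) → Bool =>
      if x none = true then multiplexed I.U else 1)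
      = muxOn (Function.Embedding.inr.trans Function.Embedding.some) fun x =>
        if x none = true then muxBlock I.U (x ∘ some ∘ Sum.inl) else 1 := by
    rw [hfun]
    exact muxOn_muxOn _ _ fun x y => if x none = true then muxBlock I.U (y ∘ Sum.inl) else 1
  rw [hmux, applyOn_muxOn]
  have he : (Function.Embedding.inr.trans Function.Embedding.some).trans
      (⟨_, hinj⟩ : _ ↪ ω ⊕ Anc P) = e.trans Function.Embedding.inl := by ext i; rfl
  rw [he, muxOn_withAnc]
  rfl

end Realizable

/-! ### Classical gates, reflections, and maximally entangled pairs -/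

section Perm

variable {ι κ : Type} [Fintype ι] [DecidableEq ι] [Fintype κ] [DecidableEq κ]

/-- The operator that maps the basis state `y` to the basis state `f y`. -/
def permOp (f : (κ → Bool) → κ → Bool) : QOp κ := fun x y => if x = f y then 1 else 0

omit [Fintype ι] [DecidableEq ι] [Fintype κ] [DecidableEq κ] in
lemma applyOn_permOp [Fintype ι] [Fintype κ] (e : ι ↪ κ) (f : (ι → Bool) → ι → Bool) :
    applyOn e (permOp f) = permOp fun y => Function.extend e (f (y ∘ e)) y := by
  ext x y
  rw [applyOn, permOp, permOp]
  have h := eq_extend_iff e (f (y ∘ e)) y x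
  by_cases h1 : ∀ w, w ∉ Set.range e → x w = y w
  · rw [if_pos h1]
    congr 1
    rw [h, eq_iff_iff]
    exact ⟨fun h2 => ⟨fun w hw => (h1 w hw).symm, h2⟩, fun h2 => h2.2⟩
  · rw [if_neg h1, if_neg]
    exact fun h2 => h1 fun w hw => ((h.1 h2).1 w hw).symm

lemma permOp_mulVec_single (f : (κ → Bool) → κ → Bool) (y : κ → Bool) :
    permOp f *ᵥ Pi.single y 1 = Pi.single (f y) 1 := by
  funext x
  rw [Matrix.mulVec_single_one, Matrix.col_apply, permOp, Pi.single_apply]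

lemma permOp_mul (f g : (κ → Bool) → κ → Bool) : permOp f * permOp g = permOp (f ∘ g) := by
  ext x y
  rw [Matrix.mul_apply, Finset.sum_eq_single (g y)]
  · simp [permOp]
  · intro z _ hz
    simp [permOp, hz]
  · simp

lemma permOp_mulVec_of_involutive {f : (κ → Bool) → κ → Bool} (hf : Function.Involutive f)
    (ψ : (κ → Bool) → ℂ) (x : κ → Bool) : (permOp f *ᵥ ψ) x = ψ (f x) := by
  rw [Matrix.mulVec, dotProduct, Finset.sum_eq_single (f x)]
  · simp [permOp, hf x]
  · intro z _ hz
    rw [permOp, if_neg, zero_mul]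
    rintro rfl
    exact hz (hf z).symm
  · simp

omit [Fintype ι] [DecidableEq ι] [Fintype κ] in
lemma extend_wire (w : κ) (z : Unit → Bool) (x : κ → Bool) :
    Function.extend (wire w) z x = Function.update x w (z ()) := by
  symm
  rw [eq_extend_iff]
  refine ⟨fun v hv => ?_, funext fun _ => by simp⟩
  rw [Function.update_of_ne]
  rintro rfl
  exact hv ⟨(), rfl⟩

/-- The bit flip. -/
def flipGate : Matrix.unitaryGroup Bool ℂ :=
  ⟨Matrix.of fun a b => if a = !b then 1 else 0, by
    rw [Matrix.mem_unitaryGroup_iff]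
    ext a b
    cases a <;> cases b <;> simp [Matrix.mul_apply, Matrix.star_apply]⟩

/-- The phase flip. -/
def phaseGate : Matrix.unitaryGroup Bool ℂ :=
  ⟨Matrix.diagonal fun a => if a = true then -1 else 1, by
    rw [Matrix.mem_unitaryGroup_iff]
    ext a b
    cases a <;> cases b <;> simp [Matrix.mul_apply, Matrix.star_apply, Matrix.diagonal]⟩

/-- The Hadamard gate. -/
def hadamardGate : Matrix.unitaryGroup Bool ℂ :=
  ⟨Matrix.of fun a b => ((1 / √2 : ℝ) : ℂ) * if a && b then -1 else 1, by
    have h : ((√2 : ℝ) : ℂ)⁻¹ * ((√2 : ℝ) : ℂ)⁻¹ = 1 / 2 := by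
      rw [← mul_inv, ← Complex.ofReal_mul, Real.mul_self_sqrt (by norm_num)]; norm_num
    rw [Matrix.mem_unitaryGroup_iff]
    ext a b
    cases a <;> cases b <;> simp [Matrix.mul_apply, Matrix.star_apply, h] <;> norm_num⟩

lemma applyOn_flipGate (w : κ) :
    applyOn (wire w) (singleOp flipGate) = permOp fun y => Function.update y w (!y w) := by
  have : singleOp (flipGate : Matrix Bool Bool ℂ) = permOp fun y _ => !y () := by
    ext x y
    change (if x () = !y () then (1 : ℂ) else 0) = if x = _ then 1 else 0
    congr 1
    rw [eq_iff_iff]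
    exact ⟨fun h => funext fun _ => h, fun h => congrFun h ()⟩
  rw [this, applyOn_permOp]
  simp only [extend_wire]
  rfl

/-- Three distinct wires, as an embedding. -/
def tripleWires (a b c : κ) (hab : a ≠ b) (hac : a ≠ c) (hbc : b ≠ c) : Fin 3 ↪ κ :=
  ⟨![a, b, c], by
    intro i j h
    fin_cases i <;> fin_cases j <;> simp_all [eq_comm]⟩

lemma applyOn_toffoliOp {a b c : κ} (hab : a ≠ b) (hac : a ≠ c) (hbc : b ≠ c) :
    applyOn (tripleWires a b c hab hac hbc) toffoliOp
      = permOp fun y => Function.update y c (xor (y c) (y a && y b)) := by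
  change applyOn _ (permOp toffoliMap) = _
  rw [applyOn_permOp]
  congr 1
  funext y
  symm
  rw [eq_extend_iff]
  constructor
  · intro w hw
    rw [Function.update_of_ne]
    rintro rfl
    exact hw ⟨2, rfl⟩
  · funext i
    fin_cases i
    · exact Function.update_of_ne hac _ _
    · exact Function.update_of_ne hbc _ _
    · exact Function.update_self _ _ _

end Perm

/-! ### Multiply controlled phase flips from Toffoli gates -/

section Reflection

variable {nv nh N L : ℕ} {ι : Type} [Fintype ι] [DecidableEq ι]

/-- A Toffoli gate conjugated by a bit flip of its second control. -/
lemma exists_andNot_circuit {a w t : ι} (haw : a ≠ w) (hat : a ≠ t) (hwt : w ≠ t) :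
    ∃ c : List (Gate nv nh N L ι), circGates c = 3 ∧ circQueries c = 0 ∧
      ∀ I, circOp I c = permOp fun y => Function.update y t (xor (y t) (y a && !y w)) := by
  refine ⟨[.single flipGate w, .toffoli (tripleWires a w t haw hat hwt), .single flipGate w],
    rfl, rfl, fun I => ?_⟩
  simp only [circOp, Gate.op, Matrix.one_mul]
  rw [applyOn_flipGate, applyOn_toffoliOp, permOp_mul, permOp_mul]
  congr 1
  funext y v
  simp only [Function.comp]
  by_cases hv : v = w
  · subst hv; simp [hwt]
  · by_cases hv' : v = t
    · subst hv'; simp [haw, hv]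
    · simp [hv, hv']

/-- A phase flip controlled by the wire `a` and by the absence of excitations on a list of
wires, each of which comes with a scratch wire. -/
lemma exists_phase_circuit (l : List (ι × ι)) : ∀ a : ι,
    (∀ p ∈ l, p.1 ≠ a) → (∀ p ∈ l, p.2 ≠ a) → (∀ p ∈ l, ∀ p' ∈ l, p.1 ≠ p'.2) →
    (l.map Prod.snd).Nodup →
    ∃ c : List (Gate nv nh N L ι), circGates c = 6 * l.length + 1 ∧ circQueries c = 0 ∧
      ∀ I y, (∀ p ∈ l, y p.2 = false) →
        circOp I c *ᵥ Pi.single y 1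
          = (if y a = true ∧ ∀ p ∈ l, y p.1 = false then (-1 : ℂ) else 1) • Pi.single y 1 := by
  induction l with
  | nil =>
    intro a _ _ _ _
    refine ⟨[.single phaseGate a], rfl, rfl, fun I y _ => ?_⟩
    rw [circOp_singleton]
    funext x
    simp only [Gate.op]
    rw [applyOn_mulVec, Finset.sum_eq_single (x ∘ wire a)]
    · rw [extend_self_comp]
      by_cases hxy : x = y
      · subst hxy
        simp [singleOp, phaseGate]
      · simp [hxy]
    · intro z _ hz
      have : z () ≠ x a := fun h => hz (funext fun _ => h)
      simp [singleOp, phaseGate, Matrix.diagonal_apply_ne _ this.symm]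
    · simp
  | cons p l ih =>
    obtain ⟨w, t⟩ := p
    intro a h1 h2 h3 h4
    simp only [List.map_cons, List.nodup_cons] at h4
    have hwt : w ≠ t := h3 (w, t) (by simp) (w, t) (by simp)
    have hat : a ≠ t := (h2 (w, t) (by simp)).symm
    have haw : a ≠ w := (h1 (w, t) (by simp)).symm
    have hlt : ∀ p ∈ l, p.1 ≠ t := fun p hp => h3 p (by simp [hp]) (w, t) (by simp)
    have hlt2 : ∀ p ∈ l, p.2 ≠ t := fun p hp h => h4.1 (h ▸ List.mem_map_of_mem (f := Prod.snd) hp)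
    -- The scratch wire $t$ receives $a\wedge\neg w$ and serves as the control for the remaining
    -- list; running `d` again clears it. This makes six gates per listed wire.
    obtain ⟨c, c1, c2, c3⟩ := ih t hlt hlt2
      (fun p hp p' hp' => h3 p (by simp [hp]) p' (by simp [hp'])) h4.2
    obtain ⟨d, d1, d2, d3⟩ := exists_andNot_circuit (nv := nv) (nh := nh) (N := N) (L := L)
      haw hat hwt
    refine ⟨d ++ c ++ d, ?_, ?_, fun I y hy => ?_⟩
    · rw [circGates_append, circGates_append, c1, d1, List.length_cons]; ring
    · rw [circQueries_append, circQueries_append, c2, d2]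
    · have hyt : y t = false := hy (w, t) (by simp)
      rw [circOp_append, circOp_append, d3, ← Matrix.mulVec_mulVec, ← Matrix.mulVec_mulVec,
        permOp_mulVec_single, c3, Matrix.mulVec_smul, permOp_mulVec_single]
      · congr 1
        · congr 1
          rw [eq_iff_iff]
          have e : ∀ p ∈ l, Function.update y t (xor (y t) (y a && !y w)) p.1 = y p.1 :=
            fun p hp => Function.update_of_ne (hlt p hp) _ _
          constructor
          · rintro ⟨g1, g2⟩
            simp [hyt] at g1
            refine ⟨g1.1, fun p hp => ?_⟩
            rcases List.mem_cons.1 hp with rfl | hp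
            · exact g1.2
            · rw [← e p hp]; exact g2 p hp
          · rintro ⟨g1, g2⟩
            refine ⟨?_, fun p hp => ?_⟩
            · simp [hyt, g1, g2 (w, t) (by simp)]
            · rw [e p hp]; exact g2 p (by simp [hp])
        · congr 1
          funext v
          by_cases hv : v = t
          · subst hv; simp [hat, hwt]
          · simp [hv]
      · intro p hp
        rw [Function.update_of_ne (hlt2 p hp)]
        exact hy p (by simp [hp])

end Reflection

/-! ### Reflections and entangled pairs on the work wires -/

section RealizableGates

lemma sum_elim_snd_eq_iff {ω : Type} {P : ℕ} {x : ω ⊕ Anc P → Bool} {y : ω → Bool} :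
    x = Sum.elim y Prod.snd ↔ x ∘ Sum.inr = Prod.snd ∧ x ∘ Sum.inl = y := by
  constructor
  · rintro rfl; exact ⟨rfl, rfl⟩
  · rintro ⟨h1, rfl⟩; rw [← h1, Sum.elim_comp_inl_inr]

variable {nv nh N L P : ℕ} {ω : Type} [Fintype ω] [DecidableEq ω]
  {M : ThermalInstance nv nh N L → QOp ω} {g q : ℕ}

omit [DecidableEq ω] in
lemma withAnc_single (y : ω → Bool) :
    withAnc (P := P) (Pi.single y 1) = Pi.single (Sum.elim y Prod.snd) 1 := by
  funext x
  simp only [withAnc, Pi.single_apply, sum_elim_snd_eq_iff]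
  split_ifs <;> simp_all

/-- Adjoining the auxiliary wires, as a matrix. -/
def ancMatrix (P : ℕ) (ω : Type) [Fintype ω] : Matrix (ω ⊕ Anc P → Bool) (ω → Bool) ℂ :=
  fun x y => if x = Sum.elim y Prod.snd then 1 else 0

lemma ancMatrix_mulVec (ψ : (ω → Bool) → ℂ) : ancMatrix P ω *ᵥ ψ = withAnc ψ := by
  funext x
  rw [Matrix.mulVec, dotProduct, Finset.sum_eq_single (x ∘ Sum.inl)]
  · simp [ancMatrix, withAnc, sum_elim_snd_eq_iff]
  · intro y _ hy
    rw [ancMatrix, if_neg, zero_mul]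
    rw [sum_elim_snd_eq_iff]
    exact fun h => hy h.2.symm
  · simp

lemma ancMatrix_isometry : (ancMatrix P ω)ᴴ * ancMatrix P ω = 1 := by
  ext y y'
  rw [Matrix.mul_apply, Finset.sum_eq_single (Sum.elim y Prod.snd)]
  · simp only [Matrix.conjTranspose_apply, ancMatrix, if_true, star_one, one_mul, Matrix.one_apply]
    congr 1
    rw [eq_iff_iff, sum_elim_snd_eq_iff]
    simp
  · intro x _ hx
    simp [ancMatrix, hx]
  · simp

lemma mul_ancMatrix_of_realizes {I : ThermalInstance nv nh N L} {c : List (Gate nv nh N L (ω ⊕ Anc P))}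
    {A : QOp ω} (h : ∀ ψ, circOp I c *ᵥ withAnc ψ = withAnc (A *ᵥ ψ)) :
    circOp I c * ancMatrix P ω = ancMatrix P ω * A := by
  ext x y
  have h1 := congrFun (h (Pi.single y 1)) x
  rw [← ancMatrix_mulVec, ← ancMatrix_mulVec, Matrix.mulVec_mulVec, Matrix.mulVec_mulVec] at h1
  simpa using h1

/-- If $V$ is the isometry adjoining the auxiliary wires and $C$ the circuit, then $CV=VM$, hence
$M^\dagger M=V^\dagger C^\dagger CV=1$. -/
lemma Realizable.unitary (h : Realizable P M g q) (I : ThermalInstance nv nh N L) :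
    M I ∈ Matrix.unitaryGroup (ω → Bool) ℂ := by
  obtain ⟨c, -, -, h3⟩ := h
  have e := mul_ancMatrix_of_realizes (h3 I)
  rw [Matrix.mem_unitaryGroup_iff', Matrix.star_eq_conjTranspose]
  calc (M I)ᴴ * M I = (M I)ᴴ * ((ancMatrix P ω)ᴴ * ancMatrix P ω) * M I := by
        rw [ancMatrix_isometry, Matrix.mul_one]
    _ = (ancMatrix P ω * M I)ᴴ * (ancMatrix P ω * M I) := by
        rw [Matrix.conjTranspose_mul]; simp only [Matrix.mul_assoc]
    _ = (ancMatrix P ω)ᴴ * ((circOp I c)ᴴ * circOp I c) * ancMatrix P ω := by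
        rw [← e, Matrix.conjTranspose_mul]; simp only [Matrix.mul_assoc]
    _ = 1 := by
        rw [← Matrix.star_eq_conjTranspose (circOp I c),
          Matrix.mem_unitaryGroup_iff'.1 (circOp_unitary I c), Matrix.mul_one, ancMatrix_isometry]

lemma realizes_of_basis {I : ThermalInstance nv nh N L} {c : List (Gate nv nh N L (ω ⊕ Anc P))}
    {A : QOp ω} (h : ∀ y, circOp I c *ᵥ Pi.single (Sum.elim y Prod.snd) 1
      = withAnc (A *ᵥ Pi.single y 1)) (ψ : (ω → Bool) → ℂ) :
    circOp I c *ᵥ withAnc ψ = withAnc (A *ᵥ ψ) := by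
  have e : circOp I c * ancMatrix P ω = ancMatrix P ω * A := by
    ext x y
    have h1 := congrFun (h y) x
    rw [← withAnc_single, ← ancMatrix_mulVec, ← ancMatrix_mulVec, Matrix.mulVec_mulVec,
      Matrix.mulVec_mulVec] at h1
    simpa using h1
  rw [← ancMatrix_mulVec, ← ancMatrix_mulVec, Matrix.mulVec_mulVec, Matrix.mulVec_mulVec, e]

/-- The reflection that changes the sign of the basis states vanishing on `S`. -/
def reflOp (S : Finset ω) : QOp ω :=
  Matrix.diagonal fun x => if ∀ w ∈ S, x w = false then -1 else 1

/-- The phase circuit with an auxiliary one as its ever-satisfied control and auxiliary zeros as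
scratch. -/
lemma Realizable.reflection (hP : Fintype.card ω + 1 ≤ P) (S : Finset ω) :
    Realizable P (fun _ : ThermalInstance nv nh N L => reflOp S) (6 * Fintype.card ω + 1) 0 := by
  have hcard : Fintype.card ω ≤ P := by omega
  obtain ⟨τ⟩ : Nonempty (ω ↪ Fin P) := by
    rw [Function.Embedding.nonempty_iff_card_le, Fintype.card_fin]; exact hcard
  have hlen : S.toList.length ≤ Fintype.card ω := by
    rw [Finset.length_toList]; exact Finset.card_le_univ S
  obtain ⟨c, h1, h2, h3⟩ := exists_phase_circuit (nv := nv) (nh := nh) (N := N) (L := L)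
    (S.toList.map fun w => ((Sum.inl w, Sum.inr (τ w, false)) :
      (ω ⊕ Anc P) × (ω ⊕ Anc P))) (Sum.inr (⟨0, by omega⟩, true))
    (by simp) (by simp) (by simp) (by
      rw [List.map_map]
      refine List.Nodup.map (fun w w' h => ?_) S.nodup_toList
      simpa using h)
  refine ⟨c, ?_, h2.le, fun I => realizes_of_basis fun y => ?_⟩
  · rw [h1, List.length_map]; omega
  · rw [h3 I _ (by simp)]
    have : reflOp S *ᵥ Pi.single y 1
        = (if ∀ w ∈ S, y w = false then (-1 : ℂ) else 1) • Pi.single y 1 := by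
      funext x
      rw [reflOp, Matrix.mulVec_diagonal]
      by_cases hx : x = y
      · subst hx; simp
      · simp [hx]
    rw [this, ← ancMatrix_mulVec, Matrix.mulVec_smul, ancMatrix_mulVec, withAnc_single]
    simp

/-- The controlled bit flip. -/
def cnotOp (a b : ω) : QOp ω := permOp fun y => Function.update y b (xor (y b) (y a))

/-- A Toffoli gate whose first control is an auxiliary wire in state one. -/
lemma Realizable.cnot (hP : 1 ≤ P) {a b : ω} (hab : a ≠ b) :
    Realizable P (fun _ : ThermalInstance nv nh N L => cnotOp a b) 1 0 := by
  refine ⟨[.toffoli (tripleWires (Sum.inr (⟨0, by omega⟩, true)) (Sum.inl a) (Sum.inl b)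
    (by simp) (by simp) (by simpa using hab))], by simp [circGates, Gate.gateCost],
    by simp [circQueries, Gate.queryCost], fun I => realizes_of_basis fun y => ?_⟩
  rw [circOp_singleton]
  simp only [Gate.op]
  rw [applyOn_toffoliOp, permOp_mulVec_single, cnotOp, permOp_mulVec_single, withAnc_single]
  congr 1
  rw [sum_elim_snd_eq_iff]
  refine ⟨funext fun p => Function.update_of_ne Sum.inr_ne_inl _ _, funext fun w => ?_⟩
  by_cases hw : w = b
  · subst hw
    rw [Function.comp_apply, Function.update_self, Function.update_self]
    rfl
  · rw [Function.comp_apply, Function.update_of_ne fun h => hw (Sum.inl_injective h),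
      Function.update_of_ne hw]
    rfl

/-- The state that has each pair of wires `v i`, `r i` maximally entangled for `i ∈ s`, and all
other wires in state zero. -/
def pairState {k : ℕ} (v r : Fin k ↪ ω) (s : Finset (Fin k)) : (ω → Bool) → ℂ :=
  fun x => if (∀ i ∈ s, x (v i) = x (r i)) ∧ ∀ w, (∀ i ∈ s, w ≠ v i ∧ w ≠ r i) → x w = false
    then (((1 / √2) ^ s.card : ℝ) : ℂ) else 0

/-- The wire $v_j$ is still in state zero, so only the zero column of the Hadamard gate contributes,
with amplitude $1/\sqrt2$ for either value of the new bit; the controlled flip copies this bit to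
$r_j$. -/
lemma cnot_hadamard_pairState {k : ℕ} {v r : Fin k ↪ ω} (hvr : ∀ i j, v i ≠ r j)
    {s : Finset (Fin k)} {j : Fin k} (hj : j ∉ s) :
    (cnotOp (v j) (r j) * applyOn (wire (v j)) (singleOp hadamardGate)) *ᵥ pairState v r s
      = pairState v r (insert j s) := by
  have hinv : Function.Involutive fun y : ω → Bool =>
      Function.update y (r j) (xor (y (r j)) (y (v j))) := by
    intro y
    funext w
    by_cases hw : w = r j
    · subst hw; simp [hvr]
    · simp [hw]
  have hvj : ∀ i ∈ s, v j ≠ v i := fun i hi h => hj (v.injective h ▸ hi)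
  have hrj : ∀ i ∈ s, r j ≠ r i := fun i hi h => hj (r.injective h ▸ hi)
  rw [← Matrix.mulVec_mulVec]
  funext x
  rw [cnotOp, permOp_mulVec_of_involutive hinv, applyOn_mulVec,
    Finset.sum_eq_single (fun _ => false)]
  · rw [extend_wire]
    have h1 : singleOp (hadamardGate : Matrix Bool Bool ℂ)
        ((fun y : ω → Bool => Function.update y (r j) (xor (y (r j)) (y (v j)))) x ∘ wire (v j))
        (fun _ => false) = ((1 / √2 : ℝ) : ℂ) := by
      simp [singleOp, hadamardGate]
    rw [h1, pairState, pairState, Finset.card_insert_of_notMem hj, pow_succ', mul_ite, mul_zero,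
      Complex.ofReal_mul]
    congr 1
    rw [eq_iff_iff]
    have e1 : ∀ i ∈ s, ∀ b b', Function.update (Function.update x (r j) b) (v j) b' (v i) = x (v i) := by
      intro i hi b b'
      rw [Function.update_of_ne (hvj i hi).symm, Function.update_of_ne (hvr i j)]
    have e2 : ∀ i ∈ s, ∀ b b', Function.update (Function.update x (r j) b) (v j) b' (r i) = x (r i) := by
      intro i hi b b'
      rw [Function.update_of_ne (hvr j i).symm, Function.update_of_ne (hrj i hi).symm]
    constructor
    · rintro ⟨h1, h2⟩
      refine ⟨fun i hi => ?_, fun w hw => ?_⟩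
      · rcases Finset.mem_insert.1 hi with rfl | hi
        · have := h2 (r i) fun i' hi' => ⟨(hvr i' i).symm, hrj i' hi'⟩
          rw [Function.update_of_ne (hvr i i).symm, Function.update_self] at this
          revert this
          cases x (v i) <;> cases x (r i) <;> simp
        · have := h1 i hi
          rwa [e1 i hi, e2 i hi] at this
      · have := h2 w fun i hi => hw i (Finset.mem_insert_of_mem hi)
        have hwj := hw j (Finset.mem_insert_self j s)
        rwa [Function.update_of_ne hwj.1, Function.update_of_ne hwj.2] at this
    · rintro ⟨h1, h2⟩
      refine ⟨fun i hi => ?_, fun w hw => ?_⟩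
      · rw [e1 i hi, e2 i hi]; exact h1 i (Finset.mem_insert_of_mem hi)
      · by_cases hwv : w = v j
        · subst hwv; simp
        · rw [Function.update_of_ne hwv]
          by_cases hwr : w = r j
          · subst hwr
            rw [Function.update_self, h1 j (Finset.mem_insert_self j s), Bool.xor_self]
          · rw [Function.update_of_ne hwr]
            refine h2 w fun i hi => ?_
            rcases Finset.mem_insert.1 hi with rfl | hi
            · exact ⟨hwv, hwr⟩
            · exact hw i hi
  · intro z _ hz
    have hz1 : z () = true := by
      by_contra h
      exact hz (funext fun _ => by simpa using h)
    rw [pairState, if_neg, mul_zero]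
    rintro ⟨-, h2⟩
    have := h2 (v j) fun i hi => ⟨hvj i hi, hvr j i⟩
    rw [extend_wire, Function.update_self, hz1] at this
    simp at this
  · simp

/-- Maximally entangled pairs can be prepared from the zero state. -/
lemma exists_realizable_pairState (hP : 1 ≤ P) {k : ℕ} {v r : Fin k ↪ ω}
    (hvr : ∀ i j, v i ≠ r j) (s : Finset (Fin k)) :
    ∃ A : QOp ω, Realizable P (fun _ : ThermalInstance nv nh N L => A) (s.card * 2) 0 ∧
      A *ᵥ Pi.single (fun _ => false) 1 = pairState v r s := by
  induction s using Finset.induction_on with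
  | empty =>
    refine ⟨1, Realizable.one.mono (by simp) le_rfl, ?_⟩
    rw [Matrix.one_mulVec]
    funext x
    simp [pairState, Pi.single_apply, funext_iff]
  | insert j s hj ih =>
    obtain ⟨A, h1, h2⟩ := ih
    refine ⟨_, ((Realizable.cnot hP (hvr j j)).mul (Realizable.single hadamardGate (v j))).mul h1
      |>.mono ?_ le_rfl, ?_⟩
    · rw [Finset.card_insert_of_notMem hj]; omega
    · rw [← Matrix.mulVec_mulVec, h2, cnot_hadamard_pairState hvr hj]

end RealizableGates

/-! ### Amplitude amplification -/

section Amplification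

variable {ω : Type} [Fintype ω] [DecidableEq ω]

/-- The zero state. -/
def zeroKet (ω : Type) [DecidableEq ω] [Fintype ω] : (ω → Bool) → ℂ := Pi.single (fun _ => false) 1

/-- The part of `ψ` on the basis states that vanish on `S`. -/
def zeroPart (S : Finset ω) (ψ : (ω → Bool) → ℂ) : (ω → Bool) → ℂ :=
  fun x => if ∀ w ∈ S, x w = false then ψ x else 0

/-- The probability of finding the wires `S` in state zero. -/
def zeroProb (S : Finset ω) (ψ : (ω → Bool) → ℂ) : ℝ :=
  ∑ x, if ∀ w ∈ S, x w = false then ‖ψ x‖ ^ 2 else 0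

lemma sum_norm_sq_eq (ψ : (ω → Bool) → ℂ) : ((∑ x, ‖ψ x‖ ^ 2 : ℝ) : ℂ) = star ψ ⬝ᵥ ψ := by
  rw [dotProduct]
  push_cast
  exact Finset.sum_congr rfl fun x _ => (Complex.conj_mul' _).symm

lemma sum_norm_sq_unitary {M : QOp ω} (hM : M ∈ Matrix.unitaryGroup (ω → Bool) ℂ)
    (ψ : (ω → Bool) → ℂ) : ∑ x, ‖(M *ᵥ ψ) x‖ ^ 2 = ∑ x, ‖ψ x‖ ^ 2 := by
  have : ((∑ x, ‖(M *ᵥ ψ) x‖ ^ 2 : ℝ) : ℂ) = ((∑ x, ‖ψ x‖ ^ 2 : ℝ) : ℂ) := by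
    rw [sum_norm_sq_eq, sum_norm_sq_eq, Matrix.star_mulVec, ← Matrix.dotProduct_mulVec,
      Matrix.mulVec_mulVec, ← Matrix.star_eq_conjTranspose, Matrix.mem_unitaryGroup_iff'.1 hM,
      Matrix.one_mulVec]
  exact_mod_cast this

lemma sum_norm_sq_single (y : ω → Bool) : ∑ x, ‖(Pi.single y 1 : (ω → Bool) → ℂ) x‖ ^ 2 = 1 := by
  rw [Finset.sum_eq_single y] <;> simp +contextual

lemma zeroProb_le (S : Finset ω) (ψ : (ω → Bool) → ℂ) : zeroProb S ψ ≤ ∑ x, ‖ψ x‖ ^ 2 :=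
  Finset.sum_le_sum fun x _ => by split_ifs <;> [exact le_rfl; positivity]

/-- `r` rounds of amplitude amplification of the zero part on `S` of the state prepared by `B`. -/
def ampOp (B : QOp ω) (S : Finset ω) (r : ℕ) : QOp ω :=
  (B * reflOp Finset.univ * Bᴴ * reflOp S) ^ r * B

lemma reflOp_mulVec (S : Finset ω) (ψ : (ω → Bool) → ℂ) :
    reflOp S *ᵥ ψ = ψ - (2 : ℂ) • zeroPart S ψ := by
  funext x
  rw [reflOp, Matrix.mulVec_diagonal]
  simp only [Pi.sub_apply, Pi.smul_apply, zeroPart, smul_eq_mul]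
  split_ifs <;> ring

lemma zeroPart_univ (ψ : (ω → Bool) → ℂ) :
    zeroPart Finset.univ ψ = (star (zeroKet ω) ⬝ᵥ ψ) • zeroKet ω := by
  funext x
  have : star (zeroKet ω) ⬝ᵥ ψ = ψ fun _ => false := by
    rw [dotProduct, Finset.sum_eq_single (fun _ => false)] <;> simp +contextual [zeroKet]
  rw [this]
  simp only [zeroPart, Finset.mem_univ, true_imp_iff, Pi.smul_apply, zeroKet, Pi.single_apply,
    smul_eq_mul, mul_ite, mul_one, mul_zero, funext_iff]
  split_ifs with h
  · congr 1; exact funext h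
  · rfl

/-- Conjugation by $B$ turns the reflection at the zero state into the reflection at the prepared
state. -/
lemma conj_reflOp_univ_mulVec {B : QOp ω} (hB : B ∈ Matrix.unitaryGroup (ω → Bool) ℂ)
    (ψ : (ω → Bool) → ℂ) :
    (B * reflOp Finset.univ * Bᴴ) *ᵥ ψ
      = ψ - (2 * (star (B *ᵥ zeroKet ω) ⬝ᵥ ψ)) • (B *ᵥ zeroKet ω) := by
  rw [← Matrix.mulVec_mulVec, ← Matrix.mulVec_mulVec, reflOp_mulVec, zeroPart_univ,
    Matrix.mulVec_sub, Matrix.mulVec_mulVec, ← Matrix.star_eq_conjTranspose,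
    Matrix.mem_unitaryGroup_iff.1 hB, Matrix.one_mulVec, Matrix.mulVec_smul, Matrix.mulVec_smul,
    smul_smul, Matrix.star_mulVec, ← Matrix.dotProduct_mulVec, ← Matrix.star_eq_conjTranspose]

lemma star_dotProduct_zeroPart (S : Finset ω) (ψ : (ω → Bool) → ℂ) :
    star ψ ⬝ᵥ zeroPart S ψ = (zeroProb S ψ : ℂ) := by
  rw [dotProduct, zeroProb]
  push_cast
  refine Finset.sum_congr rfl fun x _ => ?_
  simp only [zeroPart, Pi.star_apply]
  split_ifs
  · push_cast; exact Complex.conj_mul' _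
  · simp

/-- Amplitude amplification rotates the state in the plane of its good and bad parts. -/
lemma ampOp_mulVec_zeroKet {B : QOp ω} (hB : B ∈ Matrix.unitaryGroup (ω → Bool) ℂ) (S : Finset ω)
    {χ : ℝ} (hχ : Real.sin χ ^ 2 = zeroProb S (B *ᵥ zeroKet ω)) (r : ℕ) :
    ∃ a b : ℝ, ampOp B S r *ᵥ zeroKet ω
        = (a : ℂ) • zeroPart S (B *ᵥ zeroKet ω)
          + (b : ℂ) • (B *ᵥ zeroKet ω - zeroPart S (B *ᵥ zeroKet ω)) ∧
      a * Real.sin χ = (-1) ^ r * Real.sin ((2 * r + 1) * χ) ∧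
      b * Real.cos χ = (-1) ^ r * Real.cos ((2 * r + 1) * χ) := by
  induction r with
  | zero => exact ⟨1, 1, by simp [ampOp], by simp, by simp⟩
  | succ r ih =>
    obtain ⟨a, b, h1, h2, h3⟩ := ih
    obtain ⟨ψ, hψ⟩ : ∃ ψ, ψ = B *ᵥ zeroKet ω := ⟨_, rfl⟩
    have hunit : star ψ ⬝ᵥ ψ = 1 := by
      rw [hψ, ← sum_norm_sq_eq, sum_norm_sq_unitary hB, zeroKet, sum_norm_sq_single]; simp
    have hgood : star ψ ⬝ᵥ zeroPart S ψ = ((Real.sin χ ^ 2 : ℝ) : ℂ) := by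
      rw [star_dotProduct_zeroPart, hχ, hψ]
    rw [← hψ] at h1 ⊢
    obtain ⟨η, hφ⟩ : ∃ η, η = zeroPart S ψ := ⟨_, rfl⟩
    have hidem : zeroPart S η = η := by
      rw [hφ]; funext x; simp only [zeroPart]; split_ifs <;> rfl
    have hzadd : ∀ u w : (ω → Bool) → ℂ, zeroPart S (u + w) = zeroPart S u + zeroPart S w := by
      intro u w; funext x; simp only [zeroPart, Pi.add_apply]; split_ifs <;> simp
    have hzsmul : ∀ (c : ℂ) (u : (ω → Bool) → ℂ), zeroPart S (c • u) = c • zeroPart S u := by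
      intro c u; funext x; simp only [zeroPart, Pi.smul_apply]; split_ifs <;> simp
    have hzsub : zeroPart S (ψ - η) = 0 := by
      have := hzadd (ψ - η) η
      rw [sub_add_cancel, hidem, ← hφ] at this
      exact left_eq_add.1 (by rw [add_comm]; exact this)
    rw [← hφ] at h1 hgood ⊢
    -- One round maps $v$, the state with its good part negated, to $v-2\langle\psi,v\rangle\psi$,
    -- where $\langle\psi,v\rangle=-a\sin^2\chi+b\cos^2\chi$. Stating the invariant for $a\sin\chi$
    -- and $b\cos\chi$ avoids division when one part of the state vanishes; the sign $(-1)^r$ is a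
    -- global phase of the chosen reflections.
    refine ⟨-a + 2 * a * Real.sin χ ^ 2 - 2 * b * Real.cos χ ^ 2,
      b + 2 * a * Real.sin χ ^ 2 - 2 * b * Real.cos χ ^ 2, ?_, ?_, ?_⟩
    · have hstep : ampOp B S (r + 1) = (B * reflOp Finset.univ * Bᴴ) * (reflOp S * ampOp B S r) := by
        rw [ampOp, ampOp, pow_succ']; simp only [Matrix.mul_assoc]
      rw [hstep, ← Matrix.mulVec_mulVec _ (B * _ * Bᴴ), conj_reflOp_univ_mulVec hB, ← hψ,
        ← Matrix.mulVec_mulVec, h1, reflOp_mulVec, hzadd, hzsmul, hzsmul, hzsub, hidem, smul_zero,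
        add_zero]
      simp only [dotProduct_sub, dotProduct_add, dotProduct_smul, hunit, hgood, smul_eq_mul]
      have hc : (Complex.cos χ : ℂ) ^ 2 = 1 - Complex.sin χ ^ 2 := by
        linear_combination Complex.sin_sq_add_cos_sq (χ : ℂ)
      push_cast
      rw [hc]
      module
    · push_cast
      rw [show (2 * ((r : ℝ) + 1) + 1) * χ = (2 * r + 1) * χ + 2 * χ by ring, Real.sin_add,
        Real.sin_two_mul, Real.cos_two_mul, pow_succ]
      have hc := Real.sin_sq_add_cos_sq χ
      linear_combination (-1 + 2 * Real.sin χ ^ 2) * h2 - 2 * Real.cos χ * Real.sin χ * h3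
        + 2 * ((-1) ^ r * Real.sin ((2 * r + 1) * χ)) * hc
    · push_cast
      rw [show (2 * ((r : ℝ) + 1) + 1) * χ = (2 * r + 1) * χ + 2 * χ by ring, Real.cos_add,
        Real.sin_two_mul, Real.cos_two_mul, pow_succ]
      linear_combination (1 - 2 * Real.cos χ ^ 2) * h3 + 2 * Real.cos χ * Real.sin χ * h2

/-- The good part after amplification is a multiple of the good part before it. -/
lemma ampOp_apply {B : QOp ω} (hB : B ∈ Matrix.unitaryGroup (ω → Bool) ℂ) (S : Finset ω)
    {χ : ℝ} (hχ : Real.sin χ ^ 2 = zeroProb S (B *ᵥ zeroKet ω)) (r : ℕ) :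
    ∃ a : ℝ, (∀ x, (∀ w ∈ S, x w = false) →
        (ampOp B S r *ᵥ zeroKet ω) x = a * (B *ᵥ zeroKet ω) x) ∧
      a ^ 2 * zeroProb S (B *ᵥ zeroKet ω) = Real.sin ((2 * r + 1 : ℕ) * χ) ^ 2 := by
  obtain ⟨a, b, h1, h2, -⟩ := ampOp_mulVec_zeroKet hB S hχ r
  refine ⟨a, fun x hx => ?_, ?_⟩
  · rw [h1]
    simp only [Pi.add_apply, Pi.smul_apply, Pi.sub_apply, zeroPart, if_pos hx, smul_eq_mul]
    ring
  · rw [← hχ, ← mul_pow, h2, mul_pow, ← pow_mul, mul_comm r 2, pow_mul]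
    push_cast
    simp

lemma zeroProb_ampOp {B : QOp ω} (hB : B ∈ Matrix.unitaryGroup (ω → Bool) ℂ) (S : Finset ω)
    {χ : ℝ} (hχ : Real.sin χ ^ 2 = zeroProb S (B *ᵥ zeroKet ω)) (r : ℕ) :
    zeroProb S (ampOp B S r *ᵥ zeroKet ω) = Real.sin ((2 * r + 1 : ℕ) * χ) ^ 2 := by
  obtain ⟨a, h1, h2⟩ := ampOp_apply hB S hχ r
  rw [← h2, zeroProb, zeroProb, Finset.mul_sum]
  refine Finset.sum_congr rfl fun x _ => ?_
  split_ifs with hx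
  · rw [h1 x hx, norm_mul, mul_pow, Complex.norm_real, Real.norm_eq_abs, sq_abs]
  · simp

variable {nv nh N L P : ℕ} {B : ThermalInstance nv nh N L → QOp ω} {g q : ℕ}

lemma Realizable.amplification (hP : Fintype.card ω + 1 ≤ P) (h : Realizable P B g q)
    (S : Finset ω) (r : ℕ) :
    Realizable P (fun I => ampOp (B I) S r)
      ((2 * r + 1) * g + r * (2 * (6 * Fintype.card ω + 1))) ((2 * r + 1) * q) := by
  have h1 := (((h.mul (Realizable.reflection hP Finset.univ)).mul (h.adjoint h.unitary)).mul
    (Realizable.reflection hP S)).pow r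
  refine (h1.mul h).mono (le_of_eq ?_) (le_of_eq ?_) <;> ring

end Amplification

/-! ### The linear combination of unitaries -/

section LCU

variable {nv nh N L : ℕ}

/-- The unary counter reveals the number of indices: if $k<k'$, bit $k$ is set only for $k'$. -/
lemma prepKet_injective {L K k k' : ℕ} (hk : k ≤ K) (hk' : k' ≤ K) {l : Fin k → Fin L}
    {l' : Fin k' → Fin L} (h : prepKet K k l = prepKet K k' l') : k = k' := by
  by_contra hne
  wlog hlt : k < k' generalizing k k'
  · exact this hk' hk h.symm (Ne.symm hne) (by omega)
  have := congrFun h (Sum.inl ⟨k, by omega⟩)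
  simp [prepKet, hlt] at this

lemma prepKet_injective_right {L K k : ℕ} (hk : k ≤ K) {l l' : Fin k → Fin L}
    (h : prepKet K k l = prepKet K k l') : l = l' := by
  funext i
  have hi : (i : ℕ) < K := i.2.trans_le hk
  have hb : ∀ b : Fin (Nat.clog 2 L), Nat.testBit (l i) b = Nat.testBit (l' i) b := by
    intro b
    have := congrFun h (Sum.inr (⟨i, hi⟩, b))
    simpa [prepKet] using this
  have hL := Nat.le_pow_clog (b := 2) (by norm_num) L
  apply Fin.ext
  rw [← bitsVal_testBit ((l i).2.trans_le hL), ← bitsVal_testBit ((l' i).2.trans_le hL)]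
  congr 1
  exact funext hb

lemma prepNorm_pos (α : Fin L → ℝ) (K : ℕ) : 0 < prepNorm α K := by
  unfold prepNorm
  rw [Finset.sum_range_succ']
  have : 0 ≤ ∑ k ∈ Finset.range K, (∑ l, |α l|) ^ (k + 1) / (2 ^ (k + 1) * ((k + 1)! : ℝ)) :=
    Finset.sum_nonneg fun k _ => by positivity
  simp only [pow_zero, Nat.factorial_zero, Nat.cast_one, mul_one, div_one]
  linarith

lemma prepNorm_le_exp (α : Fin L → ℝ) (K : ℕ) : prepNorm α K ≤ Real.exp ((∑ l, |α l|) / 2) := by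
  refine le_trans (le_of_eq ?_) (Real.sum_le_exp_of_nonneg (by positivity) (K + 1))
  unfold prepNorm
  refine Finset.sum_congr rfl fun k _ => ?_
  rw [div_pow, div_div]

/-- The amplitude of `|k, l₁, …, l_k⟩` before normalization. -/
def prepCoeff (α : Fin L → ℝ) (k : ℕ) (l : Fin k → Fin L) : ℝ :=
  √((∏ i, α (l i)) / (2 ^ k * (k ! : ℝ)))

lemma prepState_apply (α : Fin L → ℝ) (K : ℕ) (z : PrepReg L K → Bool) :
    prepState α K z = ((1 / √(prepNorm α K) : ℝ) : ℂ) * ∑ k ∈ Finset.range (K + 1),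
      ∑ l : Fin k → Fin L, if z = prepKet K k l then (prepCoeff α k l : ℂ) else 0 := by
  simp only [prepState, Pi.smul_apply, Finset.sum_apply, smul_eq_mul, Pi.single_apply, mul_ite,
    mul_one, mul_zero, prepCoeff]

lemma prepState_prepKet (α : Fin L → ℝ) {K k : ℕ} (hk : k ≤ K) (l : Fin k → Fin L) :
    prepState α K (prepKet K k l) = ((1 / √(prepNorm α K) : ℝ) : ℂ) * prepCoeff α k l := by
  rw [prepState_apply, Finset.sum_eq_single k, Finset.sum_eq_single l, if_pos rfl]
  · intro l' _ hl'
    rw [if_neg fun h => hl' (prepKet_injective_right hk h).symm]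
  · simp
  · intro k' hk' hne
    refine Finset.sum_eq_zero fun l' _ => if_neg fun h => hne ?_
    exact (prepKet_injective hk (by simpa [Nat.lt_succ_iff] using hk') h).symm
  · intro h; simp at h; omega

/-- The kets $|k,l_1,\dots,l_k\rangle$ are distinct, so there are no cross terms and the squared
amplitudes of Prepare act as the weights $\alpha_{l_1}\cdots\alpha_{l_k}/(2^kk!\,s)$. Nonnegativity
of $\alpha$ lets the square roots square back. -/
lemma sum_prepState_smul {V : Type} [AddCommGroup V] [Module ℂ V] (α : Fin L → ℝ)
    (hα : ∀ l, 0 ≤ α l) (K : ℕ) (F : (PrepReg L K → Bool) → V) :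
    ∑ z, (star (prepState α K z) * prepState α K z) • F z
      = ((1 / prepNorm α K : ℝ) : ℂ) • ∑ k ∈ Finset.range (K + 1), ∑ l : Fin k → Fin L,
        (((∏ i, α (l i)) / (2 ^ k * (k ! : ℝ)) : ℝ) : ℂ) • F (prepKet K k l) := by
  have h1 : ∀ z, (star (prepState α K z) * prepState α K z) • F z
      = ∑ k ∈ Finset.range (K + 1), ∑ l : Fin k → Fin L, if z = prepKet K k l then
        (star (prepState α K z) * (((1 / √(prepNorm α K) : ℝ) : ℂ) * prepCoeff α k l)) • F z
        else 0 := by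
    intro z
    rw [show star (prepState α K z) * prepState α K z = _ from
      congrArg (star (prepState α K z) * ·) (prepState_apply α K z), Finset.mul_sum,
      Finset.mul_sum, Finset.sum_smul]
    refine Finset.sum_congr rfl fun k _ => ?_
    rw [Finset.mul_sum, Finset.mul_sum, Finset.sum_smul]
    refine Finset.sum_congr rfl fun l _ => ?_
    split_ifs <;> simp
  rw [Finset.sum_congr rfl fun z _ => h1 z, Finset.sum_comm, Finset.smul_sum]
  refine Finset.sum_congr rfl fun k hk => ?_
  rw [Finset.sum_comm, Finset.smul_sum]
  refine Finset.sum_congr rfl fun l _ => ?_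
  rw [Finset.sum_eq_single (prepKet K k l), if_pos rfl,
    prepState_prepKet α (by simpa [Nat.lt_succ_iff] using hk), smul_smul]
  · congr 1
    have e1 : (1 / √(prepNorm α K)) * (1 / √(prepNorm α K)) = 1 / prepNorm α K := by
      rw [div_mul_div_comm, Real.mul_self_sqrt (prepNorm_pos α K).le, one_mul]
    have e2 : prepCoeff α k l * prepCoeff α k l = (∏ i, α (l i)) / (2 ^ k * (k ! : ℝ)) := by
      have := Finset.prod_nonneg fun i (_ : i ∈ Finset.univ) => hα (l i)
      exact Real.mul_self_sqrt (by positivity)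
    rw [← e1, ← e2, ← Complex.ofReal_mul, Complex.star_def, Complex.conj_ofReal,
      ← Complex.ofReal_mul, ← Complex.ofReal_mul]
    congr 1
    ring
  · intro z _ hz; rw [if_neg hz]
  · simp

/-- Expansion of a power into words in noncommuting factors, splitting off the first letter. -/
lemma sum_prod_smul_list {A : Type} [Ring A] [Algebra ℂ A] (α : Fin L → ℝ) (U : Fin L → A)
    (k : ℕ) :
    ∑ l : Fin k → Fin L, ((∏ i, α (l i) : ℝ) : ℂ) • (List.ofFn fun i => U (l i)).prod
      = (∑ l, (α l : ℂ) • U l) ^ k := by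
  induction k with
  | zero => simp
  | succ k ih =>
    rw [pow_succ', ← ih, ← (Fin.consEquiv fun _ => Fin L).sum_comp, Fintype.sum_prod_type,
      Finset.sum_mul]
    refine Finset.sum_congr rfl fun a _ => ?_
    rw [Finset.mul_sum]
    refine Finset.sum_congr rfl fun l _ => ?_
    simp only [Fin.consEquiv, Equiv.coe_fn_mk, Fin.prod_univ_succ, Fin.cons_zero, Fin.cons_succ,
      List.ofFn_succ, List.prod_cons]
    rw [smul_mul_smul_comm]
    push_cast
    rfl

/-- The unitary that a sequence of controlled Select queries applies if the Prepare register is in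
the basis state `z`. -/
def selectBlock (I : ThermalInstance nv nh N L) (K : ℕ) (z : PrepReg L K → Bool) : QOp (Fin nv) :=
  (List.ofFn fun i : Fin K =>
    if z (Sum.inl i) = true then muxBlock I.U (fun b => z (Sum.inr (i, b))) else 1).prod

lemma prod_ofFn_dite {A : Type} [Monoid A] {k : ℕ} (f : Fin k → A) (m : ℕ) :
    (List.ofFn fun i : Fin (k + m) => if h : (i : ℕ) < k then f ⟨i, h⟩ else 1).prod
      = (List.ofFn f).prod := by
  induction m with
  | zero => congr 2; funext i; simp
  | succ m ih =>
    rw [← add_assoc, List.ofFn_succ', List.concat_eq_append, List.prod_append]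
    simpa using ih

/-- Index registers past position $k$ hold zero, which is a valid index, but their counter bits are
off, so they contribute the identity. -/
lemma selectBlock_prepKet (I : ThermalInstance nv nh N L) {K k : ℕ} (hk : k ≤ K)
    (l : Fin k → Fin L) :
    selectBlock I K (prepKet K k l) = (List.ofFn fun i => I.U (l i)).prod := by
  obtain ⟨m, rfl⟩ := Nat.exists_eq_add_of_le hk
  rw [← prod_ofFn_dite _ m, selectBlock]
  congr 2
  funext i
  by_cases h : (i : ℕ) < k
  · have hv := bitsVal_testBit ((l ⟨i, h⟩).2.trans_le (Nat.le_pow_clog (b := 2) (by norm_num) L))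
    have e : (fun b => prepKet (k + m) k l (Sum.inr (i, b)))
        = fun b : Fin (Nat.clog 2 L) => Nat.testBit (l ⟨i, h⟩) b := by
      funext b; simp [prepKet, h]
    rw [if_pos (by simp [prepKet, h]), dif_pos h, e, muxBlock, dif_pos (by rw [hv]; exact Fin.isLt _)]
    congr 1
    exact Fin.ext hv
  · rw [if_neg (by simp [prepKet, h]), dif_neg h]

/-- The linear combination of unitaries: the words of length $k$ add up to $H^k$, and the weight
$1/(2^kk!)$ turns this into the $k$-th term of $e^{H/2}$. -/
lemma sum_selectBlock (I : ThermalInstance nv nh N L) (K : ℕ) :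
    ∑ z, (star (prepState I.α K z) * prepState I.α K z) • selectBlock I K z
      = ((1 / prepNorm I.α K : ℝ) : ℂ) • I.halfTrunc K := by
  rw [sum_prepState_smul I.α I.α_nonneg, ThermalInstance.halfTrunc, expTrunc]
  congr 1
  refine Finset.sum_congr rfl fun k hk => ?_
  rw [smul_pow, ThermalInstance.ham, ← sum_prod_smul_list, Finset.smul_sum, Finset.smul_sum]
  refine Finset.sum_congr rfl fun l _ => ?_
  rw [selectBlock_prepKet I (by simpa [Nat.lt_succ_iff] using hk), smul_smul, smul_smul]
  congr 1
  push_cast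
  rw [div_pow, one_pow]
  field_simp

end LCU

/-! ### The work register -/

section Work

/-- The work wires: visible qubits, reference qubits, a second copy of the visible qubits, the
hidden qubits, and the register of Prepare. -/
abbrev Work (nv nh L K : ℕ) : Type :=
  Fin nv ⊕ (Fin nv ⊕ ((Fin nv ⊕ Fin nh) ⊕ PrepReg L K))

namespace Work

variable (nv nh L K : ℕ)

/-- The visible qubits. -/
def vis : Fin nv ↪ Work nv nh L K := ⟨fun i => Sum.inl i, fun _ _ h => by simpa using h⟩

/-- The reference qubits. -/
def ref : Fin nv ↪ Work nv nh L K := ⟨fun i => Sum.inr (Sum.inl i), fun _ _ h => by simpa using h⟩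

/-- The register of Prepare. -/
def prep : PrepReg L K ↪ Work nv nh L K :=
  ⟨fun i => Sum.inr (Sum.inr (Sum.inr i)), fun _ _ h => by simpa using h⟩

/-- The second copy of the visible qubits, with the hidden qubits. -/
def copyHid : Fin nv ⊕ Fin nh ↪ Work nv nh L K :=
  ⟨fun i => Sum.inr (Sum.inr (Sum.inl i)), fun _ _ h => by simpa using h⟩

/-- The visible qubits, with the hidden qubits. -/
def visHid : Fin nv ⊕ Fin nh ↪ Work nv nh L K :=
  ⟨Sum.elim (fun i => Sum.inl i) (fun i => Sum.inr (Sum.inr (Sum.inl (Sum.inr i)))), by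
    rintro (i | i) (j | j) h <;> simp_all⟩

variable {nv nh L K}

/-- Assembles a basis state of the work register. -/
def mk (v r : Fin nv → Bool) (a : Fin nv ⊕ Fin nh → Bool) (q : PrepReg L K → Bool) :
    Work nv nh L K → Bool := Sum.elim v (Sum.elim r (Sum.elim a q))

lemma eq_mk (x : Work nv nh L K → Bool) :
    x = mk (x ∘ vis nv nh L K) (x ∘ ref nv nh L K) (x ∘ copyHid nv nh L K)
      (x ∘ prep nv nh L K) := by
  funext w
  rcases w with i | i | i | i <;> rfl

lemma extend_vis (z v r a q) :
    Function.extend (vis nv nh L K) z (mk v r a q) = mk z r a q := by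
  symm
  rw [eq_extend_iff]
  refine ⟨?_, rfl⟩
  rintro (i | i | i | i) h
  · exact absurd ⟨i, rfl⟩ h
  all_goals rfl

lemma extend_prep (z v r a q) :
    Function.extend (prep nv nh L K) z (mk v r a q) = mk v r a z := by
  symm
  rw [eq_extend_iff]
  refine ⟨?_, rfl⟩
  rintro (i | i | i | i) h
  · rfl
  · rfl
  · rfl
  · exact absurd ⟨i, rfl⟩ h

lemma extend_copyHid (z v r a q) :
    Function.extend (copyHid nv nh L K) z (mk v r a q) = mk v r z q := by
  symm
  rw [eq_extend_iff]
  refine ⟨?_, rfl⟩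
  rintro (i | i | i | i) h
  · rfl
  · rfl
  · exact absurd ⟨i, rfl⟩ h
  · rfl

lemma extend_visHid (z v r a q) :
    Function.extend (visHid nv nh L K) z (mk v r a q)
      = mk (z ∘ Sum.inl) r (Sum.elim (a ∘ Sum.inl) (z ∘ Sum.inr)) q := by
  symm
  rw [eq_extend_iff]
  refine ⟨?_, ?_⟩
  · rintro (i | i | (i | i) | i) h
    · exact absurd ⟨Sum.inl i, rfl⟩ h
    · rfl
    · rfl
    · exact absurd ⟨Sum.inr i, rfl⟩ h
    · rfl
  · funext i
    rcases i with i | i <;> rfl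

end Work

end Work

/-! ### The block encoding of `e^{H/2}` -/

section BlockEncoding

variable {nv nh N L : ℕ}

/-- One controlled Select per counter bit. They act on the visible qubits only and read only the
Prepare register, so their product is again a single multiplexer. -/
lemma Realizable.selects {P K : ℕ} :
    Realizable P (fun I : ThermalInstance nv nh N L =>
      muxOn (Work.vis nv nh L K) fun x => selectBlock I K (x ∘ Work.prep nv nh L K)) 0 K := by
  let V : Fin K → ThermalInstance nv nh N L → (Work nv nh L K → Bool) → QOp (Fin nv) :=
    fun i I x => if x (Work.prep nv nh L K (Sum.inl i)) = true then
      muxBlock I.U (fun b => x (Work.prep nv nh L K (Sum.inr (i, b)))) else 1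
  have hV : ∀ i I, OffIndep (Work.vis nv nh L K) (V i I) := by
    intro i I x y h
    have e : ∀ p, x (Work.prep nv nh L K p) = y (Work.prep nv nh L K p) :=
      fun p => h _ (by rintro ⟨j, hj⟩; simp [Work.vis, Work.prep] at hj)
    simp only [V, e]
  have h1 : ∀ i, Realizable P (fun I => muxOn (Work.vis nv nh L K) (V i I)) 0 1 := by
    intro i
    exact Realizable.ctrlSelect (Work.prep nv nh L K (Sum.inl i))
      ⟨fun b => Work.prep nv nh L K (Sum.inr (i, b)), fun b b' h => by
        simpa using (Work.prep nv nh L K).injective h⟩ (Work.vis nv nh L K)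
      (fun b h => by simpa using (Work.prep nv nh L K).injective h)
      (fun b h => by simp [Work.vis, Work.prep] at h)
      (fun b j h => by simp [Work.vis, Work.prep] at h)
  have h2 : ∀ l : List (Fin K), Realizable P (fun I => muxOn (Work.vis nv nh L K)
      fun x => (l.map fun i => V i I x).prod) 0 l.length := by
    intro l
    induction l with
    | nil => simpa [muxOn_one] using Realizable.one
    | cons i l ih =>
      have := (h1 i).mul ih
      have hl : ∀ I, OffIndep (Work.vis nv nh L K) fun x => (l.map fun i => V i I x).prod := by
        intro I x y h
        have : (fun i => V i I x) = fun i => V i I y := funext fun i => hV i I x y h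
        simp only [this]
      simp only [muxOn_mul _ _ (hl _)] at this
      simpa [Nat.add_comm] using this
  have h3 := h2 (List.finRange K)
  rw [List.length_finRange] at h3
  convert h3 using 5
  rw [selectBlock, List.ofFn_eq_map]
  rfl

/-- The probability amplitude of each basis state in the maximally entangled state. -/
def pairAmp (nv : ℕ) : ℝ := (1 / √2) ^ nv

lemma pairAmp_sq (nv : ℕ) : pairAmp nv ^ 2 = 1 / 2 ^ nv := by
  rw [pairAmp, ← pow_mul, mul_comm, pow_mul, div_pow, Real.sq_sqrt (by norm_num), one_pow, div_pow,
    one_pow]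

lemma pairState_mk {K : ℕ} (v r : Fin nv → Bool) (a : Fin nv ⊕ Fin nh → Bool)
    (q : PrepReg L K → Bool) :
    pairState (Work.vis nv nh L K) (Work.ref nv nh L K) Finset.univ (Work.mk v r a q)
      = if v = r ∧ a = (fun _ => false) ∧ q = (fun _ => false) then (pairAmp nv : ℂ) else 0 := by
  rw [pairState, Finset.card_univ, Fintype.card_fin, pairAmp]
  congr 1
  rw [eq_iff_iff]
  constructor
  · rintro ⟨h1, h2⟩
    refine ⟨funext fun i => h1 i (Finset.mem_univ i), funext fun i => ?_, funext fun i => ?_⟩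
    · exact h2 (Work.copyHid nv nh L K i) fun j _ =>
        ⟨Sum.inr_ne_inl, fun h => Sum.inr_ne_inl (Sum.inr_injective h)⟩
    · exact h2 (Work.prep nv nh L K i) fun j _ =>
        ⟨Sum.inr_ne_inl, fun h => Sum.inr_ne_inl (Sum.inr_injective h)⟩
  · rintro ⟨rfl, rfl, rfl⟩
    refine ⟨fun _ _ => rfl, ?_⟩
    rintro (i | i | i | i) h
    · exact absurd rfl (h i (Finset.mem_univ i)).1
    · exact absurd rfl (h i (Finset.mem_univ i)).2
    · rfl
    · rfl

/-- The wires of the Prepare register. -/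
def prepWires (nv nh L K : ℕ) : Finset (Work nv nh L K) := Finset.univ.map (Work.prep nv nh L K)

/-- A block encoding of the truncated `e^{H/2}`, applied to half of a maximally entangled state. -/
lemma exists_blockEncoding {P : ℕ} (hP : 1 ≤ P) (K : ℕ) :
    ∃ B : ThermalInstance nv nh N L → QOp (Work nv nh L K),
      Realizable P B (nv * 2) (K + 2) ∧
      ∀ I v r a, (B I *ᵥ zeroKet (Work nv nh L K)) (Work.mk v r a fun _ => false)
        = if a = (fun _ => false) then
            ((pairAmp nv * (1 / prepNorm I.α K) : ℝ) : ℂ) * I.halfTrunc K v r else 0 := by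
  obtain ⟨E, hE, hE0⟩ := exists_realizable_pairState (nv := nv) (nh := nh) (N := N) (L := L) hP
    (v := Work.vis nv nh L K) (r := Work.ref nv nh L K) (by simp [Work.vis, Work.ref]) Finset.univ
  have hprep : Realizable P (fun I : ThermalInstance nv nh N L =>
      applyOn (Work.prep nv nh L K) (I.prep K)) 0 1 := Realizable.prepare K _
  have hall := (((hprep.adjoint hprep.unitary).mul (Realizable.selects (P := P))).mul hprep).mul hE
  refine ⟨_, hall.mono (by simp) (by omega), fun I v r a => ?_⟩
  have hp0 : ∀ z, I.prep K z (fun _ => false) = prepState I.α K z := by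
    intro z
    have := congrFun (I.prep_zero K) z
    simpa using this
  simp only [← Matrix.mulVec_mulVec]
  rw [zeroKet, hE0, ← applyOn_conjTranspose, applyOn_mulVec]
  have hq : (Work.mk v r a fun _ => false : Work nv nh L K → Bool) ∘ Work.prep nv nh L K
      = fun _ => false := rfl
  simp only [Work.extend_prep, hq, Matrix.conjTranspose_apply, hp0]
  -- The amplitudes just before the inverse Prepare. The reference state $r$ records on which basis
  -- state the visible qubits started, and thereby selects a column of the block.
  have step : ∀ z, (muxOn (Work.vis nv nh L K)
      (fun x => selectBlock I K (x ∘ Work.prep nv nh L K)) *ᵥ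
        applyOn (Work.prep nv nh L K) (I.prep K) *ᵥ
          pairState (Work.vis nv nh L K) (Work.ref nv nh L K) Finset.univ) (Work.mk v r a z)
      = if a = (fun _ => false) then
          (pairAmp nv : ℂ) * (prepState I.α K z * selectBlock I K z v r) else 0 := by
    intro z
    rw [muxOn_mulVec]
    have e1 : ∀ v', (Work.mk v' r a z : Work nv nh L K → Bool) ∘ Work.prep nv nh L K = z :=
      fun _ => rfl
    have e2 : (Work.mk v r a z : Work nv nh L K → Bool) ∘ Work.vis nv nh L K = v := rfl
    simp only [Work.extend_vis, e1, e2, applyOn_mulVec, Work.extend_prep, pairState_mk]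
    rw [Finset.sum_eq_single r, Finset.sum_eq_single (fun _ => false), hp0]
    · simp only [true_and, and_true]
      split_ifs <;> ring
    · intro z' _ hz'; simp [hz']
    · simp
    · intro v' _ hv'
      simp [hv']
    · simp
  simp only [step]
  split_ifs with ha
  -- Inverse Prepare, projected onto zero, supplies the second amplitude of each index, which turns
  -- amplitudes into weights.
  · have hs := congrFun (congrFun (sum_selectBlock I K) v) r
    rw [Matrix.smul_apply, smul_eq_mul, Matrix.sum_apply] at hs
    rw [Complex.ofReal_mul, mul_assoc, ← hs, Finset.mul_sum]
    refine Finset.sum_congr rfl fun z _ => ?_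
    rw [Matrix.smul_apply, smul_eq_mul]
    ring
  · simp

end BlockEncoding

/-! ### One amplitude to be estimated -/

section Amplitude

open scoped Matrix.Norms.Frobenius

variable {nv nh N L : ℕ}

lemma applyOn_listProd {ι κ : Type} [Fintype ι] [DecidableEq ι] [Fintype κ] [DecidableEq κ]
    (e : ι ↪ κ) (l : List (QOp ι)) : applyOn e l.prod = (l.map (applyOn e)).prod := by
  induction l with
  | nil => simp [applyOn_one]
  | cons M l ih => rw [List.prod_cons, applyOn_mul, ih, List.map_cons, List.prod_cons]

lemma Realizable.network {ω : Type} [Fintype ω] [DecidableEq ω] {P : ℕ} (hP : Nat.clog 2 N ≤ P)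
    (e : Fin nv ⊕ Fin nh ↪ ω) (θ : Fin N → ℝ) :
    Realizable P (fun I : ThermalInstance nv nh N L => applyOn e (qnnUnitary I.G θ)) 0 N := by
  have h := Realizable.listProd (P := P) (g := 0) (q := 1)
    (l := List.ofFn fun j : Fin N => fun I : ThermalInstance nv nh N L =>
      applyOn e (evolve (I.G j) (θ j))) (by
      intro M hM
      obtain ⟨j, rfl⟩ := (List.mem_ofFn' _ _).1 hM
      exact Realizable.evolution hP e j (θ j))
  rw [List.length_ofFn, mul_zero, mul_one] at h
  convert h using 2 with I
  rw [qnnUnitary, applyOn_listProd, List.map_ofFn, List.map_ofFn]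
  rfl

lemma traceOut_conj_zeroProj {ι κ : Type} [Fintype ι] [DecidableEq ι] [Fintype κ] [DecidableEq κ]
    (W : QOp (ι ⊕ κ)) (a v : ι → Bool) :
    traceOut (W * zeroProj (ι ⊕ κ) * Wᴴ) a v
      = ∑ h, W (Sum.elim a h) (fun _ => false) * star (W (Sum.elim v h) fun _ => false) := by
  rw [traceOut]
  refine Finset.sum_congr rfl fun h _ => ?_
  rw [Matrix.mul_apply, Finset.sum_eq_single (fun _ => false), zeroProj,
    Matrix.mul_single_apply_same, mul_one, Matrix.conjTranspose_apply]
  · intro y _ hy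
    rw [zeroProj, Matrix.mul_single_apply_of_ne _ _ _ _ _ hy, zero_mul]
  · simp

/-- The wires that are projected onto zero. -/
def flagWires (nv nh L K : ℕ) : Finset (Work nv nh L K) :=
  Finset.univ.map (Work.prep nv nh L K) ∪ Finset.univ.map (Work.visHid nv nh L K)

lemma forall_prepWires {K : ℕ} {x : Work nv nh L K → Bool} :
    (∀ w ∈ prepWires nv nh L K, x w = false) ↔ x ∘ Work.prep nv nh L K = fun _ => false := by
  constructor
  · intro h
    exact funext fun i => h _ (by simp [prepWires])
  · intro h w hw
    obtain ⟨i, -, rfl⟩ := Finset.mem_map.1 hw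
    exact congrFun h i

lemma forall_flagWires {K : ℕ} {x : Work nv nh L K → Bool} :
    (∀ w ∈ flagWires nv nh L K, x w = false) ↔
      x ∘ Work.prep nv nh L K = (fun _ => false) ∧ x ∘ Work.visHid nv nh L K = fun _ => false := by
  constructor
  · intro h
    exact ⟨funext fun i => h _ (by simp [flagWires]), funext fun i => h _ (by simp [flagWires])⟩
  · rintro ⟨h1, h2⟩ w hw
    rcases Finset.mem_union.1 hw with hw | hw
    · obtain ⟨i, -, rfl⟩ := Finset.mem_map.1 hw
      exact congrFun h1 i
    · obtain ⟨i, -, rfl⟩ := Finset.mem_map.1 hw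
      exact congrFun h2 i

lemma sum_ite_eq_sum_of_param {X Y : Type} [Fintype X] [Fintype Y] {p : X → Prop}
    {_ : DecidablePred p} {f : X → ℝ} (g : Y → X) (hg : Function.Injective g) (hp : ∀ y, p (g y))
    (hsurj : ∀ x, p x → f x ≠ 0 → ∃ y, g y = x) :
    (∑ x, if p x then f x else 0) = ∑ y, f (g y) := by
  symm
  refine Finset.sum_of_injOn g (fun y _ y' _ h => hg h) (by simp) ?_ fun y _ => by rw [if_pos (hp y)]
  intro x _ hx
  split_ifs with h
  · by_contra h0
    obtain ⟨y, rfl⟩ := hsurj x h h0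
    exact hx ⟨y, by simp, rfl⟩
  · rfl

lemma frobenius_norm_sq_prod {n m : Type} [Fintype n] [Fintype m] (X : Matrix n m ℂ) :
    ∑ p : n × m, ‖X p.1 p.2‖ ^ 2 = ‖X‖ ^ 2 := by
  rw [frobenius_norm_sq, ← Fintype.sum_prod_type']

/-- The normalization of the block encoding. -/
def encNorm (I : ThermalInstance nv nh N L) (K : ℕ) : ℝ := pairAmp nv * (1 / prepNorm I.α K)

/-- Visible and reference basis states together label the matrix entries, so the success probability
is a squared Frobenius norm. -/
lemma zeroProb_blockEncoding {K : ℕ} {I : ThermalInstance nv nh N L}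
    {ψ : (Work nv nh L K → Bool) → ℂ}
    (h : ∀ v r a, ψ (Work.mk v r a fun _ => false)
        = if a = (fun _ => false) then (encNorm I K : ℂ) * I.halfTrunc K v r else 0) :
    zeroProb (prepWires nv nh L K) ψ = encNorm I K ^ 2 * ‖I.halfTrunc K‖ ^ 2 := by
  rw [← frobenius_norm_sq_prod, Finset.mul_sum, zeroProb]
  refine (sum_ite_eq_sum_of_param (fun p : (Fin nv → Bool) × (Fin nv → Bool) =>
    (Work.mk p.1 p.2 (fun _ => false) fun _ => false : Work nv nh L K → Bool)) ?_ ?_ ?_).trans ?_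
  rotate_left 3
  · refine Finset.sum_congr rfl fun p _ => ?_
    rw [h, if_pos rfl, norm_mul, mul_pow, Complex.norm_real, Real.norm_eq_abs, sq_abs]
  · intro p p' hpp
    exact Prod.ext (congrArg (· ∘ Work.vis nv nh L K) hpp) (congrArg (· ∘ Work.ref nv nh L K) hpp)
  · intro p; exact forall_prepWires.2 rfl
  · intro x hx h0
    rw [forall_prepWires] at hx
    refine ⟨(x ∘ Work.vis nv nh L K, x ∘ Work.ref nv nh L K), ?_⟩
    rw [Work.eq_mk x, hx, h] at h0
    have ha : x ∘ Work.copyHid nv nh L K = fun _ => false := by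
      by_contra hne
      rw [if_neg hne] at h0
      simp at h0
    conv_rhs => rw [Work.eq_mk x, hx, ha]

/-- Applying the network and its inverse turns a state of the visible qubits with amplitudes `X`
into one with amplitudes `σ X`. -/
lemma network_encoding_apply {K : ℕ} (W : QOp (Fin nv ⊕ Fin nh)) {ψ : (Work nv nh L K → Bool) → ℂ}
    {c : ℂ} {X : QOp (Fin nv)}
    (h : ∀ v r a, ψ (Work.mk v r a fun _ => false)
        = if a = (fun _ => false) then c * X v r else 0) (r : Fin nv → Bool)
    (a : Fin nv ⊕ Fin nh → Bool) (ha : a ∘ Sum.inr = fun _ => false) :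
    ((applyOn (Work.visHid nv nh L K) Wᴴ * applyOn (Work.copyHid nv nh L K) W) *ᵥ ψ)
        (Work.mk (fun _ => false) r a fun _ => false)
      = c * (traceOut (W * zeroProj (Fin nv ⊕ Fin nh) * Wᴴ) * X) (a ∘ Sum.inl) r := by
  rw [← Matrix.mulVec_mulVec, applyOn_mulVec]
  have e1 : (Work.mk (fun _ => false) r a fun _ => false : Work nv nh L K → Bool)
      ∘ Work.visHid nv nh L K = fun _ => false := by
    funext i
    rcases i with i | i
    · rfl
    · exact congrFun ha i
  have e2 : ∀ v b, (Work.mk v r b fun _ => false : Work nv nh L K → Bool)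
      ∘ Work.copyHid nv nh L K = b := fun _ _ => rfl
  simp only [e1, Work.extend_visHid, applyOn_mulVec, e2, Work.extend_copyHid, h,
    Matrix.conjTranspose_apply]
  have e3 : ∀ z : Fin nv ⊕ Fin nh → Bool, (∑ b, W (Sum.elim (a ∘ Sum.inl) (z ∘ Sum.inr)) b
      * if b = (fun _ => false) then c * X (z ∘ Sum.inl) r else 0)
      = W (Sum.elim (a ∘ Sum.inl) (z ∘ Sum.inr)) (fun _ => false) * (c * X (z ∘ Sum.inl) r) := by
    intro z
    rw [Finset.sum_eq_single (fun _ => false)]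
    · rw [if_pos rfl]
    · intro b _ hb; rw [if_neg hb, mul_zero]
    · simp
  simp only [e3]
  -- The sum over the hidden values shared by the network on the copy and its inverse on the
  -- original is the partial trace that defines $\sigma_v$.
  rw [Matrix.mul_apply, Finset.mul_sum,
    ← (Equiv.sumArrowEquivProdArrow (Fin nv) (Fin nh) Bool).symm.sum_comp, Fintype.sum_prod_type]
  refine Finset.sum_congr rfl fun v _ => ?_
  rw [traceOut_conj_zeroProj, Finset.sum_mul, Finset.mul_sum]
  refine Finset.sum_congr rfl fun u _ => ?_
  change star (W (Sum.elim v u) _) * (W (Sum.elim (a ∘ Sum.inl) u) _ * (c * X v r)) = _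
  ring

/-- On flagged states only the copied visible qubits and the reference remain free, and these label
the entries of $Y$. -/
lemma zeroProb_network_encoding {K : ℕ} {ψ : (Work nv nh L K → Bool) → ℂ} {c : ℝ}
    {Y : QOp (Fin nv)}
    (h : ∀ r a, a ∘ Sum.inr = (fun _ => false) →
      ψ (Work.mk (fun _ => false) r a fun _ => false) = (c : ℂ) * Y (a ∘ Sum.inl) r) :
    zeroProb (flagWires nv nh L K) ψ = c ^ 2 * ‖Y‖ ^ 2 := by
  rw [← frobenius_norm_sq_prod, Finset.mul_sum, zeroProb]
  refine (sum_ite_eq_sum_of_param (fun p : (Fin nv → Bool) × (Fin nv → Bool) =>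
    (Work.mk (fun _ => false) p.2 (Sum.elim p.1 fun _ => false) fun _ => false :
      Work nv nh L K → Bool)) ?_ ?_ ?_).trans ?_
  rotate_left 3
  · refine Finset.sum_congr rfl fun p _ => ?_
    rw [h _ _ rfl, norm_mul, mul_pow, Complex.norm_real, Real.norm_eq_abs, sq_abs]
    rfl
  · intro p p' hpp
    exact Prod.ext (congrArg (fun x => x ∘ Work.copyHid nv nh L K ∘ Sum.inl) hpp)
      (congrArg (· ∘ Work.ref nv nh L K) hpp)
  · intro p
    refine forall_flagWires.2 ⟨rfl, ?_⟩
    funext i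
    rcases i with i | i <;> rfl
  · intro x hx _
    rw [forall_flagWires] at hx
    refine ⟨(x ∘ Work.copyHid nv nh L K ∘ Sum.inl, x ∘ Work.ref nv nh L K), ?_⟩
    conv_rhs => rw [Work.eq_mk x, hx.1]
    have hv : x ∘ Work.vis nv nh L K = fun _ => false :=
      funext fun i => congrFun hx.2 (Sum.inl i)
    have ha : x ∘ Work.copyHid nv nh L K
        = Sum.elim (x ∘ Work.copyHid nv nh L K ∘ Sum.inl) fun _ => false := by
      funext i
      rcases i with i | i
      · rfl
      · exact congrFun hx.2 (Sum.inr i)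
    rw [hv, ha]

/-- The angle whose squared sine is the success probability of the block encoding. -/
def encAngle (I : ThermalInstance nv nh N L) (K : ℕ) : ℝ :=
  Real.arcsin (encNorm I K * ‖I.halfTrunc K‖)

/-- The squared norm of the part of the state that is marked after the inner amplification. -/
def markedProb (I : ThermalInstance nv nh N L) (θ : Fin N → ℝ) (K ri : ℕ) : ℝ :=
  Real.sin ((2 * ri + 1 : ℕ) * encAngle I K) ^ 2
    * (‖I.sigma θ * I.halfTrunc K‖ ^ 2 / ‖I.halfTrunc K‖ ^ 2)

lemma sigma_apply_eq (I : ThermalInstance nv nh N L) (θ : Fin N → ℝ) :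
    I.sigma θ = traceOut (qnnUnitary I.G θ * zeroProj (Fin nv ⊕ Fin nh) * (qnnUnitary I.G θ)ᴴ) := rfl

lemma encNorm_pos (I : ThermalInstance nv nh N L) (K : ℕ) : 0 < encNorm I K := by
  have := prepNorm_pos I.α K
  unfold encNorm pairAmp
  positivity

/-- Circuit for one experiment, with its cost and the probability of its flag. -/
lemma exists_experiment {P K : ℕ} (hP : Fintype.card (Work nv nh L K) + 1 ≤ P)
    (hP' : Nat.clog 2 N ≤ P) (θ : Fin N → ℝ) (ri ro : ℕ) :
    ∃ M : ThermalInstance nv nh N L → QOp (Work nv nh L K),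
      Realizable P M
        ((2 * ro + 1) * ((2 * ri + 1) * (nv * 2)
            + ri * (2 * (6 * Fintype.card (Work nv nh L K) + 1)))
          + ro * (2 * (6 * Fintype.card (Work nv nh L K) + 1)))
        ((2 * ro + 1) * ((2 * ri + 1) * (K + 2) + 2 * N)) ∧
      ∀ I, ‖I.halfTrunc K‖ ≠ 0 → encNorm I K * ‖I.halfTrunc K‖ ≤ 1 ∧
        0 ≤ markedProb I θ K ri ∧ markedProb I θ K ri ≤ 1 ∧
        zeroProb (flagWires nv nh L K) (M I *ᵥ zeroKet _)
          = Real.sin ((2 * ro + 1 : ℕ) * Real.arcsin √(markedProb I θ K ri)) ^ 2 := by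
  obtain ⟨B, hB, hB0⟩ := exists_blockEncoding (nv := nv) (nh := nh) (N := N) (L := L) (P := P)
    (by omega) K
  have hW1 := Realizable.network (L := L) hP' (Work.visHid nv nh L K) θ
  have hW2 := Realizable.network (L := L) hP' (Work.copyHid nv nh L K) θ
  -- The network acts after the inner amplification, so its $2N$ queries are multiplied by the outer
  -- number of rounds only.
  have hA := ((hW1.adjoint hW1.unitary).mul hW2).mul
    (hB.amplification hP (prepWires nv nh L K) ri)
  refine ⟨_, (hA.amplification hP (flagWires nv nh L K) ro).mono (le_of_eq ?_) (le_of_eq ?_),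
    fun I hT => ?_⟩
  · ring
  · ring
  have hz := zeroProb_blockEncoding (I := I) (hB0 I)
  have hen := encNorm_pos I K
  have hle1 : encNorm I K * ‖I.halfTrunc K‖ ≤ 1 := by
    have := zeroProb_le (prepWires nv nh L K) (B I *ᵥ zeroKet _)
    rw [hz, sum_norm_sq_unitary (hB.unitary I), zeroKet, sum_norm_sq_single, ← mul_pow] at this
    exact (sq_le_one_iff₀ (by positivity)).1 this
  have hχ : Real.sin (encAngle I K) ^ 2 = zeroProb (prepWires nv nh L K) (B I *ᵥ zeroKet _) := by
    rw [hz, encAngle, Real.sin_arcsin (by have := norm_nonneg (I.halfTrunc K); nlinarith) hle1,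
      mul_pow]
  -- Inner amplification rescales the good part by one real factor, so the state still encodes a
  -- multiple of the same matrix.
  obtain ⟨x, hx1, hx2⟩ := ampOp_apply (hB.unitary I) (prepWires nv nh L K) hχ ri
  have hamp : ∀ v r a, (ampOp (B I) (prepWires nv nh L K) ri *ᵥ zeroKet _)
      (Work.mk v r a fun _ => false)
      = if a = (fun _ => false) then ((x * encNorm I K : ℝ) : ℂ) * I.halfTrunc K v r else 0 := by
    intro v r a
    rw [hx1 _ (forall_prepWires.2 rfl), hB0]
    split_ifs
    · rw [encNorm]; push_cast; ring
    · simp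
  have hmark : zeroProb (flagWires nv nh L K)
      (((applyOn (Work.visHid nv nh L K) (qnnUnitary I.G θ))ᴴ
        * applyOn (Work.copyHid nv nh L K) (qnnUnitary I.G θ)
        * ampOp (B I) (prepWires nv nh L K) ri) *ᵥ zeroKet _) = markedProb I θ K ri := by
    rw [zeroProb_network_encoding (c := x * encNorm I K) (Y := I.sigma θ * I.halfTrunc K)]
    · rw [markedProb, ← hx2, hz]
      field_simp
    · intro r a ha
      rw [← Matrix.mulVec_mulVec, ← applyOn_conjTranspose,
        network_encoding_apply (qnnUnitary I.G θ) hamp r a ha]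
      rfl
  have h0 : 0 ≤ markedProb I θ K ri := by unfold markedProb; positivity
  have h1 : markedProb I θ K ri ≤ 1 := by
    rw [← hmark]
    refine (zeroProb_le _ _).trans ?_
    rw [sum_norm_sq_unitary (hA.unitary I), zeroKet, sum_norm_sq_single]
  refine ⟨hle1, h0, h1, zeroProb_ampOp (hA.unitary I) _ ?_ ro⟩
  rw [Real.sin_arcsin (by linarith [Real.sqrt_nonneg (markedProb I θ K ri)]) (Real.sqrt_le_one.2 h1),
    Real.sq_sqrt h0, hmark]

end Amplitude

/-! ### The output state as a function of one parameter -/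

section Network

open scoped Matrix.Norms.Frobenius

variable {nv nh N L : ℕ}

/-- Even powers of $G$ are the identity and odd powers are $G$, so the exponential series splits
into a cosine and a sine series. -/
lemma evolve_eq_cos_sin {ι : Type} [Fintype ι] [DecidableEq ι] {G : QOp ι} (hG : G * G = 1) (t : ℝ) :
    evolve G t = (Real.cos t : ℂ) • (1 : QOp ι) + (Real.sin t : ℂ) • (-Complex.I • G) := by
  have hpow : ∀ n : ℕ, G ^ (2 * n) = 1 := fun n => by rw [pow_mul, sq, hG, one_pow]
  obtain ⟨z, hz⟩ : ∃ z : ℂ, z = -(t : ℂ) := ⟨_, rfl⟩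
  have hX : (-(Complex.I * (t : ℂ))) • G = (z * Complex.I) • G := by rw [hz]; congr 1; ring
  have fe : ∀ n : ℕ, (((2 * n)! : ℂ)⁻¹) • ((z * Complex.I) • G) ^ (2 * n)
      = ((z * Complex.I) ^ (2 * n) / ((2 * n)! : ℂ)) • (1 : QOp ι) := by
    intro n
    rw [smul_pow, hpow, smul_smul, div_eq_inv_mul]
  have fo : ∀ n : ℕ, (((2 * n + 1)! : ℂ)⁻¹) • ((z * Complex.I) • G) ^ (2 * n + 1)
      = ((z * Complex.I) ^ (2 * n + 1) / ((2 * n + 1)! : ℂ) / Complex.I) • (Complex.I • G) := by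
    intro n
    rw [smul_pow, pow_succ G, hpow, one_mul, smul_smul, smul_smul, div_mul_cancel₀ _ Complex.I_ne_zero,
      div_eq_inv_mul]
  have he : HasSum (fun n : ℕ => (((2 * n)! : ℂ)⁻¹) • ((z * Complex.I) • G) ^ (2 * n))
      (Complex.cos z • (1 : QOp ι)) := by
    rw [funext fe]
    exact (Complex.hasSum_cos' z).smul_const (1 : QOp ι)
  have ho : HasSum (fun n : ℕ => (((2 * n + 1)! : ℂ)⁻¹) • ((z * Complex.I) • G) ^ (2 * n + 1))
      (Complex.sin z • (Complex.I • G)) := by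
    rw [funext fo]
    exact (Complex.hasSum_sin' z).smul_const (Complex.I • G)
  have := (hasSum_matrix_exp ((z * Complex.I) • G)).unique (HasSum.even_add_odd he ho)
  rw [evolve, hX, this, hz, Complex.cos_neg, Complex.sin_neg, ← Complex.ofReal_cos,
    ← Complex.ofReal_sin, smul_smul, smul_smul, neg_mul, mul_neg]

lemma exists_prod_update {A : Type} [Monoid A] {N : ℕ} (F : Fin N → A) (k : Fin N) :
    ∃ P Q : A, ∀ a, (List.ofFn (Function.update F k a)).prod = P * a * Q := by
  induction N with
  | zero => exact k.elim0
  | succ N ih =>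
    refine Fin.cases ?_ (fun k => ?_) k
    · refine ⟨1, (List.ofFn fun i : Fin N => F i.succ).prod, fun a => ?_⟩
      rw [List.ofFn_succ, List.prod_cons]
      simp
    · obtain ⟨P, Q, h⟩ := ih (fun i => F i.succ) k
      refine ⟨F 0 * P, Q, fun a => ?_⟩
      have e : (fun i : Fin N => Function.update F k.succ a i.succ)
          = Function.update (fun i => F i.succ) k a := by
        funext i
        by_cases hi : i = k
        · subst hi; simp
        · rw [Function.update_of_ne hi, Function.update_of_ne fun h => hi (Fin.succ_injective _ h)]
      rw [List.ofFn_succ, List.prod_cons, e, h, Function.update_of_ne (Fin.succ_ne_zero k).symm]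
      simp only [mul_assoc]

lemma involution_of_hermitian_unitary {ι : Type} [Fintype ι] [DecidableEq ι] {G : QOp ι}
    (hU : G ∈ Matrix.unitaryGroup (ι → Bool) ℂ) (hH : G.IsHermitian) : G * G = 1 := by
  have := Matrix.mem_unitaryGroup_iff.1 hU
  rwa [Matrix.star_eq_conjTranspose, hH.eq] at this

namespace ThermalInstance

variable (I : ThermalInstance nv nh N L)

lemma qnnUnitary_unitary (θ : Fin N → ℝ) :
    qnnUnitary I.G θ ∈ Matrix.unitaryGroup (Fin nv ⊕ Fin nh → Bool) ℂ := by
  refine list_prod_mem fun M hM => ?_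
  obtain ⟨j, rfl⟩ := (List.mem_ofFn' _ _).1 hM
  exact evolve_unitary (I.G_hermitian j) _

/-- The output amplitudes of the network, as a matrix between hidden and visible qubits. -/
def outMatrix (W : QOp (Fin nv ⊕ Fin nh)) : Matrix (Fin nv → Bool) (Fin nh → Bool) ℂ :=
  fun a h => W (Sum.elim a h) fun _ => false

/-- The reduced state of a pure state with amplitude matrix $M$ is $MM^\dagger$; hermiticity, unit
trace and the norm bound all follow from this form. -/
lemma sigma_eq_outMatrix (θ : Fin N → ℝ) :
    I.sigma θ = outMatrix (qnnUnitary I.G θ) * (outMatrix (qnnUnitary I.G θ))ᴴ := by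
  ext a v
  rw [sigma_apply_eq, traceOut_conj_zeroProj, Matrix.mul_apply]
  rfl

lemma norm_outMatrix (θ : Fin N → ℝ) : ‖outMatrix (nv := nv) (nh := nh) (qnnUnitary I.G θ)‖ = 1 := by
  have h := sum_norm_sq_unitary (I.qnnUnitary_unitary θ) (zeroKet _)
  rw [zeroKet, sum_norm_sq_single,
    ← (Equiv.sumArrowEquivProdArrow (Fin nv) (Fin nh) Bool).symm.sum_comp, Fintype.sum_prod_type] at h
  have h2 : ‖outMatrix (nv := nv) (nh := nh) (qnnUnitary I.G θ)‖ ^ 2 = 1 := by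
    rw [frobenius_norm_sq, ← h]
    refine Finset.sum_congr rfl fun a _ => Finset.sum_congr rfl fun b _ => ?_
    rw [Matrix.mulVec_single_one]
    rfl
  exact (pow_eq_one_iff_of_nonneg (norm_nonneg _) (by norm_num)).1 h2

lemma sigma_isHermitian (θ : Fin N → ℝ) : (I.sigma θ).IsHermitian := by
  rw [sigma_eq_outMatrix]
  exact Matrix.isHermitian_mul_conjTranspose_self _

lemma sigma_trace (θ : Fin N → ℝ) : (I.sigma θ).trace = 1 := by
  rw [sigma_eq_outMatrix, Matrix.trace_mul_comm, trace_conjTranspose_mul_self, norm_outMatrix]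
  simp

lemma norm_sigma_le (θ : Fin N → ℝ) : ‖I.sigma θ‖ ≤ 1 := by
  rw [sigma_eq_outMatrix]
  refine (Matrix.frobenius_norm_mul _ _).trans ?_
  rw [Matrix.frobenius_norm_conjTranspose, norm_outMatrix, one_mul]

lemma norm_sigma_mul_le (θ : Fin N → ℝ) (X : QOp (Fin nv)) : ‖I.sigma θ * X‖ ≤ ‖X‖ := by
  refine (Matrix.frobenius_norm_mul _ _).trans ?_
  have := I.norm_sigma_le θ
  nlinarith [norm_nonneg X]

/-- The network unitary is linear in $(\cos t,\sin t)$, because one factor is. The output state is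
therefore quadratic in them, and its squared norms are quartic. -/
lemma exists_sigma_update (θ : Fin N → ℝ) (k : Fin N) :
    ∃ X Y Z : QOp (Fin nv), ∀ t : ℝ, I.sigma (Function.update θ k (θ k + t))
      = ((Real.cos t ^ 2 : ℝ) : ℂ) • X + ((Real.cos t * Real.sin t : ℝ) : ℂ) • Y
        + ((Real.sin t ^ 2 : ℝ) : ℂ) • Z := by
  obtain ⟨P, Q, h⟩ := exists_prod_update (fun j => evolve (I.G j) (θ j)) k
  obtain ⟨W0, hW0⟩ : ∃ W0, W0 = P * evolve (I.G k) (θ k) * Q := ⟨_, rfl⟩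
  obtain ⟨W1, hW1⟩ : ∃ W1, W1 = P * (evolve (I.G k) (θ k) * (-Complex.I • I.G k)) * Q := ⟨_, rfl⟩
  have hW : ∀ t : ℝ, qnnUnitary I.G (Function.update θ k (θ k + t))
      = (Real.cos t : ℂ) • W0 + (Real.sin t : ℂ) • W1 := by
    intro t
    have e : (fun j => evolve (I.G j) (Function.update θ k (θ k + t) j))
        = Function.update (fun j => evolve (I.G j) (θ j)) k (evolve (I.G k) (θ k + t)) := by
      funext j
      by_cases hj : j = k
      · subst hj; simp
      · simp [hj]
    rw [qnnUnitary, e, h, evolve_add,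
      evolve_eq_cos_sin (involution_of_hermitian_unitary (I.G_unitary k) (I.G_hermitian k)) t,
      hW0, hW1]
    simp only [Matrix.mul_add, Matrix.add_mul, Matrix.mul_smul, Matrix.smul_mul, Matrix.mul_one]
  refine ⟨outMatrix W0 * (outMatrix W0)ᴴ,
    outMatrix W0 * (outMatrix W1)ᴴ + outMatrix W1 * (outMatrix W0)ᴴ,
    outMatrix W1 * (outMatrix W1)ᴴ, fun t => ?_⟩
  have ho : outMatrix ((Real.cos t : ℂ) • W0 + (Real.sin t : ℂ) • W1)
      = (Real.cos t : ℂ) • outMatrix W0 + (Real.sin t : ℂ) • outMatrix W1 := rfl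
  rw [sigma_eq_outMatrix, hW, ho, Matrix.conjTranspose_add, Matrix.conjTranspose_smul,
    Matrix.conjTranspose_smul, Complex.star_def, Complex.conj_ofReal, Complex.conj_ofReal]
  simp only [Matrix.mul_add, Matrix.add_mul, Matrix.mul_smul, Matrix.smul_mul, smul_add, smul_smul]
  push_cast
  module

end ThermalInstance

lemma sum_quartic {ι : Type} (s : Finset ι) (b : ι → Fin 5 → ℝ) (c d : ℝ) :
    ∑ p ∈ s, quartic (b p) c d = quartic (fun i => ∑ p ∈ s, b p i) c d := by
  simp only [quartic, Finset.sum_add_distrib, Finset.sum_mul]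

lemma exists_quartic_normSq (x y z : ℂ) :
    ∃ β, ∀ c s : ℝ, ‖((c ^ 2 : ℝ) : ℂ) * x + ((c * s : ℝ) : ℂ) * y + ((s ^ 2 : ℝ) : ℂ) * z‖ ^ 2
      = quartic β c s := by
  refine ⟨![x.re ^ 2 + x.im ^ 2, 2 * (x.re * y.re + x.im * y.im),
    y.re ^ 2 + y.im ^ 2 + 2 * (x.re * z.re + x.im * z.im), 2 * (y.re * z.re + y.im * z.im),
    z.re ^ 2 + z.im ^ 2], fun c s => ?_⟩
  rw [← Complex.normSq_eq_norm_sq, Complex.normSq_apply]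
  simp only [Complex.add_re, Complex.add_im, Complex.re_ofReal_mul, Complex.im_ofReal_mul, quartic,
    Matrix.cons_val]
  ring

namespace ThermalInstance

variable (I : ThermalInstance nv nh N L)

/-- The overlap functions are quartic forms in the cosine and sine of the parameter. -/
lemma exists_quartic_norm_sigma_mul (θ : Fin N → ℝ) (k : Fin N) (E : QOp (Fin nv)) :
    ∃ β, ∀ t : ℝ, ‖I.sigma (Function.update θ k (θ k + t)) * E‖ ^ 2
      = quartic β (Real.cos t) (Real.sin t) := by
  obtain ⟨X, Y, Z, h⟩ := I.exists_sigma_update θ k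
  choose b hb using fun p : (Fin nv → Bool) × (Fin nv → Bool) =>
    exists_quartic_normSq ((X * E) p.1 p.2) ((Y * E) p.1 p.2) ((Z * E) p.1 p.2)
  refine ⟨fun i => ∑ p, b p i, fun t => ?_⟩
  rw [← sum_quartic, ← frobenius_norm_sq_prod]
  refine Finset.sum_congr rfl fun p _ => ?_
  rw [← hb, h]
  simp only [Matrix.add_mul, Matrix.smul_mul, Matrix.add_apply, Matrix.smul_apply, smul_eq_mul]

/-- The factor $\|e^{-H/2}\|^2$ is independent of $\theta$ and cancels from the derivative of the
logarithm. -/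
lemma hasDerivAt_renyiTwo (θ : Fin N → ℝ) (k : Fin N) {β : Fin 5 → ℝ}
    (hβ : ∀ t : ℝ, ‖I.sigma (Function.update θ k (θ k + t)) * halfExp I.ham‖ ^ 2
      = quartic β (Real.cos t) (Real.sin t)) (h0 : 0 < β 0) :
    HasDerivAt (fun t => renyiTwo (I.sigma (Function.update θ k t)) I.target) (β 1 / β 0) (θ k) := by
  obtain ⟨c, hc⟩ : ∃ c, c = ‖halfExp (-I.ham)‖ ^ 2 := ⟨_, rfl⟩
  have hc0 : 0 < c := by have := trace_exp_pos (-I.ham); rw [hc]; positivity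
  have hf : (fun t => renyiTwo (I.sigma (Function.update θ k t)) I.target)
      = fun u => Real.log (c * quartic β (Real.cos (u - θ k)) (Real.sin (u - θ k))) := by
    funext u
    rw [renyiTwo, target, overlap_thermalState I.ham_isHermitian (I.sigma_isHermitian _), ← hc,
      ← hβ, add_sub_cancel]
  rw [hf]
  have hq : HasDerivAt (fun u => quartic β (Real.cos (u - θ k)) (Real.sin (u - θ k))) (β 1) (θ k) := by
    have := hasDerivAt_quartic β
    rw [← sub_self (θ k)] at this
    exact this.comp_sub_const (θ k) (θ k)
  have hv : quartic β (Real.cos (θ k - θ k)) (Real.sin (θ k - θ k)) = β 0 := by simp [quartic]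
  have := (hq.const_mul c).log (by rw [hv]; positivity)
  rw [hv, mul_div_mul_left _ _ hc0.ne'] at this
  exact this

end ThermalInstance

end Network

/-! ### Independent samples -/

section Sampling

variable {R Y : Type} [Fintype R] [DecidableEq R] [Fintype Y]

lemma sum_prod_eq_prod_sum (u : R → Y → ℝ) : ∑ x : R → Y, ∏ r, u r (x r) = ∏ r, ∑ y, u r y := by
  classical
  rw [Finset.prod_univ_sum, Fintype.piFinset_univ]

/-- Independent centred variables are uncorrelated: for $r_0\ne r_1$ the factor belonging to $r_0$
sums to zero. -/
lemma sum_prod_mul_mul {w : R → Y → ℝ} (hw : ∀ r, ∑ y, w r y = 1) {d : R → Y → ℝ}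
    (hd : ∀ r, ∑ y, w r y * d r y = 0) (r₀ r₁ : R) :
    ∑ x : R → Y, (∏ r, w r (x r)) * (d r₀ (x r₀) * d r₁ (x r₁))
      = if r₀ = r₁ then ∑ y, w r₀ y * d r₀ y ^ 2 else 0 := by
  have h1 : ∀ x : R → Y, (∏ r, w r (x r)) * (d r₀ (x r₀) * d r₁ (x r₁))
      = ∏ r, (w r (x r) * ((if r = r₀ then d r (x r) else 1) * if r = r₁ then d r (x r) else 1)) := by
    intro x
    rw [Finset.prod_mul_distrib, Finset.prod_mul_distrib, Finset.prod_ite_eq', Finset.prod_ite_eq']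
    simp
  rw [Finset.sum_congr rfl fun x _ => h1 x, sum_prod_eq_prod_sum fun r y =>
    w r y * ((if r = r₀ then d r y else 1) * if r = r₁ then d r y else 1)]
  split_ifs with h
  · subst h
    rw [← Finset.mul_prod_erase Finset.univ _ (Finset.mem_univ r₀), Finset.prod_eq_one, mul_one]
    · simp only [if_true]
      exact Finset.sum_congr rfl fun y _ => by ring
    · intro r hr
      simp [Finset.ne_of_mem_erase hr, hw]
  · apply Finset.prod_eq_zero (Finset.mem_univ r₀)
    simp [h, hd]

/-- Chebyshev's inequality for the relative frequencies of several groups of independent samples,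
with a union bound over the groups. -/
lemma sum_prod_frequency_far_le {E : Type} [Fintype E] [DecidableEq E] {n : ℕ} (hn : 0 < n)
    {w : E → Y → ℝ} (hw0 : ∀ e y, 0 ≤ w e y) (hw : ∀ e, ∑ y, w e y = 1) {h : Y → ℝ}
    (h0 : ∀ y, 0 ≤ h y) (h1 : ∀ y, h y ≤ 1) {η : ℝ} (hη : 0 < η)
    (B : Set (E × Fin n → Y)) [DecidablePred (· ∈ B)]
    (hB : ∀ x ∈ B, ∃ e, η < |(∑ i, h (x (e, i))) / n - ∑ y, w e y * h y|) :
    (∑ x : E × Fin n → Y, if x ∈ B then ∏ r, w r.1 (x r) else 0)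
      ≤ Fintype.card E / (n * η ^ 2) := by
  have hn' : (0 : ℝ) < n := by exact_mod_cast hn
  obtain ⟨q, hq⟩ : ∃ q : E → ℝ, ∀ e, q e = ∑ y, w e y * h y := ⟨_, fun _ => rfl⟩
  simp only [← hq] at hB
  have hq0 : ∀ e, 0 ≤ q e := fun e => by
    rw [hq]; exact Finset.sum_nonneg fun y _ => mul_nonneg (hw0 e y) (h0 y)
  have hq1 : ∀ e, q e ≤ 1 := fun e => by
    rw [hq, ← hw e]
    exact Finset.sum_le_sum fun y _ => mul_le_of_le_one_right (hw0 e y) (h1 y)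
  let d : E × Fin n → Y → ℝ := fun r y => h y - q r.1
  have hd : ∀ r, ∑ y, w r.1 y * d r y = 0 := by
    intro r
    simp only [d, mul_sub, Finset.sum_sub_distrib, ← Finset.sum_mul, hw, ← hq]
    ring
  have hd2 : ∀ r, ∑ y, w r.1 y * d r y ^ 2 ≤ 1 := by
    intro r
    rw [← hw r.1]
    refine Finset.sum_le_sum fun y _ => mul_le_of_le_one_right (hw0 _ _) ?_
    have a1 := h0 y; have a2 := h1 y; have a3 := hq0 r.1; have a4 := hq1 r.1
    simp only [d]
    nlinarith
  have hP0 : ∀ x : E × Fin n → Y, 0 ≤ ∏ r, w r.1 (x r) :=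
    fun x => Finset.prod_nonneg fun r _ => hw0 _ _
  -- Cross terms vanish, which leaves $n$ variances, each at most one.
  have hsecond : ∀ e, ∑ x : E × Fin n → Y, (∏ r, w r.1 (x r)) * (∑ i, d (e, i) (x (e, i))) ^ 2 ≤ n := by
    intro e
    have : ∀ x : E × Fin n → Y, (∏ r, w r.1 (x r)) * (∑ i, d (e, i) (x (e, i))) ^ 2
        = ∑ i, ∑ j, (∏ r, w r.1 (x r)) * (d (e, i) (x (e, i)) * d (e, j) (x (e, j))) := by
      intro x
      rw [sq, Finset.sum_mul_sum, Finset.mul_sum]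
      simp only [Finset.mul_sum]
    rw [Finset.sum_congr rfl fun x _ => this x, Finset.sum_comm]
    calc _ ≤ ∑ i : Fin n, (1 : ℝ) := by
          refine Finset.sum_le_sum fun i _ => ?_
          rw [Finset.sum_comm]
          simp only [sum_prod_mul_mul (w := fun r : E × Fin n => w r.1) (fun r => hw r.1) hd,
            Prod.mk.injEq, true_and, Finset.sum_ite_eq, Finset.mem_univ, if_true]
          exact hd2 (e, i)
      _ = n := by simp
  -- Chebyshev's inequality pointwise: if group $e$ is off by more than $\eta$, its term alone
  -- exceeds the indicator. Summing over all groups is the union bound.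
  have hpoint : ∀ x : E × Fin n → Y, (if x ∈ B then ∏ r, w r.1 (x r) else 0)
      ≤ ∑ e, (∏ r, w r.1 (x r)) * (∑ i, d (e, i) (x (e, i))) ^ 2 / (n ^ 2 * η ^ 2) := by
    intro x
    have hnn : ∀ e ∈ Finset.univ,
        0 ≤ (∏ r, w r.1 (x r)) * (∑ i, d (e, i) (x (e, i))) ^ 2 / (n ^ 2 * η ^ 2) :=
      fun e _ => div_nonneg (mul_nonneg (hP0 x) (sq_nonneg _)) (by positivity)
    split_ifs with hx
    · obtain ⟨e, he⟩ := hB x hx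
      refine le_trans ?_ (Finset.single_le_sum hnn (Finset.mem_univ e))
      have hs : ∑ i, d (e, i) (x (e, i)) = n * ((∑ i, h (x (e, i))) / n - q e) := by
        simp only [d, Finset.sum_sub_distrib, Finset.sum_const, Finset.card_univ, Fintype.card_fin,
          nsmul_eq_mul]
        field_simp
      rw [hs, mul_pow, mul_div_assoc, mul_div_mul_left _ _ (by positivity), ← sq_abs]
      refine le_mul_of_one_le_right (hP0 x) ?_
      rw [one_le_div (by positivity)]
      gcongr
    · exact Finset.sum_nonneg hnn
  refine (Finset.sum_le_sum fun x _ => hpoint x).trans ?_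
  rw [Finset.sum_comm]
  calc _ ≤ ∑ e : E, (n : ℝ) / (n ^ 2 * η ^ 2) := by
        refine Finset.sum_le_sum fun e _ => ?_
        rw [← Finset.sum_div]
        gcongr
        exact hsecond e
    _ = _ := by
        rw [Finset.sum_const, Finset.card_univ, nsmul_eq_mul]
        field_simp

end Sampling

/-! ### Independent circuits side by side -/

section Parallel

variable {nv nh N L : ℕ} {R ι : Type} [Fintype R] [DecidableEq R] [Fintype ι] [DecidableEq ι] {W : ℕ}

/-- The wires of the `r`-th copy. -/
def copyWires (f : R × ι ≃ Fin W) (r : R) : ι ↪ Fin W :=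
  ⟨fun i => f (r, i), fun i j h => by simpa using h⟩

lemma applyOn_copyWires_prod (f : R × ι ≃ Fin W) (g : R → (ι → Bool) → ℂ) (r₀ : R) (M : QOp ι) :
    applyOn (copyWires f r₀) M *ᵥ (fun x => ∏ r, g r (x ∘ copyWires f r))
      = fun x => ∏ r, Function.update g r₀ (M *ᵥ g r₀) r (x ∘ copyWires f r) := by
  funext x
  rw [applyOn_mulVec, ← Finset.mul_prod_erase Finset.univ _ (Finset.mem_univ r₀),
    Function.update_self, Matrix.mulVec, dotProduct, Finset.sum_mul]
  refine Finset.sum_congr rfl fun z _ => ?_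
  rw [← Finset.mul_prod_erase Finset.univ _ (Finset.mem_univ r₀), extend_comp_self, mul_assoc]
  congr 2
  refine Finset.prod_congr rfl fun r hr => ?_
  have hne := Finset.ne_of_mem_erase hr
  rw [Function.update_of_ne hne, extend_comp_of_disjoint]
  intro i j h
  have := f.injective h
  exact hne (Prod.ext_iff.1 this).1.symm

/-- A circuit on one copy changes only its own tensor factor, so product states stay product states.
-/
lemma foldl_copies (f : R × ι ≃ Fin W) (I : ThermalInstance nv nh N L)
    (c : R → List (Gate nv nh N L ι)) (l : List R) (hl : l.Nodup) (g : R → (ι → Bool) → ℂ) :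
    (l.flatMap fun r => (c r).map (Gate.toInstr (copyWires f r))).foldl (fun ψ g => g.op I *ᵥ ψ)
        (fun x => ∏ r, g r (x ∘ copyWires f r))
      = fun x => ∏ r, (if r ∈ l then circOp I (c r) *ᵥ g r else g r) (x ∘ copyWires f r) := by
  induction l generalizing g with
  | nil => simp
  | cons r l ih =>
    rw [List.nodup_cons] at hl
    rw [List.flatMap_cons, List.foldl_append, foldl_toInstr, applyOn_copyWires_prod, ih hl.2]
    funext x
    refine Finset.prod_congr rfl fun r' _ => ?_
    by_cases h : r' = r
    · subst h
      simp [hl.1]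
    · simp [h]

lemma sum_map_flatMap {X Y : Type} (l : List X) (f : X → List Y) (g : Y → ℕ) :
    ((l.flatMap f).map g).sum = (l.map fun a => ((f a).map g).sum).sum := by
  induction l with
  | nil => rfl
  | cons a l ih => simp [ih]

omit [DecidableEq R] in
lemma single_zero_eq_prod (f : R × ι ≃ Fin W) :
    (Pi.single (fun _ => false) 1 : (Fin W → Bool) → ℂ)
      = fun x => ∏ r, zeroKet ι (x ∘ copyWires f r) := by
  funext x
  rw [Pi.single_apply]
  split_ifs with h
  · subst h
    symm
    exact Finset.prod_eq_one fun r _ => by simp [zeroKet, Function.comp_def]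
  · symm
    have : ∃ w, x w ≠ false := by
      by_contra hc
      push Not at hc
      exact h (funext hc)
    obtain ⟨w, hw⟩ := this
    apply Finset.prod_eq_zero (Finset.mem_univ (f.symm w).1)
    rw [zeroKet, Pi.single_eq_of_ne]
    intro hc
    apply hw
    have : x (f ((f.symm w).1, (f.symm w).2)) = false := congrFun hc (f.symm w).2
    simpa using this

/-- Runs independent circuits side by side, `n` times each, and evaluates the relative
frequencies of a flag. -/
lemma exists_sampling_algorithm {E : Type} [Fintype E] [DecidableEq E] {n : ℕ} (hn : 0 < n)
    (c : E → List (Gate nv nh N L ι)) {h : (ι → Bool) → ℝ} (h0 : ∀ y, 0 ≤ h y) (h1 : ∀ y, h y ≤ 1)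
    (out : (E → ℝ) → ℝ) :
    ∃ Q : QAlgorithm nv nh N L, Q.gateCount = n * ∑ e, circGates (c e) ∧
      Q.queryCount = n * ∑ e, circQueries (c e) ∧
      ∀ (I : ThermalInstance nv nh N L) (S : Set ℝ) (η : ℝ), 0 < η →
        (∀ y : E → ℝ, (∀ e, |y e - ∑ x, ‖(circOp I (c e) *ᵥ zeroKet ι) x‖ ^ 2 * h x| ≤ η) →
          out y ∈ S) →
        1 - Fintype.card E / (n * η ^ 2) ≤ Q.prob I S := by
  classical
  obtain ⟨f⟩ : Nonempty ((E × Fin n) × ι ≃ Fin (Fintype.card ((E × Fin n) × ι))) :=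
    ⟨Fintype.equivFin _⟩
  refine ⟨⟨_, (Finset.univ : Finset (E × Fin n)).toList.flatMap fun r =>
    (c r.1).map (Gate.toInstr (copyWires f r)),
    fun x => out fun e => (∑ i, h (x ∘ copyWires f (e, i))) / n⟩, ?_, ?_, fun I S η hη hS => ?_⟩
  · rw [QAlgorithm.gateCount, sum_map_flatMap]
    simp only [List.map_map, Function.comp_def, Gate.toInstr_gateCost]
    change ((Finset.univ : Finset (E × Fin n)).toList.map fun r => circGates (c r.1)).sum = _
    rw [Finset.sum_map_toList, Fintype.sum_prod_type, Finset.mul_sum]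
    simp
  · rw [QAlgorithm.queryCount, sum_map_flatMap]
    simp only [List.map_map, Function.comp_def, Gate.toInstr_queryCost]
    change ((Finset.univ : Finset (E × Fin n)).toList.map fun r => circQueries (c r.1)).sum = _
    rw [Finset.sum_map_toList, Fintype.sum_prod_type, Finset.mul_sum]
    simp
  · let w : E → (ι → Bool) → ℝ := fun e y => ‖(circOp I (c e) *ᵥ zeroKet ι) y‖ ^ 2
    have hw0 : ∀ e y, 0 ≤ w e y := fun e y => by positivity
    have hw : ∀ e, ∑ y, w e y = 1 := fun e => by
      simp only [w]
      rw [sum_norm_sq_unitary (circOp_unitary I (c e)), zeroKet, sum_norm_sq_single]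
    let T : Set (E × Fin n → ι → Bool) := {X | out (fun e => (∑ i, h (X (e, i))) / n) ∈ S}
    have hfinal : ∀ x, ‖QAlgorithm.finalState ⟨_, (Finset.univ : Finset (E × Fin n)).toList.flatMap
        fun r => (c r.1).map (Gate.toInstr (copyWires f r)),
        fun x => out fun e => (∑ i, h (x ∘ copyWires f (e, i))) / n⟩ I x‖ ^ 2
        = ∏ r, w r.1 (x ∘ copyWires f r) := by
      intro x
      rw [QAlgorithm.finalState]
      simp only
      rw [single_zero_eq_prod f, foldl_copies f I (fun r => c r.1) _ (Finset.nodup_toList _)]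
      simp only [Finset.mem_toList, Finset.mem_univ, if_true, norm_prod, w]
      exact (Finset.prod_pow _ _ _).symm
    -- Regroups a measured bit string by copies; the outcome distribution becomes a product
    -- distribution.
    let reg : (Fin (Fintype.card ((E × Fin n) × ι)) → Bool) ≃ (E × Fin n → ι → Bool) :=
      (f.symm.arrowCongr (Equiv.refl Bool)).trans (Equiv.curry _ _ _)
    have hreg : ∀ x r, reg x r = x ∘ copyWires f r := fun x r => rfl
    have hprob : QAlgorithm.prob ⟨_, (Finset.univ : Finset (E × Fin n)).toList.flatMap
        fun r => (c r.1).map (Gate.toInstr (copyWires f r)),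
        fun x => out fun e => (∑ i, h (x ∘ copyWires f (e, i))) / n⟩ I S
        = ∑ X : E × Fin n → ι → Bool, if X ∈ T then ∏ r, w r.1 (X r) else 0 := by
      rw [QAlgorithm.prob, ← reg.sum_comp]
      refine Finset.sum_congr rfl fun x _ => ?_
      rw [hfinal]
      rfl
    rw [hprob]
    have hfar := sum_prod_frequency_far_le hn hw0 hw h0 h1 hη (Tᶜ) (fun X hX => by
      by_contra hc
      push Not at hc
      exact hX (hS _ hc))
    have htot : ∑ X : E × Fin n → ι → Bool, ∏ r, w r.1 (X r) = 1 := by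
      rw [sum_prod_eq_prod_sum fun r : E × Fin n => w r.1]
      exact Finset.prod_eq_one fun r _ => hw r.1
    have hsplit : (∑ X : E × Fin n → ι → Bool, if X ∈ T then ∏ r, w r.1 (X r) else 0)
        + (∑ X : E × Fin n → ι → Bool, if X ∈ Tᶜ then ∏ r, w r.1 (X r) else 0) = 1 := by
      rw [← htot, ← Finset.sum_add_distrib]
      refine Finset.sum_congr rfl fun X _ => ?_
      by_cases hX : X ∈ T <;> simp [hX]
    linarith

end Parallel

/-! ### Setting the auxiliary wires and reading the flag -/

section Initialization

variable {nv nh N L P : ℕ} {ω : Type} [Fintype ω] [DecidableEq ω]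

lemma exists_flips_circuit {ι : Type} [Fintype ι] [DecidableEq ι] (l : List ι) (hl : l.Nodup) :
    ∃ c : List (Gate nv nh N L ι), circGates c = l.length ∧ circQueries c = 0 ∧
      ∀ I y, circOp I c *ᵥ Pi.single y 1 = Pi.single (fun w => if w ∈ l then !y w else y w) 1 := by
  induction l with
  | nil => exact ⟨[], rfl, rfl, fun I y => by
      simp only [circOp, Matrix.one_mulVec]; simp⟩
  | cons w l ih =>
    rw [List.nodup_cons] at hl
    obtain ⟨c, h1, h2, h3⟩ := ih hl.2
    refine ⟨c ++ [.single flipGate w], ?_, ?_, fun I y => ?_⟩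
    · rw [circGates_append, h1]; rfl
    · rw [circQueries_append, h2]; rfl
    · rw [circOp_append, circOp_singleton, ← Matrix.mulVec_mulVec, h3]
      simp only [Gate.op]
      rw [applyOn_flipGate, permOp_mulVec_single]
      congr 1
      funext v
      by_cases hv : v = w
      · subst hv; simp [hl.1]
      · simp [hv]

/-- A realizable operator can be run from the zero state, auxiliary wires included. -/
lemma Realizable.exists_circuit {M : ThermalInstance nv nh N L → QOp ω} {g q : ℕ}
    (hM : Realizable P M g q) :
    ∃ c : List (Gate nv nh N L (ω ⊕ Anc P)), circGates c ≤ P + g ∧ circQueries c ≤ q ∧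
      ∀ I, circOp I c *ᵥ zeroKet _ = withAnc (M I *ᵥ zeroKet ω) := by
  obtain ⟨c, h1, h2, h3⟩ := hM
  obtain ⟨d, d1, d2, d3⟩ := exists_flips_circuit (nv := nv) (nh := nh) (N := N) (L := L)
    ((List.finRange P).map fun i => (Sum.inr (i, true) : ω ⊕ Anc P))
    ((List.nodup_finRange P).map fun i j h => by simpa using h)
  refine ⟨d ++ c, ?_, ?_, fun I => ?_⟩
  · rw [circGates_append, d1, List.length_map, List.length_finRange]; omega
  · rw [circQueries_append, d2]; omega
  · rw [circOp_append, ← Matrix.mulVec_mulVec, zeroKet, d3, ← h3, zeroKet, withAnc_single]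
    congr 2
    rw [sum_elim_snd_eq_iff]
    constructor
    · funext p
      obtain ⟨i, b⟩ := p
      cases b <;> simp
    · funext w
      simp

/-- The flag of an experiment: all wires in `S` are found in state zero. -/
def zeroFlag (P : ℕ) (S : Finset ω) (x : ω ⊕ Anc P → Bool) : ℝ :=
  if ∀ w ∈ S, x (Sum.inl w) = false then 1 else 0

lemma sum_withAnc_zeroFlag (S : Finset ω) (ψ : (ω → Bool) → ℂ) :
    ∑ x, ‖withAnc (P := P) ψ x‖ ^ 2 * zeroFlag P S x = zeroProb S ψ := by
  rw [zeroProb, ← (Equiv.sumArrowEquivProdArrow ω (Anc P) Bool).symm.sum_comp, Fintype.sum_prod_type]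
  refine Finset.sum_congr rfl fun x _ => ?_
  rw [Finset.sum_eq_single Prod.snd]
  · have h1 : withAnc (P := P) ψ ((Equiv.sumArrowEquivProdArrow ω (Anc P) Bool).symm (x, Prod.snd))
        = ψ x := if_pos rfl
    rw [h1]
    by_cases h : ∀ w ∈ S, x w = false
    · have h2 : zeroFlag P S ((Equiv.sumArrowEquivProdArrow ω (Anc P) Bool).symm (x, Prod.snd)) = 1 :=
        if_pos h
      rw [h2, mul_one, if_pos h]
    · have h2 : zeroFlag P S ((Equiv.sumArrowEquivProdArrow ω (Anc P) Bool).symm (x, Prod.snd)) = 0 :=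
        if_neg h
      rw [h2, mul_zero, if_neg h]
  · intro y _ hy
    have : withAnc (P := P) ψ ((Equiv.sumArrowEquivProdArrow ω (Anc P) Bool).symm (x, y)) = 0 :=
      if_neg hy
    rw [this]
    simp
  · simp

end Initialization

/-! ### Stability of the logarithmic derivative -/

lemma quartic_smul (κ : ℝ) (β : Fin 5 → ℝ) (c s : ℝ) :
    quartic (fun i => κ * β i) c s = κ * quartic β c s := by
  simp only [quartic]; ring

lemma quartic_at_zero (β : Fin 5 → ℝ) : quartic β (Real.cos (shiftAngle 0)) (Real.sin (shiftAngle 0)) = β 0 := by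
  simp [quartic, shiftAngle]

/-- A quartic form in the cosine and sine with values in the unit interval. -/
def IsUnitQuartic (β : Fin 5 → ℝ) : Prop :=
  ∀ t, 0 ≤ quartic β (Real.cos t) (Real.sin t) ∧ quartic β (Real.cos t) (Real.sin t) ≤ 1

lemma IsUnitQuartic.smul {β : Fin 5 → ℝ} (hβ : IsUnitQuartic β) {κ : ℝ} (h0 : 0 ≤ κ) (h1 : κ ≤ 1) :
    IsUnitQuartic fun i => κ * β i := fun t => by
  rw [quartic_smul]
  exact ⟨mul_nonneg h0 (hβ t).1, mul_le_one₀ h1 (hβ t).1 (hβ t).2⟩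

/-- The square roots of two forms differ by at most `δ` at the sampled angles. -/
def SqrtClose (δ : ℝ) (β γ : Fin 5 → ℝ) : Prop :=
  ∀ i, |√(quartic β (Real.cos (shiftAngle i)) (Real.sin (shiftAngle i)))
      - √(quartic γ (Real.cos (shiftAngle i)) (Real.sin (shiftAngle i)))| ≤ δ

lemma SqrtClose.sqrt_le {δ : ℝ} {β γ : Fin 5 → ℝ} (h : SqrtClose δ β γ) : √(β 0) - δ ≤ √(γ 0) := by
  have := h 0
  rw [quartic_at_zero, quartic_at_zero] at this
  linarith [(abs_le.1 this).2]

lemma IsUnitQuartic.logDeriv_close {β γ : Fin 5 → ℝ} {p δ : ℝ} (hβ : IsUnitQuartic β)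
    (hγ : IsUnitQuartic γ) (hp : 0 < p) (hpβ : p ≤ β 0) (hδ : δ ≤ √p / 2) (h : SqrtClose δ β γ) :
    |β 1 / β 0 - γ 1 / γ 0| ≤ 118 * δ / p :=
  quartic_logDeriv_close hp (fun t => (hβ t).1) (fun t => (hβ t).2) (fun t => (hγ t).1)
    (fun t => (hγ t).2) hpβ hδ h

/-- Two forms whose approximations, up to unknown scale factors, are close at the sampled angles
have close logarithmic derivatives. -/
lemma logDeriv_close_of_scaled {β β' γ γ' : Fin 5 → ℝ} {κ μ p δ : ℝ} (hp : 0 < p)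
    (hβ : IsUnitQuartic β) (hβ' : IsUnitQuartic β') (hγ : IsUnitQuartic γ) (hγ' : IsUnitQuartic γ')
    (hpβ : p ≤ β 0) (hpγ : p ≤ γ 0) (hκ : 1 / 4 ≤ κ) (hκ1 : κ ≤ 1) (hμ : 0 ≤ μ) (hμ1 : μ ≤ 1)
    (hδ : δ ≤ √p / 8) (h1 : SqrtClose δ β β') (h2 : SqrtClose δ γ γ')
    (h3 : SqrtClose δ (fun i => κ * β' i) (fun i => μ * γ' i)) :
    |β 1 / β 0 - γ 1 / γ 0| ≤ 2124 * δ / p := by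
  -- The comparison passes through $\beta$, $\beta'$, $\gamma'$, $\gamma$. The middle step compares
  -- $\kappa\beta'$ with $\mu\gamma'$, whose scales cancel from the ratios; since $\kappa\beta'_0\ge
  -- p/16$, that step costs sixteen times as much: $118+16\cdot118+118=2124$.
  have hsp : 0 < √p := Real.sqrt_pos.2 hp
  have e1 := hβ.logDeriv_close hβ' hp hpβ (by linarith) h1
  have e2 := hγ.logDeriv_close hγ' hp hpγ (by linarith) h2
  have hβ0 : √p / 2 ≤ √(β' 0) := by
    have := h1.sqrt_le
    have := Real.sqrt_le_sqrt hpβ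
    linarith
  have hβ0' : p / 4 ≤ β' 0 := by
    have h := Real.sq_sqrt (hβ' (shiftAngle 0)).1
    rw [quartic_at_zero] at h
    have h' := Real.sq_sqrt hp.le
    nlinarith
  have hs : √(p / 16) = √p / 4 := by
    rw [Real.sqrt_div hp.le, show (16 : ℝ) = 4 ^ 2 by norm_num, Real.sqrt_sq (by norm_num)]
  have hκβ : p / 16 ≤ κ * β' 0 := by nlinarith
  have e3 := (hβ'.smul (by linarith) hκ1).logDeriv_close (hγ'.smul hμ hμ1) (p := p / 16)
    (by positivity) hκβ (by rw [hs]; linarith) h3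
  -- A vanishing $\mu$ would put zero within $\delta\le\sqrt p/8$ of $\sqrt{\kappa\beta'_0}\ge\sqrt
  -- p/4$.
  have hμ0 : μ ≠ 0 := by
    rintro rfl
    have h := h3.sqrt_le
    have := Real.sqrt_le_sqrt hκβ
    rw [hs] at this
    simp only [zero_mul, Real.sqrt_zero] at h
    linarith
  simp only [mul_div_mul_left _ _ (show κ ≠ 0 by linarith), mul_div_mul_left _ _ hμ0] at e3
  have e4 : 118 * δ / (p / 16) = 1888 * δ / p := by field_simp; ring
  have e5 : 2124 * δ / p = 118 * δ / p + 1888 * δ / p + 118 * δ / p := by ring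
  rw [e4] at e3
  rw [e5]
  rw [abs_le] at *
  constructor <;> linarith [e1.1, e1.2, e2.1, e2.2, e3.1, e3.2]

/-! ### The responses of an instance -/

namespace ThermalInstance

open scoped Matrix.Norms.Frobenius

variable {nv nh N L : ℕ} (I : ThermalInstance nv nh N L)

/-- The overlap of the squared output state with `X X†`, normalized. -/
def relOverlap (θ : Fin N → ℝ) (X : QOp (Fin nv)) : ℝ := ‖I.sigma θ * X‖ ^ 2 / ‖X‖ ^ 2

lemma relOverlap_nonneg (θ : Fin N → ℝ) (X : QOp (Fin nv)) : 0 ≤ I.relOverlap θ X := by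
  unfold relOverlap; positivity

lemma relOverlap_le_one (θ : Fin N → ℝ) (X : QOp (Fin nv)) : I.relOverlap θ X ≤ 1 := by
  refine div_le_one_of_le₀ ?_ (by positivity)
  gcongr
  exact I.norm_sigma_mul_le θ X

lemma sqrt_relOverlap (θ : Fin N → ℝ) (X : QOp (Fin nv)) :
    √(I.relOverlap θ X) = ‖I.sigma θ * X‖ / ‖X‖ := by
  rw [relOverlap, ← div_pow, Real.sqrt_sq (by positivity)]

lemma exists_isUnitQuartic (θ : Fin N → ℝ) (k : Fin N) (X : QOp (Fin nv)) :
    ∃ β, IsUnitQuartic β ∧ ∀ t, I.relOverlap (Function.update θ k (θ k + t)) X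
      = quartic β (Real.cos t) (Real.sin t) := by
  obtain ⟨β, hβ⟩ := I.exists_quartic_norm_sigma_mul θ k X
  have h : ∀ t, I.relOverlap (Function.update θ k (θ k + t)) X
      = quartic (fun i => (‖X‖ ^ 2)⁻¹ * β i) (Real.cos t) (Real.sin t) := fun t => by
    rw [quartic_smul, ← hβ, relOverlap, div_eq_inv_mul]
  exact ⟨_, fun t => ⟨h t ▸ I.relOverlap_nonneg _ _, h t ▸ I.relOverlap_le_one _ _⟩, h⟩

lemma norm_halfTrunc_sub_le_of_le {K : ℕ} {A δ : ℝ} (hA : I.alphaNorm ≤ A)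
    (hK : 2 * Real.exp (2 * A) / 2 ^ K ≤ δ) :
    ‖I.halfTrunc K - halfExp I.ham‖ ≤ δ / 2 * ‖halfExp I.ham‖ := by
  refine (I.norm_halfTrunc_sub_le_mul K).trans (mul_le_mul_of_nonneg_right ?_ (norm_nonneg _))
  calc Real.exp (2 * I.alphaNorm) / 2 ^ K ≤ Real.exp (2 * A) / 2 ^ K := by gcongr
    _ ≤ δ / 2 := by rw [mul_div_assoc] at hK; linarith

lemma half_norm_halfExp_le {K : ℕ} {A δ : ℝ} (hA : I.alphaNorm ≤ A)
    (hK : 2 * Real.exp (2 * A) / 2 ^ K ≤ δ) (hδ : δ ≤ 1) :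
    ‖halfExp I.ham‖ / 2 ≤ ‖I.halfTrunc K‖ := by
  have h1 := I.norm_halfTrunc_sub_le_of_le hA hK
  have h2 := norm_sub_norm_le (halfExp I.ham) (I.halfTrunc K)
  rw [norm_sub_rev] at h2
  nlinarith [norm_nonneg (halfExp I.ham)]

/-- As $\sigma_v$ does not increase Frobenius norms, numerator and denominator each contribute a
relative error of at most $\delta/2$. -/
lemma abs_sqrt_relOverlap_sub_le {K : ℕ} {A δ : ℝ} (hA : I.alphaNorm ≤ A)
    (hK : 2 * Real.exp (2 * A) / 2 ^ K ≤ δ) (θ : Fin N → ℝ) :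
    |√(I.relOverlap θ (halfExp I.ham)) - √(I.relOverlap θ (I.halfTrunc K))| ≤ δ := by
  rw [sqrt_relOverlap, sqrt_relOverlap, abs_sub_comm]
  have hE := trace_exp_pos I.ham
  refine (abs_norm_div_sub_norm_div_le (I.norm_sigma_mul_le θ _) hE).trans ?_
  rw [← Matrix.mul_sub, div_le_iff₀ hE]
  have h1 := I.norm_halfTrunc_sub_le_of_le hA hK
  have h2 := I.norm_sigma_mul_le θ (I.halfTrunc K - halfExp I.ham)
  linarith

/-- The success amplitude is $2^{-n_v/2}s^{-1}\|T\|$, where $s\le e^{A/2}$ and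
$\|T\|\ge\frac12\|e^{H/2}\|\ge\frac12\sqrt Z$. This gives the number $D$ of inner rounds. -/
lemma one_le_encNorm_mul {K : ℕ} {A Z δ : ℝ} (hA : I.alphaNorm ≤ A) (hZ : 0 < Z)
    (hZI : Z ≤ I.partition) (hK : 2 * Real.exp (2 * A) / 2 ^ K ≤ δ) (hδ : δ ≤ 1) :
    1 ≤ 2 * √(Real.exp A * 2 ^ nv / Z) * (encNorm I K * ‖I.halfTrunc K‖) := by
  have hT := I.half_norm_halfExp_le hA hK hδ
  have hE : √Z ≤ ‖halfExp I.ham‖ := by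
    rw [← Real.sqrt_sq (norm_nonneg (halfExp I.ham)), ← partition_eq]
    exact Real.sqrt_le_sqrt hZI
  have hs : prepNorm I.α K ≤ Real.exp (A / 2) :=
    (prepNorm_le_exp I.α K).trans (Real.exp_le_exp.2 (by have : ∑ l, |I.α l| ≤ A := hA; linarith))
  have hs0 := prepNorm_pos I.α K
  have hp : √(2 ^ nv) * pairAmp nv = 1 := by
    rw [← Real.sqrt_sq (show 0 ≤ pairAmp nv by unfold pairAmp; positivity), pairAmp_sq,
      ← Real.sqrt_mul (by positivity), mul_one_div_cancel (by positivity), Real.sqrt_one]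
  have he : √(Real.exp A) = Real.exp (A / 2) := (Real.exp_half A).symm
  rw [Real.sqrt_div (by positivity), Real.sqrt_mul (by positivity), he, encNorm]
  calc (1 : ℝ) ≤ (Real.exp (A / 2) / prepNorm I.α K) * (2 * ‖I.halfTrunc K‖ / √Z) := by
        refine one_le_mul_of_one_le_of_one_le ((one_le_div hs0).2 hs) ?_
        rw [one_le_div (Real.sqrt_pos.2 hZ)]
        linarith
    _ = (√(2 ^ nv) * pairAmp nv) * ((Real.exp (A / 2) / prepNorm I.α K)
          * (2 * ‖I.halfTrunc K‖ / √Z)) := by rw [hp, one_mul]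
    _ = _ := by ring

end ThermalInstance

/-- Some power of three rotates a given angle far from the multiples of `π`. -/
lemma exists_three_pow_sin_sq {J : ℕ} {χ : ℝ} (h1 : Real.pi / 6 ≤ 3 ^ J * χ) (h2 : χ ≤ Real.pi / 2) :
    ∃ j ≤ J, 1 / 4 ≤ Real.sin (3 ^ j * χ) ^ 2 := by
  classical
  have hex : ∃ j, Real.pi / 6 ≤ 3 ^ j * χ := ⟨J, h1⟩
  -- The first $j$ that reaches $\pi/6$: its predecessor is still below $\pi/6$, so the angle does
  -- not exceed $\pi/2$.
  refine ⟨Nat.find hex, Nat.find_min' hex h1, ?_⟩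
  have hge := Nat.find_spec hex
  have hle : 3 ^ Nat.find hex * χ ≤ Real.pi / 2 := by
    rcases h : Nat.find hex with _ | j
    · simpa using h2
    · have := Nat.find_min hex (m := j) (by omega)
      push Not at this
      rw [pow_succ]
      linarith
  have hs : Real.sin (Real.pi / 6) ≤ Real.sin (3 ^ Nat.find hex * χ) :=
    Real.sin_le_sin_of_le_of_le_pi_div_two (by linarith [Real.pi_pos]) hle hge
  rw [Real.sin_pi_div_six] at hs
  nlinarith

/-! ### The estimation algorithm -/

namespace ThermalInstance

open scoped Matrix.Norms.Frobenius

variable {nv nh N L : ℕ} (I : ThermalInstance nv nh N L)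

/-- The probability that an experiment raises its flag. -/
def signal (θ : Fin N → ℝ) (K ri ro : ℕ) : ℝ :=
  Real.sin ((2 * ro + 1 : ℕ) * Real.arcsin √(markedProb I θ K ri)) ^ 2

lemma markedProb_eq (θ : Fin N → ℝ) (K ri : ℕ) : markedProb I θ K ri
    = Real.sin ((2 * ri + 1 : ℕ) * encAngle I K) ^ 2 * I.relOverlap θ (I.halfTrunc K) := rfl

/-- The conditions under which the estimate has to be correct. -/
structure IsAdmissible (θ : Fin N → ℝ) (A Z p : ℝ) : Prop where
  alphaNorm_le : I.alphaNorm ≤ A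
  le_partition : Z ≤ I.partition
  le_normOverlap : p ≤ I.normOverlap θ

variable {I} {θ : Fin N → ℝ} {k : Fin N} {A Z p δ : ℝ} {J M K : ℕ}

lemma IsAdmissible.le_coeff_zero (hI : I.IsAdmissible θ A Z p) {β : Fin 5 → ℝ}
    (hβ : ∀ t, I.relOverlap (Function.update θ k (θ k + t)) (halfExp I.ham)
      = quartic β (Real.cos t) (Real.sin t)) : p ≤ β 0 := by
  have h := hβ 0
  rw [add_zero, Function.update_eq_self, Real.cos_zero, Real.sin_zero] at h
  have h' : β 0 = I.normOverlap θ := by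
    rw [I.normOverlap_eq (I.sigma_isHermitian θ), ← relOverlap, h]; simp [quartic]
  rw [h']
  exact hI.le_normOverlap

lemma hasDerivAt_renyiTwo_of_relOverlap {β : Fin 5 → ℝ}
    (hβ : ∀ t, I.relOverlap (Function.update θ k (θ k + t)) (halfExp I.ham)
      = quartic β (Real.cos t) (Real.sin t)) (h0 : 0 < β 0) :
    HasDerivAt (fun t => renyiTwo (I.sigma (Function.update θ k t)) I.target) (β 1 / β 0) (θ k) := by
  have hE : 0 < ‖halfExp I.ham‖ ^ 2 := pow_pos (trace_exp_pos I.ham) 2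
  have h := I.hasDerivAt_renyiTwo θ k (β := fun i => ‖halfExp I.ham‖ ^ 2 * β i)
    (fun t => by rw [quartic_smul, ← hβ, relOverlap, mul_div_cancel₀ _ hE.ne']) (mul_pos hE h0)
  rwa [mul_div_mul_left _ _ hE.ne'] at h

/-- The angle is at least its sine, hence at least $1/(2D)$, so multiplication by $3^M\ge2D$ brings
it to $1\ge\pi/6$. Which power of three is good depends on the instance. -/
lemma IsAdmissible.exists_good_rotation (hI : I.IsAdmissible θ A Z p) (hZ : 0 < Z)
    (hM : 2 * √(Real.exp A * 2 ^ nv / Z) ≤ 3 ^ M) (hK : 2 * Real.exp (2 * A) / 2 ^ K ≤ δ)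
    (hδ : δ ≤ 1) : ∃ j ≤ M, 1 / 4 ≤ Real.sin ((2 * (3 ^ j / 2) + 1 : ℕ) * encAngle I K) ^ 2 := by
  -- With natural division, $3^j/2$ rounds multiply the angle by exactly $3^j$.
  have hodd : ∀ j : ℕ, 2 * (3 ^ j / 2) + 1 = 3 ^ j := fun j =>
    Nat.two_mul_div_two_add_one_of_odd (Odd.pow (by decide))
  simp only [hodd]
  push_cast
  apply exists_three_pow_sin_sq _ (Real.arcsin_le_pi_div_two _)
  have h1 := I.one_le_encNorm_mul hI.alphaNorm_le hZ hI.le_partition hK hδ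
  have h3 : (1 : ℝ) ≤ 3 ^ M := one_le_pow₀ (by norm_num)
  have hpi := Real.pi_lt_four
  obtain ⟨τ, hτ⟩ : ∃ τ, τ = encNorm I K * ‖I.halfTrunc K‖ := ⟨_, rfl⟩
  rw [← hτ] at h1 ⊢
  have hτ0 : 0 ≤ τ := by
    rw [hτ]; exact mul_nonneg (encNorm_pos I K).le (norm_nonneg _)
  rcases le_total τ 1 with h | h
  · have h2 : τ ≤ Real.arcsin τ := by
      conv_lhs => rw [← Real.sin_arcsin (by linarith) h]
      exact Real.sin_le (Real.arcsin_nonneg.2 hτ0)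
    calc Real.pi / 6 ≤ 1 := by linarith
      _ ≤ _ := h1
      _ ≤ 3 ^ M * Real.arcsin τ := by gcongr
  · rw [Real.arcsin_of_one_le h]
    have := Real.pi_pos
    nlinarith

/-- The signals are the squared sines of odd multiples of the angle $\arcsin\sqrt q$, where $q$ is
the marked probability. So `angle_close` bounds the difference of the angles, and the sine is
1-Lipschitz. -/
lemma abs_sqrt_markedProb_sub_le {I' : ThermalInstance nv nh N L} {ri : ℕ}
    (h : ∀ i ≤ J, ∀ j ≤ J, |I.signal θ K ri (powOffset i + powOffset j)
      - I'.signal θ K ri (powOffset i + powOffset j)| ≤ 1 / 64) :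
    |√(markedProb I θ K ri) - √(markedProb I' θ K ri)| ≤ 1 / 2 ^ J := by
  have hle : ∀ I : ThermalInstance nv nh N L, √(markedProb I θ K ri) ≤ 1 := fun I => by
    rw [← Real.sqrt_one, markedProb_eq]
    apply Real.sqrt_le_sqrt
    exact mul_le_one₀ (Real.sin_sq_le_one _) (I.relOverlap_nonneg _ _) (I.relOverlap_le_one _ _)
  have hge : ∀ I : ThermalInstance nv nh N L, 0 ≤ √(markedProb I θ K ri) := fun I => Real.sqrt_nonneg _
  have hs : ∀ I : ThermalInstance nv nh N L,
      Real.sin (Real.arcsin √(markedProb I θ K ri)) = √(markedProb I θ K ri) := fun I =>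
    Real.sin_arcsin (by linarith [hge I]) (hle I)
  rw [← hs I, ← hs I']
  exact (Real.abs_sin_sub_sin_le _ _).trans
    (angle_close (Real.arcsin_nonneg.2 (hge I)) (Real.arcsin_le_pi_div_two _)
      (Real.arcsin_nonneg.2 (hge I')) (Real.arcsin_le_pi_div_two _) h)

/-- Instances that the experiments cannot tell apart have close derivatives. -/
lemma abs_deriv_sub_le_of_signal_close {I' : ThermalInstance nv nh N L}
    (hI : I.IsAdmissible θ A Z p) (hI' : I'.IsAdmissible θ A Z p) (hp : 0 < p) (hZ : 0 < Z)
    (hM : 2 * √(Real.exp A * 2 ^ nv / Z) ≤ 3 ^ M) (hK : 2 * Real.exp (2 * A) / 2 ^ K ≤ δ)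
    (hJ : 1 / 2 ^ J ≤ δ) (hδ : δ ≤ 1) (hδp : δ ≤ √p / 8) {g g' : ℝ}
    (hg : HasDerivAt (fun t => renyiTwo (I.sigma (Function.update θ k t)) I.target) g (θ k))
    (hg' : HasDerivAt (fun t => renyiTwo (I'.sigma (Function.update θ k t)) I'.target) g' (θ k))
    (h : ∀ (i : Fin 5), ∀ j ≤ M, ∀ i₁ ≤ J, ∀ i₂ ≤ J,
      |I.signal (Function.update θ k (θ k + shiftAngle i)) K (3 ^ j / 2) (powOffset i₁ + powOffset i₂)
        - I'.signal (Function.update θ k (θ k + shiftAngle i)) K (3 ^ j / 2)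
          (powOffset i₁ + powOffset i₂)| ≤ 1 / 64) :
    |g - g'| ≤ 2124 * δ / p := by
  obtain ⟨β, uβ, hβ⟩ := I.exists_isUnitQuartic θ k (halfExp I.ham)
  obtain ⟨β', uβ', hβ'⟩ := I.exists_isUnitQuartic θ k (I.halfTrunc K)
  obtain ⟨γ, uγ, hγ⟩ := I'.exists_isUnitQuartic θ k (halfExp I'.ham)
  obtain ⟨γ', uγ', hγ'⟩ := I'.exists_isUnitQuartic θ k (I'.halfTrunc K)
  have pβ := hI.le_coeff_zero hβ
  have pγ := hI'.le_coeff_zero hγ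
  rw [hg.unique (hasDerivAt_renyiTwo_of_relOverlap hβ (by linarith)),
    hg'.unique (hasDerivAt_renyiTwo_of_relOverlap hγ (by linarith))]
  -- The depth $j$ is good for `I` only; for `I'` it suffices that its scale factor lies in $[0,1]$.
  -- Nothing has to find $j$, since the signals agree at all depths.
  obtain ⟨j, hj, hκ⟩ := hI.exists_good_rotation hZ hM hK hδ
  refine logDeriv_close_of_scaled hp uβ uβ' uγ uγ' pβ pγ hκ (Real.sin_sq_le_one _)
    (sq_nonneg (Real.sin ((2 * (3 ^ j / 2) + 1 : ℕ) * encAngle I' K))) (Real.sin_sq_le_one _) hδp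
    (fun i => ?_) (fun i => ?_) (fun i => ?_)
  · rw [← hβ, ← hβ']
    exact I.abs_sqrt_relOverlap_sub_le hI.alphaNorm_le hK _
  · rw [← hγ, ← hγ']
    exact I'.abs_sqrt_relOverlap_sub_le hI'.alphaNorm_le hK _
  · rw [quartic_smul, quartic_smul, ← hβ', ← hγ', ← markedProb_eq, ← markedProb_eq]
    exact (abs_sqrt_markedProb_sub_le (h i j hj)).trans hJ

end ThermalInstance

open ThermalInstance

lemma experiment_gates_le {nv w P J M ri ro : ℕ} (hro : 2 * ro ≤ 2 * 2 ^ J) (hri : 2 * ri + 1 ≤ 3 ^ M) :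
    P + ((2 * ro + 1) * ((2 * ri + 1) * (nv * 2) + ri * (2 * (6 * w + 1))) + ro * (2 * (6 * w + 1)))
      ≤ 2 ^ J * 3 ^ M * (P + 30 * w + 6 * nv + 5) := by
  have h2 : 1 ≤ 2 ^ J := Nat.one_le_two_pow
  have h3 : 1 ≤ 3 ^ M := Nat.one_le_pow _ _ (by norm_num)
  generalize 2 ^ J = a at *
  generalize 3 ^ M = b at *
  have hab : 1 ≤ a * b := Nat.mul_pos h2 h3
  have e1 : 2 * ro + 1 ≤ 3 * a := by omega
  calc P + ((2 * ro + 1) * ((2 * ri + 1) * (nv * 2) + ri * (2 * (6 * w + 1))) + ro * (2 * (6 * w + 1)))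
      = P * 1 + ((2 * ro + 1) * ((2 * ri + 1) * (nv * 2) + (2 * ri) * (6 * w + 1))
        + ((2 * ro) * 1) * (6 * w + 1)) := by ring
    _ ≤ P * (a * b) + ((3 * a) * (b * (nv * 2) + b * (6 * w + 1)) + ((2 * a) * b) * (6 * w + 1)) := by
        gcongr
        omega
    _ = a * b * (P + 30 * w + 6 * nv + 5) := by ring

lemma experiment_queries_le {N J M K ri ro : ℕ} (hro : 2 * ro ≤ 2 * 2 ^ J) (hri : 2 * ri + 1 ≤ 3 ^ M) :
    (2 * ro + 1) * ((2 * ri + 1) * (K + 2) + 2 * N) ≤ 3 * 2 ^ J * (K + 2) * (3 ^ M + N) := by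
  have h2 : 1 ≤ 2 ^ J := Nat.one_le_two_pow
  calc (2 * ro + 1) * ((2 * ri + 1) * (K + 2) + 2 * N)
      ≤ (3 * 2 ^ J) * (3 ^ M * (K + 2) + (K + 2) * N) := by
        gcongr
        · omega
        · omega
    _ = _ := by ring

open scoped Matrix.Norms.Frobenius in
/-- The algorithm in terms of the numbers of amplification rounds and the truncation order. -/
lemma exists_estimation_algorithm {nv nh N L : ℕ} (θ : Fin N → ℝ) (k : Fin N) {ε A Z p δ : ℝ}
    {J M K : ℕ} (hp : 0 < p) (hZ : 0 < Z)
    (hM : 2 * √(Real.exp A * 2 ^ nv / Z) ≤ 3 ^ M) (hK : 2 * Real.exp (2 * A) / 2 ^ K ≤ δ)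
    (hJ : 1 / 2 ^ J ≤ δ) (hδ : δ ≤ 1) (hδp : δ ≤ √p / 8) (hδε : 2124 * δ / p ≤ ε) :
    ∃ Q : QAlgorithm nv nh N L,
      Q.queryCount ≤ 65536 * (5 * ((M + 1) * ((J + 1) * (J + 1)))) ^ 2
        * (3 * 2 ^ J * (K + 2) * (3 ^ M + N)) ∧
      Q.gateCount ≤ 65536 * (5 * ((M + 1) * ((J + 1) * (J + 1)))) ^ 2
        * (2 ^ J * 3 ^ M * (Nat.clog 2 N + 31 * Fintype.card (Work nv nh L K) + 6 * nv + 6)) ∧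
      ∀ I : ThermalInstance nv nh N L, I.IsAdmissible θ A Z p →
        ∃ g : ℝ,
          HasDerivAt (fun t => renyiTwo (I.sigma (Function.update θ k t)) I.target) g (θ k) ∧
          2 / 3 < Q.prob I {x | |x - g| ≤ ε} := by
  classical
  obtain ⟨P, hPdef⟩ : ∃ P, P = Nat.clog 2 N + (Fintype.card (Work nv nh L K) + 1) := ⟨_, rfl⟩
  -- One experiment per shift of $\theta_k$, inner depth, and pair of offsets for the outer depth.
  let E := Fin 5 × (Fin (M + 1) × (Fin (J + 1) × Fin (J + 1)))
  have hcard : Fintype.card E = 5 * ((M + 1) * ((J + 1) * (J + 1))) := by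
    simp only [E, Fintype.card_prod, Fintype.card_fin]
  let sig : ThermalInstance nv nh N L → E → ℝ := fun I e =>
    I.signal (Function.update θ k (θ k + shiftAngle e.1)) K (3 ^ (e.2.1 : ℕ) / 2)
      (powOffset e.2.2.1 + powOffset e.2.2.2)
  have hexp : ∀ e : E, ∃ c : List (Gate nv nh N L (Work nv nh L K ⊕ Anc P)),
      circGates c ≤ 2 ^ J * 3 ^ M * (P + 30 * Fintype.card (Work nv nh L K) + 6 * nv + 5) ∧
      circQueries c ≤ 3 * 2 ^ J * (K + 2) * (3 ^ M + N) ∧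
      ∀ I : ThermalInstance nv nh N L, ‖I.halfTrunc K‖ ≠ 0 →
        ∑ x, ‖(circOp I c *ᵥ zeroKet _) x‖ ^ 2 * zeroFlag P (flagWires nv nh L K) x = sig I e := by
    rintro ⟨i, j, i₁, i₂⟩
    have hro : 2 * (powOffset i₁ + powOffset i₂) ≤ 2 * 2 ^ J := by
      have := powOffset_le (Nat.lt_succ_iff.1 i₁.2)
      have := powOffset_le (Nat.lt_succ_iff.1 i₂.2)
      omega
    have hri : 2 * (3 ^ (j : ℕ) / 2) + 1 ≤ 3 ^ M := by
      rw [Nat.two_mul_div_two_add_one_of_odd (Odd.pow (by decide))]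
      exact Nat.pow_le_pow_right (by norm_num) (Nat.lt_succ_iff.1 j.2)
    obtain ⟨R, hR, hRI⟩ := exists_experiment (nv := nv) (nh := nh) (L := L) (K := K) (P := P)
      (by omega) (by omega) (Function.update θ k (θ k + shiftAngle i)) (3 ^ (j : ℕ) / 2)
      (powOffset i₁ + powOffset i₂)
    obtain ⟨c, h1, h2, h3⟩ := hR.exists_circuit
    refine ⟨c, h1.trans (experiment_gates_le hro hri), h2.trans (experiment_queries_le hro hri),
      fun I hT => ?_⟩
    rw [h3, sum_withAnc_zeroFlag]
    exact (hRI I hT).2.2.2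
  choose c hc1 hc2 hc3 using hexp
  have hT : ∀ I : ThermalInstance nv nh N L, I.IsAdmissible θ A Z p → ‖I.halfTrunc K‖ ≠ 0 := by
    intro I hI
    have := I.half_norm_halfExp_le hI.alphaNorm_le hK hδ
    have := trace_exp_pos I.ham
    linarith
  have hg : ∀ I : ThermalInstance nv nh N L, I.IsAdmissible θ A Z p → ∃ g : ℝ,
      HasDerivAt (fun t => renyiTwo (I.sigma (Function.update θ k t)) I.target) g (θ k) := by
    intro I hI
    obtain ⟨β, -, hβ⟩ := I.exists_isUnitQuartic θ k (halfExp I.ham)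
    exact ⟨_, hasDerivAt_renyiTwo_of_relOverlap hβ (hp.trans_le (hI.le_coeff_zero hβ))⟩
  -- The derivatives compatible with observed frequencies `y`; the output is any one of them.
  let cand : (E → ℝ) → ℝ → Prop := fun y g => ∃ I : ThermalInstance nv nh N L,
    I.IsAdmissible θ A Z p ∧
    HasDerivAt (fun t => renyiTwo (I.sigma (Function.update θ k t)) I.target) g (θ k) ∧
    ∀ e, |y e - sig I e| ≤ 1 / 128
  -- The least number of samples for which the Chebyshev bound at accuracy $1/128$ is strictly below
  -- $1/3$.
  let n := 3 * Fintype.card E * 128 ^ 2 + 1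
  obtain ⟨Q, hQg, hQq, hQ⟩ := exists_sampling_algorithm (n := n) (Nat.succ_pos _) c
    (h := zeroFlag P (flagWires nv nh L K))
    (fun y => by unfold zeroFlag; split_ifs <;> norm_num)
    (fun y => by unfold zeroFlag; split_ifs <;> norm_num)
    (fun y => if h : ∃ g, cand y g then h.choose else 0)
  have hpos : 0 < Fintype.card E := by rw [hcard]; positivity
  have hnE : ∀ (f : E → ℕ) (b : ℕ), (∀ e, f e ≤ b) →
      n * ∑ e, f e ≤ 65536 * (5 * ((M + 1) * ((J + 1) * (J + 1)))) ^ 2 * b := by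
    intro f b hf
    rw [← hcard]
    calc n * ∑ e, f e ≤ (65536 * Fintype.card E) * (Fintype.card E * b) := by
          gcongr
          · simp only [n]; omega
          · exact (Finset.sum_le_sum fun e _ => hf e).trans (by simp)
      _ = _ := by ring
  refine ⟨Q, hQq ▸ hnE _ _ hc2, hQg ▸ hnE _ _ fun e => (hc1 e).trans (le_of_eq ?_), fun I hI => ?_⟩
  · rw [hPdef]; ring
  obtain ⟨g, hgI⟩ := hg I hI
  refine ⟨g, hgI, lt_of_lt_of_le ?_ (hQ I {x | |x - g| ≤ ε} (1 / 128) (by norm_num) fun y hy => ?_)⟩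
  · have hE : (0 : ℝ) < Fintype.card E := by exact_mod_cast hpos
    have : (Fintype.card E : ℝ) / (n * (1 / 128) ^ 2) < 1 / 3 := by
      rw [div_lt_iff₀ (by positivity)]
      simp only [n]
      push_cast
      linarith
    linarith
  · simp only [fun e => hc3 e I (hT I hI)] at hy
    have hex : ∃ g, cand y g := ⟨g, I, hI, hgI, hy⟩
    rw [dif_pos hex]
    -- The true and the chosen instance are both within $1/128$ of the observations, hence within
    -- $1/64$ of each other.
    obtain ⟨I', hI', hgI', hy'⟩ := hex.choose_spec
    refine (abs_deriv_sub_le_of_signal_close hI' hI hp hZ hM hK hJ hδ hδp hgI' hgI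
      fun i j hj i₁ h₁ i₂ h₂ => ?_).trans hδε
    have a1 := hy' (i, ⟨j, by omega⟩, ⟨i₁, by omega⟩, ⟨i₂, by omega⟩)
    have a2 := hy (i, ⟨j, by omega⟩, ⟨i₁, by omega⟩, ⟨i₂, by omega⟩)
    simp only [sig] at a1 a2
    rw [abs_le] at *
    constructor <;> linarith [a1.1, a1.2, a2.1, a2.2]

/-! ### The choice of parameters and the costs -/

lemma natCast_le_two_mul_log {b n : ℕ} {x : ℝ} (hb : 2 ≤ b) (h : (b : ℝ) ^ n ≤ x) :
    (n : ℝ) ≤ 2 * Real.log x := by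
  have h2 : (2 : ℝ) ≤ b := by exact_mod_cast hb
  have h1 : Real.log ((b : ℝ) ^ n) ≤ Real.log x := Real.log_le_log (by positivity) h
  have h3 : Real.log 2 ≤ Real.log b := Real.log_le_log (by norm_num) h2
  rw [Real.log_pow] at h1
  have h4 := Real.log_two_gt_d9
  nlinarith [(Nat.cast_nonneg n : (0 : ℝ) ≤ n)]

lemma clog_le_log (n : ℕ) {x : ℝ} (hx : 1 ≤ x) (h : (n : ℝ) ≤ x) :
    (Nat.clog 2 n : ℝ) ≤ 1 + 2 * Real.log x := by
  have hl := Real.log_nonneg hx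
  rcases Nat.lt_or_ge 1 n with hn | hn
  · have h1 := Nat.pow_pred_clog_lt_self (b := 2) (by norm_num) hn
    have h2 := natCast_le_two_mul_log (b := 2) (n := (Nat.clog 2 n).pred) (x := x) le_rfl
      (le_trans (by exact_mod_cast h1.le) h)
    have h3 : (Nat.clog 2 n : ℝ) ≤ ((Nat.clog 2 n).pred : ℕ) + 1 := by
      exact_mod_cast (by rw [Nat.pred_eq_sub_one]; omega)
    linarith
  · rw [Nat.clog_of_right_le_one hn]
    push_cast
    linarith

lemma exists_pow_between {b : ℕ} (hb : 2 ≤ b) {x : ℝ} (hx : 1 ≤ x) :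
    ∃ n : ℕ, x ≤ (b : ℝ) ^ n ∧ (b : ℝ) ^ n ≤ b * x ∧ (n : ℝ) ≤ 1 + 2 * Real.log x := by
  obtain ⟨n, h1, h2⟩ := exists_nat_pow_near hx (y := (b : ℝ)) (by exact_mod_cast hb)
  refine ⟨n + 1, h2.le, ?_, ?_⟩
  · rw [pow_succ, mul_comm]; gcongr
  · have := natCast_le_two_mul_log hb h1
    push_cast
    linarith

lemma card_work (nv nh L K : ℕ) :
    Fintype.card (Work nv nh L K) = 3 * nv + nh + K + K * Nat.clog 2 L := by
  simp only [Work, PrepReg, Fintype.card_sum, Fintype.card_prod, Fintype.card_fin]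
  ring

/-- Squaring the number of experiments gives $\Lambda^6$ and the truncation order one more factor;
the eighth power is chosen to match the gate count. -/
lemma query_bound {J M K N : ℕ} {Λ S D : ℝ} (hΛ : 1 ≤ Λ) (hS : 0 ≤ S) (hD : 0 ≤ D)
    (hJ : (J : ℝ) ≤ 23 * Λ) (hM : (M : ℝ) ≤ 9 * Λ) (hK : (K : ℝ) ≤ 37 * Λ)
    (h2 : (2 : ℝ) ^ J ≤ 20000 * S) (h3 : (3 : ℝ) ^ M ≤ 6 * D) :
    ((65536 * (5 * ((M + 1) * ((J + 1) * (J + 1)))) ^ 2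
        * (3 * 2 ^ J * (K + 2) * (3 ^ M + N)) : ℕ) : ℝ) ≤ 10 ^ 26 * Λ ^ 8 * ((N + D) * S) := by
  push_cast
  calc (65536 * (5 * (((M : ℝ) + 1) * ((J + 1) * (J + 1)))) ^ 2
        * (3 * 2 ^ J * (K + 2) * (3 ^ M + N)) : ℝ)
      ≤ 65536 * (5 * ((10 * Λ) * ((24 * Λ) * (24 * Λ)))) ^ 2
        * (3 * (20000 * S) * (39 * Λ) * (6 * (N + D))) := by
        gcongr <;> linarith [(Nat.cast_nonneg N : (0 : ℝ) ≤ N)]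
    _ = (65536 * 28800 ^ 2 * (3 * 20000 * 39 * 6)) * Λ ^ 7 * ((N + D) * S) := by ring
    _ ≤ 10 ^ 26 * Λ ^ 8 * ((N + D) * S) := by
        gcongr
        · norm_num
        · norm_num

/-- The Prepare register has about $K\lceil\log_2L\rceil=O(\Lambda^2)$ qubits, which raises
$\Lambda^6$ to $\Lambda^8$. The terms without $n_v$, $n_h$ are absorbed through $L+n\ge1$. -/
lemma gate_bound {J M K nv nh L a b : ℕ} {Λ S D : ℝ} (hn : 1 ≤ L + (nv + nh)) (hΛ : 1 ≤ Λ)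
    (hS : 0 ≤ S) (hD : 0 ≤ D)
    (hJ : (J : ℝ) ≤ 23 * Λ) (hM : (M : ℝ) ≤ 9 * Λ) (hK : (K : ℝ) ≤ 37 * Λ) (ha : (a : ℝ) ≤ 3 * Λ)
    (hb : (b : ℝ) ≤ 3 * Λ) (h2 : (2 : ℝ) ^ J ≤ 20000 * S) (h3 : (3 : ℝ) ^ M ≤ 6 * D) :
    ((65536 * (5 * ((M + 1) * ((J + 1) * (J + 1)))) ^ 2
        * (2 ^ J * 3 ^ M * (a + 31 * (3 * nv + nh + K + K * b) + 6 * nv + 6)) : ℕ) : ℝ)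
      ≤ 10 ^ 26 * Λ ^ 8 * (((L + (nv + nh)) * D) * S) := by
  have hn' : (1 : ℝ) ≤ L + (nv + nh) := by exact_mod_cast hn
  have hL : (0 : ℝ) ≤ L := Nat.cast_nonneg L
  have hnh : (0 : ℝ) ≤ nh := Nat.cast_nonneg nh
  have hnv : (0 : ℝ) ≤ nv := Nat.cast_nonneg nv
  have hΛ2 : Λ ≤ Λ ^ 2 := by nlinarith
  have hsum : (a + 31 * (3 * nv + nh + K + K * b) + 6 * nv + 6 : ℝ)
      ≤ 10000 * Λ ^ 2 * (L + (nv + nh)) := by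
    have hKb : (K * b : ℝ) ≤ (37 * Λ) * (3 * Λ) := by gcongr
    have h1 : (a + 31 * (K + K * b) + 6 : ℝ) ≤ 5000 * Λ ^ 2 := by nlinarith
    have h4 : (5000 * Λ ^ 2 : ℝ) ≤ 5000 * Λ ^ 2 * (L + (nv + nh)) :=
      le_mul_of_one_le_right (by positivity) hn'
    have h5 : (L + (nv + nh) : ℝ) ≤ Λ ^ 2 * (L + (nv + nh)) :=
      le_mul_of_one_le_left (by linarith) (by linarith)
    nlinarith
  push_cast
  calc (65536 * (5 * (((M : ℝ) + 1) * ((J + 1) * (J + 1)))) ^ 2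
        * (2 ^ J * 3 ^ M * (a + 31 * (3 * nv + nh + K + K * b) + 6 * nv + 6)) : ℝ)
      ≤ 65536 * (5 * ((10 * Λ) * ((24 * Λ) * (24 * Λ)))) ^ 2
        * ((20000 * S) * (6 * D) * (10000 * Λ ^ 2 * (L + (nv + nh)))) := by
        gcongr <;> linarith
    _ = (65536 * 28800 ^ 2 * (20000 * 6 * 10000)) * Λ ^ 8 * (((L + (nv + nh)) * D) * S) := by ring
    _ ≤ 10 ^ 26 * Λ ^ 8 * (((L + (nv + nh)) * D) * S) := by
        gcongr
        norm_num

/-- The algorithm without wires that outputs zero. -/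
def zeroAlgorithm (nv nh N L : ℕ) : QAlgorithm nv nh N L := ⟨0, [], fun _ => 0⟩

lemma zeroAlgorithm_prob {nv nh N L : ℕ} (I : ThermalInstance nv nh N L) {S : Set ℝ} (hS : (0 : ℝ) ∈ S) :
    (zeroAlgorithm nv nh N L).prob I S = 1 := by
  classical
  have : ∀ x : Fin 0 → Bool, QAlgorithm.finalState (zeroAlgorithm nv nh N L) I x = 1 := fun x => by
    change (Pi.single (fun _ => false) 1 : (Fin 0 → Bool) → ℂ) x = 1
    rw [Subsingleton.elim x fun _ => false, Pi.single_eq_same]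
  refine (Fintype.sum_subsingleton (ι := Fin 0 → Bool) _ fun _ => false).trans ?_
  refine (if_pos hS).trans ?_
  have h := this fun _ => false
  rw [← one_pow 2, ← norm_one (α := ℂ), ← h]

lemma ThermalInstance.sigma_eq_one {nh N L : ℕ} (I : ThermalInstance 0 nh N L) (θ : Fin N → ℝ) :
    I.sigma θ = 1 := by
  have h := I.sigma_trace θ
  ext x y
  rw [Subsingleton.elim y x, Matrix.one_apply_eq, ← h, Matrix.trace, Fintype.sum_subsingleton _ x]
  rfl

/-- The numbers of amplification rounds and the truncation order. -/
lemma exists_parameters {ε p A Λ D : ℝ} (hε : 0 < ε) (hp : 0 < p) (hεp1 : ε * p ≤ 13 / 2)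
    (hA : 0 ≤ A) (hΛ : 1 ≤ Λ) (hAΛ : A ≤ 3 * Λ) (hεΛ : Real.log (1 / (ε * p)) ≤ Λ) (hD1 : 1 ≤ D)
    (hDA : D ≤ Real.exp A) : ∃ J M K : ℕ,
      1 / 2 ^ J ≤ ε * p / 10000 ∧ 2 * D ≤ 3 ^ M ∧ 2 * Real.exp (2 * A) / 2 ^ K ≤ ε * p / 10000 ∧
      J ≤ 23 * Λ ∧ M ≤ 9 * Λ ∧ K ≤ 37 * Λ ∧
      2 ^ J ≤ 20000 * (1 / (ε * p)) ∧ 3 ^ M ≤ 6 * D := by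
  have hεp : 0 < ε * p := mul_pos hε hp
  -- Small enough for $2124\,\delta/p\le\epsilon$ and, as $\epsilon\le13/2$ and $p\le1$, also for
  -- $\delta\le\sqrt p/8$.
  obtain ⟨δ, hδ⟩ : ∃ δ, δ = ε * p / 10000 := ⟨_, rfl⟩
  have hδ0 : 0 < δ := by rw [hδ]; positivity
  have hδ1 : 1 ≤ 1 / δ := by rw [le_div_iff₀ hδ0]; linarith
  rw [← hδ]
  have hδeq : 1 / δ = 10000 * (1 / (ε * p)) := by rw [hδ]; field_simp
  have hlog2 := Real.log_two_lt_d9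
  have hδlog : Real.log (1 / δ) ≤ 11 * Λ := by
    have h1 : Real.log 10000 ≤ Real.log (2 ^ 14) := Real.log_le_log (by norm_num) (by norm_num)
    rw [Real.log_pow] at h1
    push_cast at h1
    rw [hδeq, Real.log_mul (by norm_num) (by positivity)]
    linarith
  obtain ⟨J, hJ1, hJ2, hJ3⟩ := exists_pow_between (b := 2) le_rfl hδ1
  obtain ⟨M, hM1, hM2, hM3⟩ := exists_pow_between (b := 3) (by norm_num) (x := 2 * D) (by linarith)
  obtain ⟨K, hK1, -, hK3⟩ := exists_pow_between (b := 2) le_rfl (x := 2 * Real.exp (2 * A) * (1 / δ))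
    (by nlinarith [Real.one_le_exp (show 0 ≤ 2 * A by linarith)])
  push_cast at hJ1 hJ2 hM1 hM2 hK1
  -- $Z$ does not occur in $\Lambda$, so $\log D$ has to be controlled by $A$.
  have hMlog : Real.log (2 * D) ≤ 1 + 3 * Λ := by
    rw [Real.log_mul (by norm_num) (by linarith)]
    have := Real.log_le_log (by linarith) hDA
    rw [Real.log_exp] at this
    linarith
  have hKlog : Real.log (2 * Real.exp (2 * A) * (1 / δ)) ≤ 18 * Λ := by
    rw [Real.log_mul (by positivity) (by positivity), Real.log_mul (by norm_num) (by positivity),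
      Real.log_exp]
    linarith
  refine ⟨J, M, K, ?_, hM1, ?_, by linarith, by linarith, by linarith, ?_, by linarith⟩
  · rw [div_le_iff₀ (by positivity)]
    rw [div_le_iff₀ hδ0] at hJ1
    linarith
  · rw [div_le_iff₀ (by positivity)]
    rw [mul_one_div, div_le_iff₀ hδ0] at hK1
    linarith
  · rw [hδeq] at hJ2
    linarith

/-- The a priori lower bound on the partition function may be assumed to be at least
`exp (-A) * 2 ^ nv`. -/
lemma exists_partition_lower_bound {nv nh N L : ℕ} {A Z : ℝ} (hZ : 0 < Z)
    (hex : ∃ I : ThermalInstance nv nh N L, I.alphaNorm ≤ A ∧ Z ≤ I.partition) :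
    ∃ Y, 0 < Y ∧ (∀ I : ThermalInstance nv nh N L, I.alphaNorm ≤ A → Z ≤ I.partition → Y ≤ I.partition) ∧
      1 ≤ √(Real.exp A * 2 ^ nv / Y) ∧ √(Real.exp A * 2 ^ nv / Y) ≤ √(Real.exp A * 2 ^ nv / Z) ∧
      √(Real.exp A * 2 ^ nv / Y) ≤ Real.exp A := by
  have hY0 : 0 < max Z (Real.exp (-A) * 2 ^ nv) := lt_max_of_lt_left hZ
  have hYI : ∀ I : ThermalInstance nv nh N L, I.alphaNorm ≤ A → Z ≤ I.partition →
      max Z (Real.exp (-A) * 2 ^ nv) ≤ I.partition := by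
    intro I h1 h2
    refine max_le h2 (le_trans ?_ I.le_partition)
    gcongr
  refine ⟨_, hY0, hYI, ?_, ?_, ?_⟩
  · obtain ⟨I, h1, h2⟩ := hex
    rw [Real.one_le_sqrt, one_le_div hY0]
    refine (hYI I h1 h2).trans (I.partition_le.trans ?_)
    gcongr
  · apply Real.sqrt_le_sqrt
    gcongr
    exact le_max_left _ _
  · rw [Real.sqrt_le_left (by positivity), div_le_iff₀ hY0]
    calc Real.exp A * 2 ^ nv = Real.exp A ^ 2 * (Real.exp (-A) * 2 ^ nv) := by
          rw [Real.exp_neg]; field_simp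
      _ ≤ _ := by
          gcongr
          exact le_max_right _ _

end

theorem theorem5 :
    ∃ (C : ℝ) (c : ℕ), ∀ (nv nh N L : ℕ) (θ : Fin N → ℝ) (k : Fin N) (ε A Z p : ℝ),
      0 < ε → 0 < Z → 0 < p →
      ∃ Q : QAlgorithm nv nh N L,
        (Q.queryCount : ℝ) ≤
          C * Real.log (2 + N + L + nv + nh + Real.exp A * 2 ^ nv / (ε * p)) ^ c *
            ((N + √(Real.exp A * 2 ^ nv / Z)) / (ε * p)) ∧
        (Q.gateCount : ℝ) ≤
          C * Real.log (2 + N + L + nv + nh + Real.exp A * 2 ^ nv / (ε * p)) ^ c *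
            (((L + (nv + nh)) * √(Real.exp A * 2 ^ nv / Z)) / (ε * p)) ∧
        ∀ I : ThermalInstance nv nh N L,
          I.alphaNorm ≤ A → Z ≤ I.partition → p ≤ I.normOverlap θ →
          ε ≤ 13 / (2 * overlap (I.sigma θ) I.target) →
          ∃ g : ℝ,
            HasDerivAt (fun t => renyiTwo (I.sigma (Function.update θ k t)) I.target) g (θ k) ∧
            2 / 3 < Q.prob I {x | |x - g| ≤ ε} := by
  refine ⟨10 ^ 26, 8, fun nv nh N L θ k ε A Z p hε hZ hp => ?_⟩
  have hN : (1 : ℝ) ≤ N := by exact_mod_cast (Nat.one_le_iff_ne_zero.2 (by rintro rfl; exact k.elim0))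
  have hL : (0 : ℝ) ≤ L := Nat.cast_nonneg L
  have hnh : (0 : ℝ) ≤ nh := Nat.cast_nonneg nh
  have hnv : (0 : ℝ) ≤ nv := Nat.cast_nonneg nv
  obtain ⟨X, hX⟩ : ∃ X, X = 2 + N + L + nv + nh + Real.exp A * 2 ^ nv / (ε * p) := ⟨_, rfl⟩
  obtain ⟨B, hB⟩ : ∃ B, B = Real.exp A * 2 ^ nv := ⟨_, rfl⟩
  rw [← hX, ← hB]
  have hB0 : 0 < B := by rw [hB]; positivity
  have hεp : 0 < ε * p := mul_pos hε hp
  have hBX : B / (ε * p) ≤ X := by rw [hX, ← hB]; linarith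
  have hX3 : 3 ≤ X := by
    have : 0 < B / (ε * p) := by positivity
    rw [hX, ← hB]; linarith
  have hΛ : 1 ≤ Real.log X := by
    rw [Real.le_log_iff_exp_le (by linarith)]
    linarith [Real.exp_one_lt_d9]
  have htriv : (((zeroAlgorithm nv nh N L).queryCount : ℕ) : ℝ) ≤
      10 ^ 26 * Real.log X ^ 8 * ((N + √(B / Z)) / (ε * p)) ∧
      (((zeroAlgorithm nv nh N L).gateCount : ℕ) : ℝ) ≤
      10 ^ 26 * Real.log X ^ 8 * (((L + (nv + nh)) * √(B / Z)) / (ε * p)) := by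
    have h1 : (zeroAlgorithm nv nh N L).queryCount = 0 := rfl
    have h2 : (zeroAlgorithm nv nh N L).gateCount = 0 := rfl
    rw [h1, h2, Nat.cast_zero]
    constructor <;> positivity
  -- Without visible qubits $\sigma_v=1$ and the derivative is zero. The case is separate because
  -- the gate budget vanishes when $L=n=0$.
  rcases Nat.eq_zero_or_pos nv with rfl | hnv1
  · refine ⟨_, htriv.1, htriv.2, fun I _ _ _ _ => ⟨0, ?_, ?_⟩⟩
    · simp only [I.sigma_eq_one]
      exact hasDerivAt_const _ _
    · rw [zeroAlgorithm_prob I (by simpa using hε.le)]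
      norm_num
  -- If no instance satisfies the hypotheses, any algorithm will do. Otherwise one such instance
  -- forces $A\ge0$, $p\le1$, $\epsilon\le13/2$ and $D\ge1$, which the choice of parameters needs.
  by_cases hex : ∃ I : ThermalInstance nv nh N L, I.alphaNorm ≤ A ∧ Z ≤ I.partition ∧
      p ≤ I.normOverlap θ ∧ ε ≤ 13 / (2 * overlap (I.sigma θ) I.target)
  swap
  · exact ⟨_, htriv.1, htriv.2, fun I h1 h2 h3 h4 => (hex ⟨I, h1, h2, h3, h4⟩).elim⟩
  obtain ⟨I₀, hA₀, hZ₀, hp₀, hε₀⟩ := hex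
  have hA : 0 ≤ A := I₀.alphaNorm_nonneg.trans hA₀
  have hp1 : p ≤ 1 := by
    refine hp₀.trans ?_
    rw [I₀.normOverlap_eq (I₀.sigma_isHermitian θ)]
    exact I₀.relOverlap_le_one θ _
  have hε1 : ε ≤ 13 / 2 := by
    have h1 := one_le_overlap I₀.ham_isHermitian (I₀.sigma_isHermitian θ) (I₀.sigma_trace θ)
    refine hε₀.trans ?_
    rw [ThermalInstance.target]
    gcongr
    linarith
  obtain ⟨Y, hY0, hYI, hD1, hDZ, hDA⟩ := exists_partition_lower_bound hZ ⟨I₀, hA₀, hZ₀⟩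
  rw [← hB] at hD1 hDZ hDA
  have hsp : p ≤ √p := Real.le_sqrt_of_sq_le (by nlinarith)
  have hsp1 : √p ≤ 1 := by rw [← Real.sqrt_one]; exact Real.sqrt_le_sqrt hp1
  have hεp1 : ε * p ≤ 13 / 2 * p := by gcongr
  have h2nv : (1 : ℝ) ≤ 2 ^ nv := one_le_pow₀ (by norm_num)
  have hAB : Real.exp A ≤ B := by
    rw [hB]; exact le_mul_of_one_le_right (by positivity) h2nv
  -- $e^A\le B\le X\epsilon p\le X^3$, since $\epsilon p\le13/2\le X^2$.
  have hAlog : A ≤ 3 * Real.log X := by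
    have h2 : B ≤ X * (X * X) := by
      rw [div_le_iff₀ hεp] at hBX
      refine hBX.trans (mul_le_mul_of_nonneg_left ?_ (by linarith))
      nlinarith
    have h4 := Real.log_le_log (Real.exp_pos A) (hAB.trans h2)
    rw [Real.log_exp, Real.log_mul (by positivity) (by positivity),
      Real.log_mul (by positivity) (by positivity)] at h4
    linarith
  have hεlog : Real.log (1 / (ε * p)) ≤ Real.log X := by
    refine Real.log_le_log (by positivity) (le_trans ?_ hBX)
    gcongr
    exact (Real.one_le_exp hA).trans hAB
  obtain ⟨J, M, K, hJ1, hM1, hK1, hJ, hM, hK, h2J, h3M⟩ :=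
    exists_parameters hε hp (by linarith) hA hΛ hAlog hεlog hD1 hDA
  obtain ⟨Q, hQ1, hQ2, hQ⟩ := exists_estimation_algorithm (nh := nh) (L := L) θ k (ε := ε) hp hY0
    (hB ▸ hM1) hK1 hJ1 (by linarith) (by linarith)
    (by rw [div_le_iff₀ hp]; linarith)
  have hNX : (N : ℝ) ≤ X := by
    have : 0 < B / (ε * p) := by positivity
    rw [hX, ← hB]; linarith
  have hLX : (L : ℝ) ≤ X := by
    have : 0 < B / (ε * p) := by positivity
    rw [hX, ← hB]; linarith
  have hcN := clog_le_log N (by linarith) hNX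
  have hcL := clog_le_log L (by linarith) hLX
  have h3M' : (3 : ℝ) ^ M ≤ 6 * √(B / Z) := by linarith
  refine ⟨Q, ?_, ?_, fun I h1 h2 h3 _ => hQ I ⟨h1, hYI I h1 h2, h3⟩⟩
  · rw [← mul_one_div ((N : ℝ) + √(B / Z))]
    exact (Nat.cast_le.2 hQ1).trans
      (query_bound hΛ (by positivity) (by positivity) hJ hM hK h2J h3M')
  · rw [← mul_one_div (((L : ℝ) + (nv + nh)) * √(B / Z))]
    rw [card_work] at hQ2
    exact (Nat.cast_le.2 hQ2).trans (gate_bound (by omega) hΛ (by positivity) (by positivity)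
      hJ hM hK (by linarith) (by linarith) h2J h3M')
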